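/- **Theorem 2.1.** Let $M$ be a nonempty manifold of dimension $n\ge 1$, real or complex, of class $C^r$ with $r=\infty$ or $r=\omega$ (in the complex case: a complex manifold); all objects below are of class $C^r$, $d$ is a number of the ground field $\mathbb K=\mathbb R$ or $\mathbb C$, and repeated indices are summed. *Contravariant metrics.* A contravariant metric on $M$ is a symmetric bilinear form $(\,,)$ on $T^*M$ that is invertible on an open dense subset; put $g^{ij}=(dx^i,dx^j)$. Its contravariant Levi-Civita connection, required to be defined on all of $M$, consists of functions $\Gamma_k^{ij}$ on every coordinate patch such that $\Gamma_k^{ij}=-g^{is}\Gamma_{sk}^j$ wherever the metric is invertible, where $\Gamma_{sk}^j$ is the Levi-Civita connection of the inverse metric $(g_{ij})=(g^{ij})^{-1}$. The metric is flat if near every point where it is invertible there are $n$ functions $f$ with independent differentials $\xi=df$ satisfying $g^{is}\partial_s\xi_j+\Gamma_j^{is}\xi_s=0$. *Flat pencils.* Two contravariant metrics $(\,,)_1,(\,,)_2$ with contravariant Levi-Civita connections $\Gamma_1,\Gamma_2$ form a flat pencil if for every $\lambda\in\mathbb K$ the form $(\,,)_1-\lambda(\,,)_2$ is a flat contravariant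 metric with contravariant Levi-Civita connection $\Gamma_1-\lambda\Gamma_2$. The pencil is quasihomogeneous of degree $d$, by means of a function $\tau$ on $M$, if the vector fields $E=\nabla_1\tau$, $E^i=g_1^{is}\partial_s\tau$, and $e=\nabla_2\tau$, $e^i=g_2^{is}\partial_s\tau$, satisfy $$[e,E]=e,\quad \mathcal L_E(\,,)_1=(d-1)(\,,)_1,\quad \mathcal L_e(\,,)_1=(\,,)_2,\quad \mathcal L_e(\,,)_2=0 .$$ Let $M_0\subset M$ be the open dense set where $(\,,)_2$ is invertible. The pencil is regular if the $(1,1)$-tensor $R_i^j=\frac{d-1}{2}\delta_i^j+(\nabla_2)_iE^j$ is nondegenerate on $M_0$; it acts on 1-forms by $(Ru)_i=R_i^ju_j$. *Frobenius structures.* A Frobenius structure of charge $d$ on an open subset $U\subset M$ consists of a commutative associative multiplication with unity $e$ on the tangent spaces, a symmetric nondegenerate bilinear form $\langle\,,\rangle$ on them with $\langle a\cdot b,c\rangle=\langle a,b\cdot c\rangle$, and an Euler vector field $E$ such that: the curvature of the Levi-Civita connection $\nabla$ of $\langle\,,\rangle$ vanishes and $\nabla e=0$; for $c(u,v,w)=\langle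 u\cdot v,w\rangle$ the four-linear form $(\nabla_zc)(u,v,w)$ is symmetric; $\nabla\nabla E=0$; and for all vector fields $a,b$ on open subsets of $U$, with $Q(a)=a+[E,a]$, $$Q(a\cdot b)=Q(a)\cdot b+a\cdot Q(b),\qquad E\langle a,b\rangle+d\,\langle a,b\rangle=\langle Q(a),b\rangle+\langle a,Q(b)\rangle .$$ Vectors and covectors are identified by $\langle\,,\rangle$, so that covectors can be multiplied and paired; the intersection form is $(\omega_1,\omega_2)=i_E(\omega_1\cdot\omega_2)$. *Claim.* Let $M$ carry a regular quasihomogeneous flat pencil of degree $d$, with function $\tau$. On $M_0$ let $\Delta(u,v)_k=u_iv_j\Delta_k^{ij}$, where $\Delta_i^{jk}=g_{2\,is}\Delta^{sjk}$, $\Delta^{ijk}=g_2^{js}\Gamma_{1\,s}^{ik}-g_1^{is}\Gamma_{2\,s}^{jk}$, and define a multiplication of 1-forms on $M_0$ by $$u\cdot v:=\Delta(u,R^{-1}v).$$ Then there exists a unique Frobenius structure on $M_0$ such that $\langle\,,\rangle=(\,,)_2$ as bilinear forms on $T^*M_0$, the multiplication of tangent vectors is $\langle\,,\rangle$-dual to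 this multiplication of 1-forms, the unity and Euler vector fields are $\nabla_2\tau$ and $\nabla_1\tau$ respectively, and the intersection form is $(\,,)_1$. Its charge is $d$. -/

import Mathlib

open scoped Manifold ContDiff

noncomputable section

namespace FlatPencil

/-!
Throughout, `𝕜` is `ℝ` or `ℂ` and `M` is an `n`-dimensional manifold of class `C^r` over `𝕜`, where
in the theorem `r` is `∞` or `ω`.  Tensor fields are given pointwise on tangent and cotangent
spaces; their components are taken in the coordinate patches of the maximal atlas.  For a
coordinate patch `φ`, a component or a coefficient is a function on `M` that is only meaningful on
`φ.source`.
-/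

variable {𝕜 : Type*} [RCLike 𝕜] {n : ℕ}
variable {M : Type*} [TopologicalSpace M] [ChartedSpace (Fin n → 𝕜) M]

/-- The tangent space of `M` at `x`. -/
abbrev Tan (𝕜 : Type*) [RCLike 𝕜] (n : ℕ) {M : Type*} [TopologicalSpace M]
    [ChartedSpace (Fin n → 𝕜) M] (x : M) : Type _ :=
  TangentSpace 𝓘(𝕜, Fin n → 𝕜) x

/-- The cotangent space of `M` at `x`. -/
abbrev Cotan (𝕜 : Type*) [RCLike 𝕜] (n : ℕ) {M : Type*} [TopologicalSpace M]
    [ChartedSpace (Fin n → 𝕜) M] (x : M) : Type _ :=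
  Module.Dual 𝕜 (Tan 𝕜 n x)

instance instFiniteTan (x : M) : Module.Finite 𝕜 (Tan 𝕜 n x) :=
  inferInstanceAs (Module.Finite 𝕜 (Fin n → 𝕜))

/-! ### Coordinate patches -/

/-- `φ` is a coordinate patch of the `C^r` manifold `M`. -/
def IsPatch (r : WithTop ℕ∞) (φ : OpenPartialHomeomorph M (Fin n → 𝕜)) : Prop :=
  φ ∈ IsManifold.maximalAtlas 𝓘(𝕜, Fin n → 𝕜) r M

/-- The covector `dx^i` at `x`, where `x^1, …, x^n` are the coordinates of the patch `φ`. -/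
def dcoord (φ : OpenPartialHomeomorph M (Fin n → 𝕜)) (i : Fin n) (x : M) : Cotan 𝕜 n x :=
  (LinearMap.proj i : (Fin n → 𝕜) →ₗ[𝕜] 𝕜) ∘ₗ
    (mfderiv 𝓘(𝕜, Fin n → 𝕜) 𝓘(𝕜, Fin n → 𝕜) φ x).toLinearMap

/-- The coordinate vector `∂_i` at `x` of the patch `φ`, i.e. `(dφ_x)⁻¹` of the `i`-th basis
vector. -/
def coordVec (φ : OpenPartialHomeomorph M (Fin n → 𝕜)) (i : Fin n) (x : M) : Tan 𝕜 n x :=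
  (mfderiv 𝓘(𝕜, Fin n → 𝕜) 𝓘(𝕜, Fin n → 𝕜) φ x).inverse (Pi.single i 1 : Fin n → 𝕜)

/-- The partial derivative `∂_k f = ∂f/∂x^k` of a function in the coordinates of `φ`. -/
def pd (φ : OpenPartialHomeomorph M (Fin n → 𝕜)) (k : Fin n) (f : M → 𝕜) (x : M) : 𝕜 :=
  fderiv 𝕜 (f ∘ φ.symm) (φ x) (Pi.single k 1)

/-- The differential `df` of a function at `x`. -/
def dform (n : ℕ) {M : Type*} [TopologicalSpace M] [ChartedSpace (Fin n → 𝕜) M]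
    (f : M → 𝕜) (x : M) : Cotan 𝕜 n x :=
  (mfderiv 𝓘(𝕜, Fin n → 𝕜) 𝓘(𝕜, 𝕜) f x).toLinearMap

/-- `f` is of class `C^r` on `U`. -/
def SmoothOn (n : ℕ) {M : Type*} [TopologicalSpace M] [ChartedSpace (Fin n → 𝕜) M]
    (r : WithTop ℕ∞) (f : M → 𝕜) (U : Set M) : Prop :=
  ContMDiffOn 𝓘(𝕜, Fin n → 𝕜) 𝓘(𝕜, 𝕜) r f U

/-! ### Vector fields -/

/-- The components `X^i` of a vector field. -/
def vecComp (φ : OpenPartialHomeomorph M (Fin n → 𝕜)) (X : ∀ x : M, Tan 𝕜 n x) (i : Fin n)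
    (x : M) : 𝕜 :=
  dcoord φ i x (X x)

/-- The vector field `X` is of class `C^r` on `U`. -/
def SmoothVecOn (r : WithTop ℕ∞) (X : ∀ x : M, Tan 𝕜 n x) (U : Set M) : Prop :=
  ∀ φ : OpenPartialHomeomorph M (Fin n → 𝕜), IsPatch r φ →
    ∀ i, SmoothOn n r (vecComp φ X i) (φ.source ∩ U)

/-- The Lie bracket of vector fields. -/
abbrev bracket (X Y : ∀ x : M, Tan 𝕜 n x) : ∀ x : M, Tan 𝕜 n x :=
  VectorField.mlieBracket 𝓘(𝕜, Fin n → 𝕜) X Y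

/-! ### The Levi-Civita connection and the curvature of a metric `G = (g_{ij})`

`G` gives the matrix of components of a metric on `TM` in the patch `φ`. -/

/-- The Christoffel symbols `Γ_{sk}^j = ½ g^{jm} (∂_s g_{mk} + ∂_k g_{sm} - ∂_m g_{sk})`. -/
def christoffel (φ : OpenPartialHomeomorph M (Fin n → 𝕜)) (G : M → Matrix (Fin n) (Fin n) 𝕜)
    (s k j : Fin n) (x : M) : 𝕜 :=
  (1 / 2 : 𝕜) * ∑ m, (G x)⁻¹ j m *
    (pd φ s (fun y => G y m k) x + pd φ k (fun y => G y s m) x - pd φ m (fun y => G y s k) x)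

/-- The Riemann curvature tensor
`R_{kij}^l = ∂_i Γ_{jk}^l - ∂_j Γ_{ik}^l + Γ_{im}^l Γ_{jk}^m - Γ_{jm}^l Γ_{ik}^m`. -/
def riemann (φ : OpenPartialHomeomorph M (Fin n → 𝕜)) (G : M → Matrix (Fin n) (Fin n) 𝕜)
    (l k i j : Fin n) (x : M) : 𝕜 :=
  pd φ i (christoffel φ G j k l) x - pd φ j (christoffel φ G i k l) x
    + ∑ m, (christoffel φ G i m l x * christoffel φ G j k m x
        - christoffel φ G j m l x * christoffel φ G i k m x)

/-- The covariant derivative `∇_i X^j = ∂_i X^j + Γ_{is}^j X^s` of a vector field. -/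
def nablaVec (φ : OpenPartialHomeomorph M (Fin n → 𝕜)) (G : M → Matrix (Fin n) (Fin n) 𝕜)
    (X : ∀ x : M, Tan 𝕜 n x) (i j : Fin n) (x : M) : 𝕜 :=
  pd φ i (vecComp φ X j) x + ∑ s, christoffel φ G i s j x * vecComp φ X s x

/-- The second covariant derivative `∇_i ∇_j X^k` of a vector field. -/
def nablaNablaVec (φ : OpenPartialHomeomorph M (Fin n → 𝕜)) (G : M → Matrix (Fin n) (Fin n) 𝕜)
    (X : ∀ x : M, Tan 𝕜 n x) (i j k : Fin n) (x : M) : 𝕜 :=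
  pd φ i (nablaVec φ G X j k) x
    - ∑ s, christoffel φ G i j s x * nablaVec φ G X s k x
    + ∑ s, christoffel φ G i s k x * nablaVec φ G X j s x

/-! ### Contravariant metrics -/

/-- A field of bilinear forms on the cotangent spaces. -/
abbrev CoForm (𝕜 : Type*) [RCLike 𝕜] (n : ℕ) (M : Type*) [TopologicalSpace M]
    [ChartedSpace (Fin n → 𝕜) M] : Type _ :=
  ∀ x : M, LinearMap.BilinForm 𝕜 (Cotan 𝕜 n x)

/-- The components `g^{ij} = (dx^i, dx^j)`. -/
def coComp (φ : OpenPartialHomeomorph M (Fin n → 𝕜)) (g : CoForm 𝕜 n M) (x : M) :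
    Matrix (Fin n) (Fin n) 𝕜 :=
  Matrix.of fun i j => g x (dcoord φ i x) (dcoord φ j x)

/-- The set on which the form is invertible. -/
def invLocus (g : CoForm 𝕜 n M) : Set M :=
  {x | (g x).Nondegenerate}

/-- A contravariant metric: a symmetric bilinear form of class `C^r` on `T*M` that is invertible on
an open dense subset.  The set of all points where it is invertible is automatically open. -/
structure IsContraMetric (r : WithTop ℕ∞) (g : CoForm 𝕜 n M) : Prop where
  symm : ∀ x, (g x).IsSymm
  smooth : ∀ φ : OpenPartialHomeomorph M (Fin n → 𝕜), IsPatch r φ →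
    ∀ i j, SmoothOn n r (fun x => coComp φ g x i j) φ.source
  dense : Dense (invLocus g)

/-- A collection of functions `Γ_k^{ij}`, written `Γ φ k i j`, for every coordinate patch `φ`. -/
abbrev Coeffs (𝕜 : Type*) [RCLike 𝕜] (n : ℕ) (M : Type*) [TopologicalSpace M] : Type _ :=
  OpenPartialHomeomorph M (Fin n → 𝕜) → Fin n → Fin n → Fin n → M → 𝕜

/-- The components `(g_{ij}) = (g^{ij})⁻¹` of the metric on `TM` that is inverse to `g`. -/
def coInv (φ : OpenPartialHomeomorph M (Fin n → 𝕜)) (g : CoForm 𝕜 n M) (x : M) :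
    Matrix (Fin n) (Fin n) 𝕜 :=
  (coComp φ g x)⁻¹

/-- `Γ` is the contravariant Levi-Civita connection of `g`: functions of class `C^r` on the whole of
every coordinate patch, with `Γ_k^{ij} = - g^{is} Γ_{sk}^j` wherever `g` is invertible, where
`Γ_{sk}^j` is the Levi-Civita connection of the inverse metric. -/
structure IsContraLeviCivita (r : WithTop ℕ∞) (g : CoForm 𝕜 n M) (Γ : Coeffs 𝕜 n M) : Prop where
  smooth : ∀ φ : OpenPartialHomeomorph M (Fin n → 𝕜), IsPatch r φ →
    ∀ k i j, SmoothOn n r (Γ φ k i j) φ.source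
  eq : ∀ φ : OpenPartialHomeomorph M (Fin n → 𝕜), IsPatch r φ →
    ∀ x ∈ φ.source ∩ invLocus g, ∀ k i j,
      Γ φ k i j x = - ∑ s, coComp φ g x i s * christoffel φ (coInv φ g) s k j x

/-- `f` is a flat coordinate on `V` of the contravariant metric `g` with contravariant Levi-Civita
connection `Γ`: its differential `ξ = df` satisfies `g^{is} ∂_s ξ_j + Γ_j^{is} ξ_s = 0`. -/
def IsFlatCoord (r : WithTop ℕ∞) (g : CoForm 𝕜 n M) (Γ : Coeffs 𝕜 n M) (f : M → 𝕜)
    (V : Set M) : Prop :=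
  SmoothOn n r f V ∧
    ∀ φ : OpenPartialHomeomorph M (Fin n → 𝕜), IsPatch r φ → ∀ x ∈ φ.source ∩ V, ∀ i j,
      ∑ s, coComp φ g x i s * pd φ s (pd φ j f) x + ∑ s, Γ φ j i s x * pd φ s f x = 0

/-- The contravariant metric `g`, with contravariant Levi-Civita connection `Γ`, is flat: near every
point where it is invertible there are `n` independent flat coordinates. -/
def IsFlat (r : WithTop ℕ∞) (g : CoForm 𝕜 n M) (Γ : Coeffs 𝕜 n M) : Prop :=
  ∀ x ∈ invLocus g, ∃ V : Set M, IsOpen V ∧ x ∈ V ∧ ∃ f : Fin n → M → 𝕜,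
    (∀ a, IsFlatCoord r g Γ (f a) V) ∧
      ∀ y ∈ V, LinearIndependent 𝕜 fun a => dform n (f a) y

/-! ### Flat pencils -/

/-- `g₁` and `g₂` form a flat pencil, `Γ₁` and `Γ₂` being their contravariant Levi-Civita
connections. -/
structure IsFlatPencil (r : WithTop ℕ∞) (g₁ g₂ : CoForm 𝕜 n M) (Γ₁ Γ₂ : Coeffs 𝕜 n M) :
    Prop where
  metric₁ : IsContraMetric r g₁
  metric₂ : IsContraMetric r g₂
  leviCivita₁ : IsContraLeviCivita r g₁ Γ₁
  leviCivita₂ : IsContraLeviCivita r g₂ Γ₂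
  metric : ∀ c : 𝕜, IsContraMetric r (g₁ - c • g₂)
  leviCivita : ∀ c : 𝕜, IsContraLeviCivita r (g₁ - c • g₂)
    (fun φ k i j x => Γ₁ φ k i j x - c * Γ₂ φ k i j x)
  flat : ∀ c : 𝕜, IsFlat r (g₁ - c • g₂) (fun φ k i j x => Γ₁ φ k i j x - c * Γ₂ φ k i j x)

/-- The gradient `∇τ`, i.e. the vector field `X` with `ω(X) = (dτ, ω)` for all covectors `ω`; in
coordinates `X^i = g^{is} ∂_s τ`. -/
def gradient (g : CoForm 𝕜 n M) (τ : M → 𝕜) (x : M) : Tan 𝕜 n x :=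
  (Module.evalEquiv 𝕜 (Tan 𝕜 n x)).symm (g x (dform n τ x))

/-- The components of the Lie derivative `L_X g`, i.e.
`X^s ∂_s g^{ij} - g^{sj} ∂_s X^i - g^{is} ∂_s X^j`. -/
def lieCo (φ : OpenPartialHomeomorph M (Fin n → 𝕜)) (X : ∀ x : M, Tan 𝕜 n x) (g : CoForm 𝕜 n M)
    (i j : Fin n) (x : M) : 𝕜 :=
  ∑ s, (vecComp φ X s x * pd φ s (fun y => coComp φ g y i j) x
    - coComp φ g x s j * pd φ s (vecComp φ X i) x
    - coComp φ g x i s * pd φ s (vecComp φ X j) x)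

/-- `L_X g = h` on `M`. -/
def LieEq (r : WithTop ℕ∞) (X : ∀ x : M, Tan 𝕜 n x) (g h : CoForm 𝕜 n M) : Prop :=
  ∀ φ : OpenPartialHomeomorph M (Fin n → 𝕜), IsPatch r φ → ∀ x ∈ φ.source, ∀ i j,
    lieCo φ X g i j x = coComp φ h x i j

/-- The pencil of `g₁` and `g₂` is quasihomogeneous of degree `d` by means of the function `τ`;
here `E = ∇₁τ` and `e = ∇₂τ`. -/
structure IsQuasihomogeneous (r : WithTop ℕ∞) (g₁ g₂ : CoForm 𝕜 n M) (τ : M → 𝕜) (d : 𝕜) :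
    Prop where
  smooth : SmoothOn n r τ Set.univ
  bracket_eq : bracket (gradient g₂ τ) (gradient g₁ τ) = gradient g₂ τ
  lie_E : LieEq r (gradient g₁ τ) g₁ ((d - 1) • g₁)
  lie_e₁ : LieEq r (gradient g₂ τ) g₁ g₂
  lie_e₂ : LieEq r (gradient g₂ τ) g₂ 0

/-- The (1,1)-tensor `R_i^j = (d-1)/2 δ_i^j + (∇₂)_i E^j` with `E = ∇₁τ`, on the set where `g₂` is
invertible.  The matrix acts on the components of 1-forms by `(R u)_i = R_i^j u_j`. -/
def regTensor (φ : OpenPartialHomeomorph M (Fin n → 𝕜)) (g₁ g₂ : CoForm 𝕜 n M) (τ : M → 𝕜) (d : 𝕜)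
    (x : M) : Matrix (Fin n) (Fin n) 𝕜 :=
  ((d - 1) / 2) • (1 : Matrix (Fin n) (Fin n) 𝕜)
    + Matrix.of fun i j => nablaVec φ (coInv φ g₂) (gradient g₁ τ) i j x

/-- Regularity: `R` is nondegenerate (wherever `∇₂` is defined). -/
def IsRegular (r : WithTop ℕ∞) (g₁ g₂ : CoForm 𝕜 n M) (τ : M → 𝕜) (d : 𝕜) : Prop :=
  ∀ φ : OpenPartialHomeomorph M (Fin n → 𝕜), IsPatch r φ → ∀ x ∈ φ.source ∩ invLocus g₂,
    (regTensor φ g₁ g₂ τ d x).det ≠ 0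

/-- The components `Δ^{ijk} = g₂^{js} Γ₁_s^{ik} - g₁^{is} Γ₂_s^{jk}`. -/
def deltaUp (φ : OpenPartialHomeomorph M (Fin n → 𝕜)) (g₁ g₂ : CoForm 𝕜 n M) (Γ₁ Γ₂ : Coeffs 𝕜 n M)
    (i j k : Fin n) (x : M) : 𝕜 :=
  ∑ s, (coComp φ g₂ x j s * Γ₁ φ s i k x - coComp φ g₁ x i s * Γ₂ φ s j k x)

/-- The components `Δ_i^{jk} = g₂_{is} Δ^{sjk}`. -/
def delta (φ : OpenPartialHomeomorph M (Fin n → 𝕜)) (g₁ g₂ : CoForm 𝕜 n M) (Γ₁ Γ₂ : Coeffs 𝕜 n M)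
    (i j k : Fin n) (x : M) : 𝕜 :=
  ∑ s, coInv φ g₂ x i s * deltaUp φ g₁ g₂ Γ₁ Γ₂ s j k x

/-- The components `u_i = u(∂_i)` of a covector. -/
def covComp (φ : OpenPartialHomeomorph M (Fin n → 𝕜)) {x : M} (u : Cotan 𝕜 n x) : Fin n → 𝕜 :=
  fun i => u (coordVec φ i x)

/-- The covector with given components, `w_k dx^k`. -/
def covOf (φ : OpenPartialHomeomorph M (Fin n → 𝕜)) (x : M) (w : Fin n → 𝕜) : Cotan 𝕜 n x :=
  ∑ k, w k • dcoord φ k x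

/-- `Δ(u,v)_k = u_i v_j Δ_k^{ij}`, computed in the patch `φ`. -/
def deltaOp (φ : OpenPartialHomeomorph M (Fin n → 𝕜)) (g₁ g₂ : CoForm 𝕜 n M) (Γ₁ Γ₂ : Coeffs 𝕜 n M)
    {x : M} (u v : Cotan 𝕜 n x) : Cotan 𝕜 n x :=
  covOf φ x fun k => ∑ i, ∑ j, covComp φ u i * covComp φ v j * delta φ g₁ g₂ Γ₁ Γ₂ k i j x

/-- `R⁻¹ v`, computed in the patch `φ`. -/
def regInv (φ : OpenPartialHomeomorph M (Fin n → 𝕜)) (g₁ g₂ : CoForm 𝕜 n M) (τ : M → 𝕜) (d : 𝕜)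
    {x : M} (v : Cotan 𝕜 n x) : Cotan 𝕜 n x :=
  covOf φ x ((regTensor φ g₁ g₂ τ d x)⁻¹.mulVec (covComp φ v))

/-- The multiplication of 1-forms `u · v = Δ(u, R⁻¹ v)`, computed in the patch `φ`. -/
def formMul (φ : OpenPartialHomeomorph M (Fin n → 𝕜)) (g₁ g₂ : CoForm 𝕜 n M) (Γ₁ Γ₂ : Coeffs 𝕜 n M)
    (τ : M → 𝕜) (d : 𝕜) {x : M} (u v : Cotan 𝕜 n x) : Cotan 𝕜 n x :=
  deltaOp φ g₁ g₂ Γ₁ Γ₂ u (regInv φ g₁ g₂ τ d v)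

/-! ### Frobenius structures -/

/-- The data of a Frobenius structure: the metric `<,>`, the multiplication of tangent vectors, the
unity vector field `e`, the Euler vector field `E` and the charge.  Below, these are considered on
an open subset `U` of `M`, and their values outside of `U` are irrelevant. -/
@[ext]
structure FrobData (𝕜 : Type*) [RCLike 𝕜] (n : ℕ) (M : Type*) [TopologicalSpace M]
    [ChartedSpace (Fin n → 𝕜) M] where
  metric : ∀ x : M, LinearMap.BilinForm 𝕜 (Tan 𝕜 n x)
  mul : ∀ x : M, Tan 𝕜 n x →ₗ[𝕜] Tan 𝕜 n x →ₗ[𝕜] Tan 𝕜 n x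
  unit : ∀ x : M, Tan 𝕜 n x
  euler : ∀ x : M, Tan 𝕜 n x
  charge : 𝕜

namespace FrobData

/-- The components `<∂_i, ∂_j>` of the metric. -/
def metricComp (F : FrobData 𝕜 n M) (φ : OpenPartialHomeomorph M (Fin n → 𝕜)) (x : M) :
    Matrix (Fin n) (Fin n) 𝕜 :=
  Matrix.of fun i j => F.metric x (coordVec φ i x) (coordVec φ j x)

/-- The structure functions `c_{ij}^k` of the multiplication. -/
def mulComp (F : FrobData 𝕜 n M) (φ : OpenPartialHomeomorph M (Fin n → 𝕜)) (i j k : Fin n)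
    (x : M) : 𝕜 :=
  dcoord φ k x (F.mul x (coordVec φ i x) (coordVec φ j x))

/-- The components `c_{ijk} = <∂_i · ∂_j, ∂_k>` of the trilinear form `c(u,v,w) = <u · v, w>`. -/
def triComp (F : FrobData 𝕜 n M) (φ : OpenPartialHomeomorph M (Fin n → 𝕜)) (i j k : Fin n)
    (x : M) : 𝕜 :=
  F.metric x (F.mul x (coordVec φ i x) (coordVec φ j x)) (coordVec φ k x)

/-- The components `(∇_l c)_{ijk}` of the covariant derivative of the trilinear form `c`. -/
def nablaTri (F : FrobData 𝕜 n M) (φ : OpenPartialHomeomorph M (Fin n → 𝕜)) (l i j k : Fin n)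
    (x : M) : 𝕜 :=
  pd φ l (F.triComp φ i j k) x
    - ∑ m, (christoffel φ (F.metricComp φ) l i m x * F.triComp φ m j k x
      + christoffel φ (F.metricComp φ) l j m x * F.triComp φ i m k x
      + christoffel φ (F.metricComp φ) l k m x * F.triComp φ i j m x)

/-- The grading operator `Q = id + ad_E` on vector fields. -/
def grading (F : FrobData 𝕜 n M) (X : ∀ x : M, Tan 𝕜 n x) (x : M) : Tan 𝕜 n x :=
  X x + bracket F.euler X x

/-- `F` is a Frobenius structure of class `C^r` on the open subset `U` of `M`. -/
structure IsFrobeniusOn (r : WithTop ℕ∞) (F : FrobData 𝕜 n M) (U : Set M) : Prop where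
  /- the tangent spaces are Frobenius algebras depending smoothly on the point -/
  smooth_metric : ∀ φ : OpenPartialHomeomorph M (Fin n → 𝕜), IsPatch r φ →
    ∀ i j, SmoothOn n r (fun x => F.metricComp φ x i j) (φ.source ∩ U)
  smooth_mul : ∀ φ : OpenPartialHomeomorph M (Fin n → 𝕜), IsPatch r φ →
    ∀ i j k, SmoothOn n r (F.mulComp φ i j k) (φ.source ∩ U)
  smooth_unit : SmoothVecOn r F.unit U
  smooth_euler : SmoothVecOn r F.euler U
  mul_comm : ∀ x ∈ U, ∀ u v, F.mul x u v = F.mul x v u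
  mul_assoc : ∀ x ∈ U, ∀ u v w, F.mul x (F.mul x u v) w = F.mul x u (F.mul x v w)
  unit_mul : ∀ x ∈ U, ∀ u, F.mul x (F.unit x) u = u
  symm : ∀ x ∈ U, (F.metric x).IsSymm
  nondegenerate : ∀ x ∈ U, (F.metric x).Nondegenerate
  invariant : ∀ x ∈ U, ∀ u v w, F.metric x (F.mul x u v) w = F.metric x u (F.mul x v w)
  /- first axiom: the curvature vanishes and the unity is covariantly constant -/
  flat : ∀ φ : OpenPartialHomeomorph M (Fin n → 𝕜), IsPatch r φ → ∀ x ∈ φ.source ∩ U,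
    ∀ l k i j, riemann φ (F.metricComp φ) l k i j x = 0
  nabla_unit : ∀ φ : OpenPartialHomeomorph M (Fin n → 𝕜), IsPatch r φ → ∀ x ∈ φ.source ∩ U,
    ∀ i j, nablaVec φ (F.metricComp φ) F.unit i j x = 0
  /- second axiom: the four-linear form `(∇_z c)(u,v,w)` is symmetric -/
  nablaTri_symm : ∀ φ : OpenPartialHomeomorph M (Fin n → 𝕜), IsPatch r φ →
    ∀ x ∈ φ.source ∩ U, ∀ (a : Fin 4 → Fin n) (σ : Equiv.Perm (Fin 4)),
      F.nablaTri φ (a (σ 0)) (a (σ 1)) (a (σ 2)) (a (σ 3)) x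
        = F.nablaTri φ (a 0) (a 1) (a 2) (a 3) x
  /- third axiom: the Euler vector field is linear, and `E` on functions and `Q = id + ad_E` on
  vector fields make the vector fields on `U`, and on its open subsets `V`, a graded Frobenius
  algebra of the given charge over the functions; that `E` is a derivation of the functions and
  that `Q(f X) = E(f) X + f Q(X)` holds for every vector field `E`.  Vector fields on open subsets
  are needed since an analytic manifold may have too few global ones. -/
  nablaNabla_euler : ∀ φ : OpenPartialHomeomorph M (Fin n → 𝕜), IsPatch r φ →
    ∀ x ∈ φ.source ∩ U, ∀ i j k, nablaNablaVec φ (F.metricComp φ) F.euler i j k x = 0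
  grading_mul : ∀ V : Set M, IsOpen V → V ⊆ U → ∀ X Y : (∀ x : M, Tan 𝕜 n x),
    SmoothVecOn r X V → SmoothVecOn r Y V → ∀ x ∈ V, F.grading (fun y => F.mul y (X y) (Y y)) x
      = F.mul x (F.grading X x) (Y x) + F.mul x (X x) (F.grading Y x)
  grading_metric : ∀ V : Set M, IsOpen V → V ⊆ U → ∀ X Y : (∀ x : M, Tan 𝕜 n x),
    SmoothVecOn r X V → SmoothVecOn r Y V → ∀ x ∈ V, dform n (fun y => F.metric y (X y) (Y y)) x (F.euler x)
        + F.charge * F.metric x (X x) (Y x)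
      = F.metric x (F.grading X x) (Y x) + F.metric x (X x) (F.grading Y x)

/-- The identification `T_xM → T*_xM`, `v ↦ <v, ·>` defined by the metric. -/
def flatMap (F : FrobData 𝕜 n M) (x : M) : Tan 𝕜 n x →ₗ[𝕜] Cotan 𝕜 n x :=
  F.metric x

/-- The bilinear form `g` on `T*M` is on `U` the metric `<,>` carried over to the cotangent spaces by
the identification of `TM` with `T*M`. -/
def MetricEq (F : FrobData 𝕜 n M) (g : CoForm 𝕜 n M) (U : Set M) : Prop :=
  ∀ x ∈ U, ∀ v w, g x (F.flatMap x v) (F.flatMap x w) = F.metric x v w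

/-- The bilinear form `g` on `T*M` is on `U` the intersection form `(ω₁, ω₂) = i_E (ω₁ · ω₂)`, where
1-forms are multiplied by means of the identification of `TM` with `T*M`. -/
def IntersectionFormEq (F : FrobData 𝕜 n M) (g : CoForm 𝕜 n M) (U : Set M) : Prop :=
  ∀ x ∈ U, ∀ v w, g x (F.flatMap x v) (F.flatMap x w) = F.flatMap x (F.mul x v w) (F.euler x)

/-- The Frobenius structure `F` on the set `M₀` where `g₂` is invertible is the one induced by the
pencil: `<,> = (,)₂`, the multiplication of vectors is `<,>`-dual to `u · v = Δ(u, R⁻¹ v)`, the unity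
and the Euler vector field are `∇₂τ` and `∇₁τ`, and the intersection form is `(,)₁`. -/
structure IsInduced (r : WithTop ℕ∞) (F : FrobData 𝕜 n M) (g₁ g₂ : CoForm 𝕜 n M)
    (Γ₁ Γ₂ : Coeffs 𝕜 n M) (τ : M → 𝕜) (d : 𝕜) : Prop where
  metric_eq : F.MetricEq g₂ (invLocus g₂)
  mul_dual : ∀ φ : OpenPartialHomeomorph M (Fin n → 𝕜), IsPatch r φ →
    ∀ x ∈ φ.source ∩ invLocus g₂, ∀ v w,
      F.flatMap x (F.mul x v w) = formMul φ g₁ g₂ Γ₁ Γ₂ τ d (F.flatMap x v) (F.flatMap x w)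
  unit_eq : ∀ x ∈ invLocus g₂, F.unit x = gradient g₂ τ x
  euler_eq : ∀ x ∈ invLocus g₂, F.euler x = gradient g₁ τ x
  intersection_eq : F.IntersectionFormEq g₁ (invLocus g₂)

/-- `F` and `F'` are the same Frobenius structure on `U`. -/
structure SameOn (F F' : FrobData 𝕜 n M) (U : Set M) : Prop where
  metric : ∀ x ∈ U, F.metric x = F'.metric x
  mul : ∀ x ∈ U, F.mul x = F'.mul x
  unit : ∀ x ∈ U, F.unit x = F'.unit x
  euler : ∀ x ∈ U, F.euler x = F'.euler x
  charge : F.charge = F'.charge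

end FrobData

end FlatPencil

end

/-!
The construction of the Frobenius structure on the set `M₀` where `(,)₂` is invertible rests on a few
tensor identities, all of which come from comparing coefficients in the parameter of the pencil.

Let `∇` be the Levi-Civita connection of `g₂`, with Christoffel symbols `C`, let `e = ∇₂τ` and `E = ∇₁τ`.
At a point of `M₀` the form `g₁ - c g₂` is invertible for all but finitely many `c`, so an identity that
is polynomial in `c` holds coefficient by coefficient (`pencil_coeffs`). For compatibility with the
metric and for the torsion this shows that `Δ` is the difference `Γ₁ + g₁ C` of two connections
(`IsFlatPencil.delta_eq`), that `∇_k g₁^{ij} = Δ_k^{ij} + Δ_k^{ji}` (`covUU_coComp₁`), and that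
`g₁^{is} Δ_s^{jk}` and `g₂^{is} Δ_s^{jk}` are symmetric in `i` and `j`. For the curvature of
`g₁ - c g₂`, written as curvature of `C` corrected by `Δ` (`IsFlat.curvature`), the three coefficients
say that `g₂` is flat, that `Δ` satisfies the Codazzi equation `∇_l Δ_j = ∇_j Δ_l`, and that the
operators `Δ(·, v)` commute (`IsFlatPencil.curvature_coeffs`). The hypotheses provide flat coordinates
for `g₁ - c g₂`, so the flatness of the whole pencil enters only through the vanishing of curvature, and
all computations are done covariantly in an arbitrary patch; flat coordinates of `g₂` are not used.

Quasihomogeneity adds the following. The gradient `e` preserves `g₂`, so `dτ` is parallel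
(`hessian_tau`). The scaling of `g₁` by `E` makes `Δ(·, dτ)` the scalar `(1-d)/2`, first where `g₁` is
invertible and then everywhere by density, and therefore `R = Δ(dτ, ·)` (`regTensor_eq`). The equation
`L_e g₁ = g₂` becomes `g₂ R + (g₂ R)ᵀ = g₂`. The tensor `R` is parallel (`covLU_opMat`): the derivative
of the torsion identity of `g₁` along `e` shows that `g₁^{is} g₂^{jm} ∇_s R_m^k` is symmetric in `i` and
`j`, the previous equation that it is antisymmetric in `j` and `k`, so it vanishes.

The axioms now follow. The multiplication `u · v = Δ(u, R⁻¹ v)` has the unity `dτ`, it is commutative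
and associative since the operators `Δ(·, v)` commute, and `i_E (u · v) = g₁(u, v)` since
`E^s Δ_s = g₁ R`. The lowered structure constants `c_k = h Δ_k R⁻¹ h` (`cubic`), with `h` the inverse of
`g₂`, are symmetric by commutativity and the torsion identity of `g₂`, and so is `∇c` by the Codazzi
equation, as `h` and `R` are parallel. The Euler vector field has `∇E = R + (1-d)/2`, which is parallel;
differentiating `E^s Δ_s = g₁ R` gives `L_E Δ = (d-1) Δ` (`dirM_deltaMat`), and with
`L_E h = (2-d) h` and `L_E R = 0` one obtains `L_E c = (3-d) c` (`dirM_cubic`), which is the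
homogeneity of the multiplication. That the multiplication does not depend on the patch (`formMul_eq`)
follows from the tensoriality of `Δ` (`deltaMat_eq_jac`), which is determined by its symmetric part and
the torsion identity of `g₂`.

Uniqueness: the metric is the inverse of `g₂`, the multiplication and the vector fields are prescribed,
and the charge is determined by the homogeneity of the metric, which is nonzero in positive dimension
(`sameOn_inducedFrob`).
-/

open scoped Manifold ContDiff Topology

noncomputable section

namespace FlatPencil

set_option linter.unusedSectionVars false

variable {𝕜 : Type*} [RCLike 𝕜] {n : ℕ}
variable {M : Type*} [TopologicalSpace M] [ChartedSpace (Fin n → 𝕜) M]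
variable {r : WithTop ℕ∞}

section

/-! ### Partial derivatives in a coordinate patch -/

/-- The function `f` is of class `C^r` at the point `x`. -/
def SmAt (n : ℕ) {M : Type*} [TopologicalSpace M] [ChartedSpace (Fin n → 𝕜) M]
    (r : WithTop ℕ∞) (f : M → 𝕜) (x : M) : Prop :=
  ContMDiffAt 𝓘(𝕜, Fin n → 𝕜) 𝓘(𝕜, 𝕜) r f x

variable {φ ψ : OpenPartialHomeomorph M (Fin n → 𝕜)} {f g : M → 𝕜} {x : M}

lemma add_one_le_of_infty_le (hr : ∞ ≤ r) : r + 1 ≤ r := by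
  induction r using WithTop.recTopCoe with
  | top => exact le_top
  | coe a =>
    have : a = ⊤ := top_le_iff.1 (WithTop.coe_le_coe.1 hr)
    subst this; exact le_rfl

lemma ne_zero_of_infty_le (hr : ∞ ≤ r) : r ≠ 0 := by
  rintro rfl
  have := hr
  simp at this

lemma two_le_of_infty_le (hr : ∞ ≤ r) : 2 ≤ r :=
  le_trans (WithTop.coe_le_coe.2 (le_top : (2 : ℕ∞) ≤ ⊤)) hr

/-- `φ` is a coordinate patch around the point `x` of the `C^r` manifold `M`, with `r ≥ ∞`. -/
structure PatchAt (r : WithTop ℕ∞) (φ : OpenPartialHomeomorph M (Fin n → 𝕜)) (x : M) : Prop where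
  le : ∞ ≤ r
  patch : IsPatch r φ
  mem : x ∈ φ.source

lemma PatchAt.eventually (h : PatchAt r φ x) : ∀ᶠ y in 𝓝 x, PatchAt r φ y := by
  filter_upwards [φ.open_source.mem_nhds h.mem] with y hy
  exact ⟨h.le, h.patch, hy⟩

section smooth

lemma SmoothOn.smAt {U : Set M} (h : SmoothOn n r f U) (hU : U ∈ 𝓝 x) : SmAt n r f x :=
  ContMDiffOn.contMDiffAt h hU

lemma smAt_const (c : 𝕜) : SmAt n r (fun _ : M => c) x := contMDiffAt_const

lemma SmAt.congr (hf : SmAt n r f x) (h : g =ᶠ[𝓝 x] f) : SmAt n r g x :=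
  ContMDiffAt.congr_of_eventuallyEq hf h

lemma SmAt.continuousAt (hf : SmAt n r f x) : ContinuousAt f x := ContMDiffAt.continuousAt hf

lemma SmAt.add (hf : SmAt n r f x) (hg : SmAt n r g x) : SmAt n r (fun y => f y + g y) x :=
  ContMDiffAt.add hf hg

lemma SmAt.sub (hf : SmAt n r f x) (hg : SmAt n r g x) : SmAt n r (fun y => f y - g y) x :=
  ContMDiffAt.sub hf hg

lemma SmAt.mul (hf : SmAt n r f x) (hg : SmAt n r g x) : SmAt n r (fun y => f y * g y) x :=
  ContMDiffAt.smul hf hg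

lemma SmAt.inv (hf : SmAt n r f x) (h0 : f x ≠ 0) : SmAt n r (fun y => (f y)⁻¹) x :=
  ContMDiffAt.inv₀ hf h0

lemma SmAt.sum {ι : Type*} {s : Finset ι} {u : ι → M → 𝕜} (hu : ∀ i ∈ s, SmAt n r (u i) x) :
    SmAt n r (fun y => ∑ i ∈ s, u i y) x :=
  ContMDiffAt.sum hu

lemma SmAt.prod {ι : Type*} {s : Finset ι} {u : ι → M → 𝕜} (hu : ∀ i ∈ s, SmAt n r (u i) x) :
    SmAt n r (fun y => ∏ i ∈ s, u i y) x :=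
  ContMDiffAt.prod hu

lemma SmAt.det {m : ℕ} {A : M → Matrix (Fin m) (Fin m) 𝕜}
    (hA : ∀ i j, SmAt n r (fun y => A y i j) x) : SmAt n r (fun y => (A y).det) x := by
  simp only [Matrix.det_apply']
  exact SmAt.sum fun σ _ => (smAt_const _).mul (SmAt.prod fun i _ => hA _ _)

lemma SmAt.matrix_inv {m : ℕ} {A : M → Matrix (Fin m) (Fin m) 𝕜}
    (hA : ∀ i j, SmAt n r (fun y => A y i j) x) (h0 : (A x).det ≠ 0) (i j : Fin m) :
    SmAt n r (fun y => (A y)⁻¹ i j) x := by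
  simp only [Matrix.inv_def, Ring.inverse_eq_inv, Matrix.smul_apply, smul_eq_mul,
    Matrix.adjugate_apply]
  refine ((SmAt.det hA).inv h0).mul (SmAt.det fun k l => ?_)
  by_cases hk : k = j
  · subst hk; simpa using smAt_const _
  · simpa [Matrix.updateRow_ne hk] using hA k l

lemma SmAt.mul_mat {m : ℕ} {A B : M → Matrix (Fin m) (Fin m) 𝕜}
    (hA : ∀ i j, SmAt n r (fun y => A y i j) x) (hB : ∀ i j, SmAt n r (fun y => B y i j) x)
    (i j : Fin m) : SmAt n r (fun y => (A y * B y) i j) x := by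
  simp only [Matrix.mul_apply]
  exact SmAt.sum fun k _ => (hA _ _).mul (hB _ _)

variable (hφ : IsPatch r φ) (hx : x ∈ φ.source)
include hφ hx

lemma SmAt.contDiffAt [IsManifold 𝓘(𝕜, Fin n → 𝕜) r M] (hf : SmAt n r f x) :
    ContDiffAt 𝕜 r (f ∘ φ.symm) (φ x) := by
  have h1 := contMDiffAt_symm_of_mem_maximalAtlas hφ (φ.map_source hx)
  have h2 : ContMDiffAt 𝓘(𝕜, Fin n → 𝕜) 𝓘(𝕜, 𝕜) r f (φ.symm (φ x)) := by
    rw [φ.left_inv hx]; exact hf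
  exact (h2.comp (φ x) h1).contDiffAt

lemma smAt_of_contDiffAt [IsManifold 𝓘(𝕜, Fin n → 𝕜) r M] {F : (Fin n → 𝕜) → 𝕜}
    (hF : ContDiffAt 𝕜 r F (φ x)) : SmAt n r (fun y => F (φ y)) x :=
  hF.contMDiffAt.comp x (contMDiffAt_of_mem_maximalAtlas hφ hx)

end smooth

section pd

lemma pd_congr (hx : x ∈ φ.source) (h : f =ᶠ[𝓝 x] g) (k : Fin n) : pd φ k f x = pd φ k g x := by
  unfold pd
  congr 1
  apply Filter.EventuallyEq.fderiv_eq
  have h1 : Filter.Tendsto φ.symm (𝓝 (φ x)) (𝓝 x) := by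
    have := φ.continuousAt_symm (φ.map_source hx)
    rwa [ContinuousAt, φ.left_inv hx] at this
  exact h1.eventually h

lemma pd_const (c : 𝕜) (k : Fin n) : pd φ k (fun _ => c) x = 0 := by
  have : (fun _ : M => c) ∘ φ.symm = fun _ => c := rfl
  simp [pd, this]

lemma pd_eq_zero_of_eventually_const (hx : x ∈ φ.source) {c : 𝕜} (h : ∀ᶠ y in 𝓝 x, f y = c)
    (k : Fin n) : pd φ k f x = 0 := by
  rw [pd_congr hx (g := fun _ => c) h, pd_const]

variable [IsManifold 𝓘(𝕜, Fin n → 𝕜) r M]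
variable (h : PatchAt r φ x)
include h

lemma SmAt.differentiableAt (hf : SmAt n r f x) : DifferentiableAt 𝕜 (f ∘ φ.symm) (φ x) :=
  (hf.contDiffAt h.patch h.mem).differentiableAt (ne_zero_of_infty_le h.le)

lemma pd_add (hf : SmAt n r f x) (hg : SmAt n r g x) (k : Fin n) :
    pd φ k (fun y => f y + g y) x = pd φ k f x + pd φ k g x := by
  have := fderiv_add (hf.differentiableAt h) (hg.differentiableAt h)
  unfold pd
  rw [show (fun y => f y + g y) ∘ φ.symm = (f ∘ φ.symm) + (g ∘ φ.symm) from rfl, this]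
  rfl

lemma pd_sub (hf : SmAt n r f x) (hg : SmAt n r g x) (k : Fin n) :
    pd φ k (fun y => f y - g y) x = pd φ k f x - pd φ k g x := by
  have := fderiv_sub (hf.differentiableAt h) (hg.differentiableAt h)
  unfold pd
  rw [show (fun y => f y - g y) ∘ φ.symm = (f ∘ φ.symm) - (g ∘ φ.symm) from rfl, this]
  rfl

lemma pd_mul (hf : SmAt n r f x) (hg : SmAt n r g x) (k : Fin n) :
    pd φ k (fun y => f y * g y) x = pd φ k f x * g x + f x * pd φ k g x := by
  have := fderiv_mul (hf.differentiableAt h) (hg.differentiableAt h)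
  unfold pd
  rw [show (fun y => f y * g y) ∘ φ.symm = (f ∘ φ.symm) * (g ∘ φ.symm) from rfl, this]
  simp [φ.left_inv h.mem]
  ring

lemma pd_const_mul (hf : SmAt n r f x) (c : 𝕜) (k : Fin n) :
    pd φ k (fun y => c * f y) x = c * pd φ k f x := by
  rw [pd_mul h (smAt_const c) hf, pd_const, zero_mul, zero_add]

lemma pd_sum {ι : Type*} {s : Finset ι} {u : ι → M → 𝕜} (hu : ∀ i ∈ s, SmAt n r (u i) x)
    (k : Fin n) : pd φ k (fun y => ∑ i ∈ s, u i y) x = ∑ i ∈ s, pd φ k (u i) x := by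
  classical
  induction s using Finset.induction_on with
  | empty => simpa using pd_const (φ := φ) (x := x) 0 k
  | insert a s ha ih =>
    have h1 : SmAt n r (fun y => ∑ i ∈ s, u i y) x :=
      SmAt.sum fun i hi => hu i (Finset.mem_insert_of_mem hi)
    simp only [Finset.sum_insert ha]
    rw [pd_add h (hu a (Finset.mem_insert_self _ _)) h1,
      ih fun i hi => hu i (Finset.mem_insert_of_mem hi)]

lemma SmAt.pd (hf : SmAt n r f x) (k : Fin n) : SmAt n r (pd φ k f) x := by
  have h1 := (hf.contDiffAt h.patch h.mem).fderiv_right (add_one_le_of_infty_le h.le)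
  exact smAt_of_contDiffAt h.patch h.mem (h1.clm_apply contDiffAt_const)

lemma pd_comm (hf : SmAt n r f x) (k l : Fin n) :
    pd φ k (pd φ l f) x = pd φ l (pd φ k f) x := by
  have hs : IsSymmSndFDerivAt 𝕜 (f ∘ φ.symm) (φ x) :=
    (hf.contDiffAt h.patch h.mem).isSymmSndFDerivAt (by simpa using two_le_of_infty_le h.le)
  have hd : DifferentiableAt 𝕜 (fderiv 𝕜 (f ∘ φ.symm)) (φ x) :=
    ((hf.contDiffAt h.patch h.mem).fderiv_right (add_one_le_of_infty_le h.le)).differentiableAt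
      (ne_zero_of_infty_le h.le)
  have key : ∀ k l : Fin n, FlatPencil.pd φ k (FlatPencil.pd φ l f) x
      = fderiv 𝕜 (fderiv 𝕜 (f ∘ φ.symm)) (φ x) (Pi.single k 1) (Pi.single l 1) := by
    intro k l
    have h1 : (FlatPencil.pd φ l f) ∘ φ.symm =ᶠ[𝓝 (φ x)]
        fun z => fderiv 𝕜 (f ∘ φ.symm) z (Pi.single l 1) := by
      filter_upwards [φ.open_target.mem_nhds (φ.map_source h.mem)] with z hz
      simp only [Function.comp, FlatPencil.pd, φ.right_inv hz]
    rw [show FlatPencil.pd φ k (FlatPencil.pd φ l f) x = fderiv 𝕜 (FlatPencil.pd φ l f ∘ φ.symm) (φ x) (Pi.single k 1) from rfl, h1.fderiv_eq, fderiv_clm_apply hd (differentiableAt_const _)]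
    simp
  rw [key, key]
  exact hs _ _

end pd

/-! ### Coordinates and the Jacobian matrix -/

variable [IsManifold 𝓘(𝕜, Fin n → 𝕜) r M]

lemma smAt_coord (h : PatchAt r φ x) (i : Fin n) :
    SmAt n r (fun y => φ y i) x :=
  smAt_of_contDiffAt h.patch h.mem (F := fun z => z i) (contDiff_apply 𝕜 𝕜 i).contDiffAt

lemma pd_coord (hx : x ∈ φ.source) (i k : Fin n) :
    pd φ k (fun y => φ y i) x = if i = k then 1 else 0 := by
  have h1 : (fun y => φ y i) ∘ φ.symm =ᶠ[𝓝 (φ x)] fun z => (id z) i := by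
    filter_upwards [φ.open_target.mem_nhds (φ.map_source hx)] with z hz
    simp only [Function.comp, φ.right_inv hz, id]
  unfold pd
  rw [h1.fderiv_eq, fderiv_apply differentiableAt_id]
  simp [Pi.single_apply]

lemma symm_comp_eventuallyEq {α : Type*} (hx : x ∈ φ.source) (hx' : x ∈ ψ.source) (f : M → α) :
    f ∘ φ.symm =ᶠ[𝓝 (φ x)] (f ∘ ψ.symm) ∘ (ψ ∘ φ.symm) := by
  have h2 : Filter.Tendsto φ.symm (𝓝 (φ x)) (𝓝 x) := by
    have := φ.continuousAt_symm (φ.map_source hx)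
    rwa [ContinuousAt, φ.left_inv hx] at this
  filter_upwards [h2.eventually (ψ.open_source.mem_nhds hx')] with z hz
  simp only [Function.comp, ψ.left_inv hz]

lemma differentiableAt_transition (hφ : PatchAt r φ x) (hψ : PatchAt r ψ x) :
    DifferentiableAt 𝕜 (ψ ∘ φ.symm) (φ x) :=
  differentiableAt_pi.2 fun a => (smAt_coord hψ a).differentiableAt hφ

lemma fderiv_transition_apply (hφ : PatchAt r φ x) (hψ : PatchAt r ψ x) (i a : Fin n) :
    fderiv 𝕜 (ψ ∘ φ.symm) (φ x) (Pi.single i 1) a = pd φ i (fun y => ψ y a) x := by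
  unfold pd
  rw [show (fun y => ψ y a) ∘ φ.symm = fun z => (ψ ∘ φ.symm) z a from rfl,
    fderiv_apply (differentiableAt_transition hφ hψ)]
  rfl

/-- Chain rule for the change of coordinates from `ψ` to `φ`. -/
lemma pd_chain (hφ : PatchAt r φ x) (hψ : PatchAt r ψ x) (hf : SmAt n r f x) (i : Fin n) :
    pd φ i f x = ∑ a, pd φ i (fun y => ψ y a) x * pd ψ a f x := by
  have hF : DifferentiableAt 𝕜 (f ∘ ψ.symm) ((ψ ∘ φ.symm) (φ x)) := by
    simpa [φ.left_inv hφ.mem] using hf.differentiableAt hψ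
  simp only [← fderiv_transition_apply hφ hψ]
  unfold pd
  rw [(symm_comp_eventuallyEq hφ.mem hψ.mem f).fderiv_eq,
    fderiv_comp _ hF (differentiableAt_transition hφ hψ), ContinuousLinearMap.comp_apply]
  set v := fderiv 𝕜 (ψ ∘ φ.symm) (φ x) (Pi.single i 1)
  conv_lhs => rw [pi_eq_sum_univ' v, map_sum]
  simp only [Function.comp, φ.left_inv hφ.mem, map_smul, smul_eq_mul]

/-- The Jacobian matrix `∂ψ^a/∂x^i`, with rows indexed by the coordinates of `φ`. -/
def jac (φ ψ : OpenPartialHomeomorph M (Fin n → 𝕜)) (x : M) : Matrix (Fin n) (Fin n) 𝕜 :=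
  Matrix.of fun i a => pd φ i (fun y => ψ y a) x

lemma pd_chain_jac (hφ : PatchAt r φ x) (hψ : PatchAt r ψ x) (hf : SmAt n r f x) (i : Fin n) :
    pd φ i f x = ∑ a, jac φ ψ x i a * pd ψ a f x := pd_chain hφ hψ hf i

lemma smAt_jac (hφ : PatchAt r φ x) (hψ : PatchAt r ψ x) (i a : Fin n) :
    SmAt n r (fun y => jac φ ψ y i a) x :=
  (smAt_coord hψ a).pd hφ i

lemma jac_mul_jac (hφ : PatchAt r φ x) (hψ : PatchAt r ψ x) : jac φ ψ x * jac ψ φ x = 1 := by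
  ext i j
  have := pd_chain hφ hψ (smAt_coord hφ j) i
  rw [pd_coord hφ.mem] at this
  rw [Matrix.mul_apply, Matrix.one_apply]
  simp only [jac, Matrix.of_apply, ← this, eq_comm]

lemma isUnit_jac (hφ : PatchAt r φ x) (hψ : PatchAt r ψ x) : IsUnit (jac φ ψ x) :=
  IsUnit.of_mul_eq_one _ (jac_mul_jac hφ hψ)

lemma det_jac_ne_zero (hφ : PatchAt r φ x) (hψ : PatchAt r ψ x) : (jac φ ψ x).det ≠ 0 :=
  ((Matrix.isUnit_iff_isUnit_det _).1 (isUnit_jac hφ hψ)).ne_zero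

/-! ### Vectors, covectors and bilinear forms in components -/

lemma mdifferentiable_patch (h : PatchAt r φ x) :
    φ.MDifferentiable 𝓘(𝕜, Fin n → 𝕜) 𝓘(𝕜, Fin n → 𝕜) := by
  have h1 : (1 : WithTop ℕ∞) ≤ r := le_trans (by norm_num) (two_le_of_infty_le h.le)
  have hm := IsManifold.maximalAtlas_subset_of_le h1 h.patch
  have := IsManifold.of_le (I := 𝓘(𝕜, Fin n → 𝕜)) (M := M) h1
  exact ⟨fun y hy => (mdifferentiableAt_of_mem_maximalAtlas hm hy).mdifferentiableWithinAt,
    fun y hy => (mdifferentiableAt_symm_of_mem_maximalAtlas hm hy).mdifferentiableWithinAt⟩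

/-- The differential of a coordinate patch as a linear isomorphism. -/
def patchDeriv (h : PatchAt r φ x) : Tan 𝕜 n x ≃ₗ[𝕜] (Fin n → 𝕜) :=
  ((mdifferentiable_patch h).mfderiv h.mem).toLinearEquiv

lemma dcoord_apply (h : PatchAt r φ x) (i : Fin n) (v : Tan 𝕜 n x) :
    dcoord φ i x v = patchDeriv h v i := rfl

lemma coordVec_eq (h : PatchAt r φ x) (i : Fin n) :
    coordVec φ i x = (patchDeriv h).symm (Pi.single i 1) := by
  unfold coordVec
  have : mfderiv 𝓘(𝕜, Fin n → 𝕜) 𝓘(𝕜, Fin n → 𝕜) φ x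
    = ((mdifferentiable_patch h).mfderiv h.mem : _ →L[𝕜] _) := rfl
  rw [this, ContinuousLinearMap.inverse_equiv]
  rfl

lemma dcoord_coordVec (h : PatchAt r φ x) (i j : Fin n) :
    dcoord φ i x (coordVec φ j x) = if i = j then 1 else 0 := by
  rw [dcoord_apply h, coordVec_eq h, LinearEquiv.apply_symm_apply, Pi.single_apply]

lemma tan_eq_sum (h : PatchAt r φ x) (v : Tan 𝕜 n x) :
    v = ∑ i, dcoord φ i x v • coordVec φ i x := by
  apply (patchDeriv h).injective
  simp only [map_sum, map_smul, coordVec_eq h, LinearEquiv.apply_symm_apply, dcoord_apply h]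
  exact pi_eq_sum_univ' _

lemma cotan_eq_sum (h : PatchAt r φ x) (u : Cotan 𝕜 n x) :
    u = ∑ i, covComp φ u i • dcoord φ i x := by
  ext v
  conv_lhs => rw [tan_eq_sum h v]
  simp [covComp, mul_comm]

lemma covOf_covComp (h : PatchAt r φ x) (u : Cotan 𝕜 n x) : covOf φ x (covComp φ u) = u :=
  (cotan_eq_sum h u).symm

lemma covComp_covOf (h : PatchAt r φ x) (w : Fin n → 𝕜) : covComp φ (covOf φ x w) = w := by
  ext i
  simp [covComp, covOf, dcoord_coordVec h]

lemma cotan_ext (h : PatchAt r φ x) {u w : Cotan 𝕜 n x}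
    (huw : covComp φ u = covComp φ w) : u = w := by
  rw [← covOf_covComp h u, huw, covOf_covComp h]

lemma mfderiv_coord_comp (hφ : PatchAt r φ x) {F : M → 𝕜} (hF : SmAt n r F x) (v : Tan 𝕜 n x) :
    mfderiv 𝓘(𝕜, Fin n → 𝕜) 𝓘(𝕜, 𝕜) F x v
      = fderiv 𝕜 (F ∘ φ.symm) (φ x) (patchDeriv hφ v) := by
  have h1 : F =ᶠ[𝓝 x] (F ∘ φ.symm) ∘ φ := by
    filter_upwards [φ.open_source.mem_nhds hφ.mem] with y hy
    simp only [Function.comp, φ.left_inv hy]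
  have h2 : MDifferentiableAt 𝓘(𝕜, Fin n → 𝕜) 𝓘(𝕜, 𝕜) (F ∘ φ.symm) (φ x) :=
    (hF.differentiableAt hφ).mdifferentiableAt
  have h3 := (mdifferentiable_patch hφ).mdifferentiableAt hφ.mem
  rw [h1.mfderiv_eq, mfderiv_comp x h2 h3, mfderiv_eq_fderiv]
  rfl

lemma dform_apply (hφ : PatchAt r φ x) {F : M → 𝕜} (hF : SmAt n r F x) (v : Tan 𝕜 n x) :
    dform n F x v = ∑ i, pd φ i F x * dcoord φ i x v := by
  have h := mfderiv_coord_comp hφ hF v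
  change dform n F x v = _ at h
  rw [h]
  conv_lhs => rw [pi_eq_sum_univ' (patchDeriv hφ v), map_sum]
  simp only [map_smul, smul_eq_mul, dcoord_apply hφ, pd, mul_comm]

lemma dform_eq (hφ : PatchAt r φ x) {F : M → 𝕜} (hF : SmAt n r F x) :
    dform n F x = ∑ i, pd φ i F x • dcoord φ i x := by
  ext v
  rw [dform_apply hφ hF]
  simp

lemma dform_coord (h : PatchAt r φ x) (i : Fin n) : dform n (fun y => φ y i) x = dcoord φ i x := by
  rw [dform_eq h (smAt_coord h i)]
  simp [pd_coord h.mem]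

/-- The transformation law of the coordinate differentials. -/
lemma dcoord_eq_jac (hφ : PatchAt r φ x) (hψ : PatchAt r ψ x) (a : Fin n) :
    dcoord ψ a x = ∑ i, jac φ ψ x i a • dcoord φ i x := by
  rw [← dform_coord hψ, dform_eq hφ (smAt_coord hψ a)]
  rfl

lemma covComp_eq_jac (hφ : PatchAt r φ x) (hψ : PatchAt r ψ x) (u : Cotan 𝕜 n x) :
    covComp φ u = (jac φ ψ x).mulVec (covComp ψ u) := by
  conv_lhs => rw [cotan_eq_sum hψ u]
  ext i
  simp only [dcoord_eq_jac hφ hψ]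
  simp [covComp, Matrix.mulVec, dotProduct, dcoord_coordVec hφ, mul_comm]

lemma covOf_jac (hφ : PatchAt r φ x) (hψ : PatchAt r ψ x) (w : Fin n → 𝕜) :
    covOf φ x ((jac φ ψ x).mulVec w) = covOf ψ x w := by
  apply cotan_ext hφ
  rw [covComp_covOf hφ, covComp_eq_jac hφ hψ, covComp_covOf hψ]

lemma coComp_eq_jac (hφ : PatchAt r φ x) (hψ : PatchAt r ψ x) (g : CoForm 𝕜 n M) :
    coComp ψ g x = (jac φ ψ x).transpose * coComp φ g x * jac φ ψ x := by
  ext a b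
  simp only [coComp, Matrix.of_apply, dcoord_eq_jac hφ hψ, Matrix.mul_apply, Matrix.transpose_apply,
    map_sum, map_smul, LinearMap.sum_apply, LinearMap.smul_apply, smul_eq_mul, Finset.sum_mul, Finset.mul_sum]
  exact Finset.sum_congr rfl fun i _ => Finset.sum_congr rfl fun j _ => by ring

lemma coForm_apply (h : PatchAt r φ x) (g : CoForm 𝕜 n M) (u w : Cotan 𝕜 n x) :
    g x u w = ∑ i, ∑ j, covComp φ u i * covComp φ w j * coComp φ g x i j := by
  conv_lhs => rw [cotan_eq_sum h u, cotan_eq_sum h w]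
  simp only [coComp, Matrix.of_apply, Finset.mul_sum,
    map_sum, map_smul, LinearMap.sum_apply, LinearMap.smul_apply, smul_eq_mul]
  rw [Finset.sum_comm]
  exact Finset.sum_congr rfl fun i _ => Finset.sum_congr rfl fun j _ => by ring

lemma mem_invLocus_iff (h : PatchAt r φ x) (g : CoForm 𝕜 n M) :
    x ∈ invLocus g ↔ (coComp φ g x).det ≠ 0 := by
  set b : Module.Basis (Fin n) 𝕜 (Cotan 𝕜 n x) := (Module.Basis.ofEquivFun (patchDeriv h)).dualBasis
  have hb : ∀ i, b i = dcoord φ i x := fun i => by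
    ext v
    simp [b, dcoord_apply h]
  have hm : LinearMap.BilinForm.toMatrix b (g x) = coComp φ g x := by
    ext i j
    simp [LinearMap.BilinForm.toMatrix_apply, hb, coComp]
  rw [← hm]
  exact LinearMap.BilinForm.nondegenerate_iff_det_ne_zero b

/-- Functions with `n` independent differentials at `x` separate the tangent vectors at `x`. -/
lemma eq_zero_of_dform_eq_zero {f : Fin n → M → 𝕜}
    (hl : LinearIndependent 𝕜 fun a => dform n (f a) x) {v : Tan 𝕜 n x}
    (hv : ∀ a, dform n (f a) x v = 0) : v = 0 := by
  have hfr : Module.finrank 𝕜 (Tan 𝕜 n x) = n := Module.finrank_fin_fun 𝕜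
  have hspan := hl.span_eq_top_of_card_eq_finrank' (by simp [hfr])
  rw [← Module.forall_dual_apply_eq_zero_iff 𝕜]
  intro l
  have hmem : l ∈ Submodule.span 𝕜 (Set.range fun a => dform n (f a) x) := hspan ▸ Submodule.mem_top
  induction hmem using Submodule.span_induction with
  | mem y hy => obtain ⟨a, rfl⟩ := hy; exact hv a
  | zero => rfl
  | add y z _ _ h1 h2 => rw [LinearMap.add_apply, h1, h2, add_zero]
  | smul c y _ h1 => rw [LinearMap.smul_apply, h1, smul_zero]

end

section

variable {φ ψ : OpenPartialHomeomorph M (Fin n → 𝕜)} {x : M}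

/-! ### Matrix-valued functions -/

/-- The partial derivative of a matrix-valued function, entry by entry. -/
def pdM (φ : OpenPartialHomeomorph M (Fin n → 𝕜)) (k : Fin n) (A : M → Matrix (Fin n) (Fin n) 𝕜)
    (x : M) : Matrix (Fin n) (Fin n) 𝕜 :=
  Matrix.of fun i j => pd φ k (fun y => A y i j) x

/-- The entries of the matrix-valued function `A` are of class `C^r` at `x`. -/
def SmMatAt (r : WithTop ℕ∞) (A : M → Matrix (Fin n) (Fin n) 𝕜) (x : M) : Prop :=
  ∀ i j, SmAt n r (fun y => A y i j) x

lemma SmMatAt.mul {A B : M → Matrix (Fin n) (Fin n) 𝕜} (hA : SmMatAt r A x) (hB : SmMatAt r B x) :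
    SmMatAt r (fun y => A y * B y) x := SmAt.mul_mat hA hB

lemma SmMatAt.transpose {A : M → Matrix (Fin n) (Fin n) 𝕜} (hA : SmMatAt r A x) :
    SmMatAt r (fun y => (A y).transpose) x := fun i j => hA j i

lemma SmMatAt.inv {A : M → Matrix (Fin n) (Fin n) 𝕜} (hA : SmMatAt r A x) (h0 : (A x).det ≠ 0) :
    SmMatAt r (fun y => (A y)⁻¹) x := SmAt.matrix_inv hA h0

lemma pdM_congr {A B : M → Matrix (Fin n) (Fin n) 𝕜} (hx : x ∈ φ.source) (h : A =ᶠ[𝓝 x] B)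
    (k : Fin n) : pdM φ k A x = pdM φ k B x := by
  ext i j
  refine pd_congr hx ?_ k
  filter_upwards [h] with y hy
  rw [hy]

lemma pdM_const (A : Matrix (Fin n) (Fin n) 𝕜) (k : Fin n) :
    pdM φ k (fun _ : M => A) x = 0 := by
  ext i j
  exact pd_const _ k

lemma pdM_transpose (A : M → Matrix (Fin n) (Fin n) 𝕜) (k : Fin n) :
    pdM φ k (fun y => (A y).transpose) x = (pdM φ k A x).transpose := rfl

variable [IsManifold 𝓘(𝕜, Fin n → 𝕜) r M]

lemma pdM_mul (h : PatchAt r φ x) {A B : M → Matrix (Fin n) (Fin n) 𝕜} (hA : SmMatAt r A x)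
    (hB : SmMatAt r B x) (k : Fin n) :
    pdM φ k (fun y => A y * B y) x = pdM φ k A x * B x + A x * pdM φ k B x := by
  ext i j
  simp only [pdM, Matrix.mul_apply, Matrix.add_apply, Matrix.of_apply]
  rw [pd_sum h fun s _ => (hA i s).mul (hB s j), ← Finset.sum_add_distrib]
  exact Finset.sum_congr rfl fun s _ => pd_mul h (hA i s) (hB s j) k

lemma pdM_inv (h : PatchAt r φ x) {A : M → Matrix (Fin n) (Fin n) 𝕜} (hA : SmMatAt r A x)
    (h0 : (A x).det ≠ 0) (k : Fin n) :
    pdM φ k (fun y => (A y)⁻¹) x = - ((A x)⁻¹ * pdM φ k A x * (A x)⁻¹) := by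
  have hev : ∀ᶠ y in 𝓝 x, (A y).det ≠ 0 := (SmAt.det hA).continuousAt.eventually_ne h0
  have h1 := pdM_mul h (hA.inv h0) hA k
  have h2 : pdM φ k (fun y => (A y)⁻¹ * A y) x = 0 := by
    rw [pdM_congr h.mem (B := fun _ => 1), pdM_const]
    filter_upwards [hev] with y hy
    exact Matrix.nonsing_inv_mul _ hy.isUnit
  rw [h2] at h1
  have h3 : pdM φ k (fun y => (A y)⁻¹) x * A x = - ((A x)⁻¹ * pdM φ k A x) :=
    eq_neg_of_add_eq_zero_left h1.symm
  calc pdM φ k (fun y => (A y)⁻¹) x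
      = pdM φ k (fun y => (A y)⁻¹) x * A x * (A x)⁻¹ := by
        rw [Matrix.mul_assoc, Matrix.mul_nonsing_inv _ h0.isUnit, Matrix.mul_one]
    _ = _ := by rw [h3, neg_mul]

/-! ### Christoffel symbols -/

lemma christoffel_congr {G G' : M → Matrix (Fin n) (Fin n) 𝕜} (hx : x ∈ φ.source)
    (h : G =ᶠ[𝓝 x] G') (s k j : Fin n) : christoffel φ G s k j x = christoffel φ G' s k j x := by
  have hp : ∀ a i j, pd φ a (fun y => G y i j) x = pd φ a (fun y => G' y i j) x :=
    fun a i j => congrFun (congrFun (pdM_congr hx h a) i) j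
  simp only [christoffel, hp, h.self_of_nhds]

lemma christoffel_symm {G : M → Matrix (Fin n) (Fin n) 𝕜} (hG : ∀ y, (G y).IsSymm)
    (s k j : Fin n) : christoffel φ G s k j x = christoffel φ G k s j x := by
  have hp : ∀ a i j, pd φ a (fun y => G y i j) x = pd φ a (fun y => G y j i) x := by
    intro a i j
    simp only [fun y => (hG y).apply i j]
  unfold christoffel
  congr 1
  refine Finset.sum_congr rfl fun m _ => ?_
  rw [hp s m k, hp k s m, hp m s k]
  ring

lemma smAt_christoffel (h : PatchAt r φ x) {G : M → Matrix (Fin n) (Fin n) 𝕜}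
    (hG : SmMatAt r G x) (h0 : (G x).det ≠ 0) (s k j : Fin n) :
    SmAt n r (christoffel φ G s k j) x :=
  (smAt_const _).mul (SmAt.sum fun m _ => (hG.inv h0 j m).mul
    ((((hG m k).pd h s).add ((hG s m).pd h k)).sub ((hG s k).pd h m)))

/-- The matrix `(Γ_{sk}^j)` with rows `s` and columns `j`. -/
def chrMat (φ : OpenPartialHomeomorph M (Fin n → 𝕜)) (G : M → Matrix (Fin n) (Fin n) 𝕜) (k : Fin n)
    (x : M) : Matrix (Fin n) (Fin n) 𝕜 :=
  Matrix.of fun s j => christoffel φ G s k j x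

/-- The Levi-Civita connection is compatible with the metric. -/
lemma pdM_metric {G : M → Matrix (Fin n) (Fin n) 𝕜} (hG : ∀ y, (G y).IsSymm) (h0 : (G x).det ≠ 0)
    (k : Fin n) :
    pdM φ k G x = chrMat φ G k x * G x + (chrMat φ G k x * G x).transpose := by
  have hp : ∀ a i j, pd φ a (fun y => G y i j) x = pd φ a (fun y => G y j i) x := by
    intro a i j
    simp only [fun y => (hG y).apply i j]
  have hC : ∀ s l, (chrMat φ G k x * G x) s l = (1 / 2 : 𝕜) *
      (pd φ s (fun y => G y l k) x + pd φ k (fun y => G y s l) x - pd φ l (fun y => G y s k) x) := by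
    intro s l
    set w : Fin n → 𝕜 := fun m => (1 / 2 : 𝕜) *
      (pd φ s (fun y => G y m k) x + pd φ k (fun y => G y s m) x - pd φ m (fun y => G y s k) x)
    have h1 : ∀ j, chrMat φ G k x s j = ((G x)⁻¹.mulVec w) j := by
      intro j
      simp only [chrMat, christoffel, Matrix.of_apply, Matrix.mulVec, dotProduct, Finset.mul_sum, w]
      exact Finset.sum_congr rfl fun m _ => by ring
    calc (chrMat φ G k x * G x) s l = ((G x).mulVec ((G x)⁻¹.mulVec w)) l := by
          rw [Matrix.mul_apply]
          simp only [h1, Matrix.mulVec, dotProduct]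
          refine Finset.sum_congr rfl fun j _ => ?_
          rw [(hG x).apply l j, mul_comm]
      _ = w l := by
          rw [Matrix.mulVec_mulVec, Matrix.mul_nonsing_inv _ h0.isUnit, Matrix.one_mulVec]
  ext i j
  rw [Matrix.add_apply, Matrix.transpose_apply, hC, hC, hp k j i]
  simp only [pdM, Matrix.of_apply]
  ring

/-! ### Contravariant metrics -/

section contra

variable {g : CoForm 𝕜 n M} {Γ : Coeffs 𝕜 n M}

lemma IsContraMetric.smMatAt (hg : IsContraMetric r g) (h : PatchAt r φ x) :
    SmMatAt r (coComp φ g) x := fun i j =>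
  (hg.smooth φ h.patch i j).smAt (φ.open_source.mem_nhds h.mem)

lemma IsContraMetric.coComp_isSymm (hg : IsContraMetric r g) (y : M) : (coComp φ g y).IsSymm := by
  ext i j
  exact (hg.symm y).eq _ _

lemma IsContraMetric.coInv_isSymm (hg : IsContraMetric r g) (y : M) : (coInv φ g y).IsSymm := by
  have := hg.coComp_isSymm (φ := φ) y
  unfold Matrix.IsSymm at this ⊢
  rw [coInv, Matrix.transpose_nonsing_inv, this]

lemma IsContraMetric.eventually (hg : IsContraMetric r g) (hr : ∞ ≤ r) (hx : x ∈ invLocus g) :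
    ∀ᶠ y in 𝓝 x, y ∈ invLocus g := by
  have h : PatchAt r (chartAt (Fin n → 𝕜) x) x :=
    ⟨hr, IsManifold.chart_mem_maximalAtlas x, mem_chart_source _ x⟩
  have h0 := (mem_invLocus_iff h g).1 hx
  filter_upwards [(SmAt.det (hg.smMatAt h)).continuousAt.eventually_ne h0, h.eventually] with y hy h'
  exact (mem_invLocus_iff h' g).2 hy

lemma IsContraMetric.isOpen (hg : IsContraMetric r g) (hr : ∞ ≤ r) : IsOpen (invLocus g) :=
  isOpen_iff_mem_nhds.2 fun _ hx => hg.eventually hr hx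

lemma coComp_mul_coInv (h : PatchAt r φ x) (hx : x ∈ invLocus g) :
    coComp φ g x * coInv φ g x = 1 :=
  Matrix.mul_nonsing_inv _ ((mem_invLocus_iff h g).1 hx).isUnit

lemma coInv_mul_coComp (h : PatchAt r φ x) (hx : x ∈ invLocus g) :
    coInv φ g x * coComp φ g x = 1 :=
  Matrix.nonsing_inv_mul _ ((mem_invLocus_iff h g).1 hx).isUnit

lemma det_coInv_ne_zero (h : PatchAt r φ x) (hx : x ∈ invLocus g) : (coInv φ g x).det ≠ 0 := by
  intro h0
  have := congrArg Matrix.det (coInv_mul_coComp h hx)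
  simp [h0] at this

lemma IsContraMetric.smMatAt_coInv (hg : IsContraMetric r g) (h : PatchAt r φ x)
    (hx : x ∈ invLocus g) : SmMatAt r (coInv φ g) x :=
  (hg.smMatAt h).inv ((mem_invLocus_iff h g).1 hx)

lemma IsContraLeviCivita.smAt (hΓ : IsContraLeviCivita r g Γ) (h : PatchAt r φ x) (k i j : Fin n) :
    SmAt n r (Γ φ k i j) x :=
  (hΓ.smooth φ h.patch k i j).smAt (φ.open_source.mem_nhds h.mem)

/-- The matrix `(Γ_k^{ij})` with rows `i` and columns `j`. -/
def conMat (φ : OpenPartialHomeomorph M (Fin n → 𝕜)) (Γ : Coeffs 𝕜 n M) (k : Fin n) (x : M) :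
    Matrix (Fin n) (Fin n) 𝕜 :=
  Matrix.of fun i j => Γ φ k i j x

lemma IsContraLeviCivita.conMat_eq (hΓ : IsContraLeviCivita r g Γ) (h : PatchAt r φ x)
    (hx : x ∈ invLocus g) (k : Fin n) :
    conMat φ Γ k x = - (coComp φ g x * chrMat φ (coInv φ g) k x) := by
  ext i j
  simp only [conMat, chrMat, Matrix.of_apply, hΓ.eq φ h.patch x ⟨h.mem, hx⟩, Matrix.neg_apply,
    Matrix.mul_apply]

/-- `∂_k g^{ij} = Γ_k^{ij} + Γ_k^{ji}`. -/
lemma IsContraLeviCivita.pdM_coComp (hΓ : IsContraLeviCivita r g Γ) (hg : IsContraMetric r g)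
    (h : PatchAt r φ x) (hx : x ∈ invLocus g) (k : Fin n) :
    pdM φ k (coComp φ g) x = conMat φ Γ k x + (conMat φ Γ k x).transpose := by
  have h1 : pdM φ k (coComp φ g) x = pdM φ k (fun y => (coInv φ g y)⁻¹) x := by
    refine pdM_congr h.mem ?_ k
    filter_upwards [hg.eventually h.le hx, h.eventually] with y hy h'
    exact (Matrix.nonsing_inv_nonsing_inv _ ((mem_invLocus_iff h' g).1 hy).isUnit).symm
  have h2 : (coInv φ g x)⁻¹ = coComp φ g x :=
    Matrix.nonsing_inv_nonsing_inv _ ((mem_invLocus_iff h g).1 hx).isUnit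
  have hs : (coComp φ g x).transpose = coComp φ g x := hg.coComp_isSymm x
  have hs' : (coInv φ g x).transpose = coInv φ g x := hg.coInv_isSymm x
  rw [h1, pdM_inv h (hg.smMatAt_coInv h hx) (det_coInv_ne_zero h hx), h2,
    pdM_metric hg.coInv_isSymm (det_coInv_ne_zero h hx), hΓ.conMat_eq h hx]
  rw [Matrix.transpose_mul, Matrix.transpose_neg, Matrix.transpose_mul, hs, hs', mul_add, add_mul,
    neg_add]
  congr 2
  · rw [Matrix.mul_assoc, Matrix.mul_assoc, coInv_mul_coComp h hx, Matrix.mul_one]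
  · rw [← Matrix.mul_assoc, coComp_mul_coInv h hx, Matrix.one_mul]

/-- The torsion of the Levi-Civita connection vanishes: `g^{is} Γ_s^{jk} = g^{js} Γ_s^{ik}`. -/
lemma IsContraLeviCivita.torsion (hΓ : IsContraLeviCivita r g Γ) (hg : IsContraMetric r g)
    (h : PatchAt r φ x) (hx : x ∈ invLocus g) (i j k : Fin n) :
    ∑ s, coComp φ g x i s * Γ φ s j k x = ∑ s, coComp φ g x j s * Γ φ s i k x := by
  simp only [hΓ.eq φ h.patch x ⟨h.mem, hx⟩, mul_neg, Finset.sum_neg_distrib, Finset.mul_sum]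
  rw [Finset.sum_comm]
  congr 1
  refine Finset.sum_congr rfl fun m _ => Finset.sum_congr rfl fun s _ => ?_
  rw [christoffel_symm hg.coInv_isSymm m s k]
  ring

lemma eq_zero_of_sum_pd {f : Fin n → M → 𝕜} (h : PatchAt r φ x) (hf : ∀ a, SmAt n r (f a) x)
    (hl : LinearIndependent 𝕜 fun a => dform n (f a) x) {w : Fin n → 𝕜}
    (hw : ∀ a, ∑ k, pd φ k (f a) x * w k = 0) : w = 0 := by
  have h1 : (patchDeriv h).symm w = 0 := by
    refine eq_zero_of_dform_eq_zero hl fun a => ?_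
    rw [dform_apply h (hf a)]
    simpa [dcoord_apply h] using hw a
  simpa using h1

/-- Covariant derivative `∂_l Δ_j^{ik} + C_{lm}^i Δ_j^{mk} + C_{lm}^k Δ_j^{im}` in which the lower index
`j` is ignored; it is meant to be antisymmetrised in `l` and `j`. -/
def covUp (φ : OpenPartialHomeomorph M (Fin n → 𝕜)) (C Δ : Fin n → Fin n → Fin n → M → 𝕜)
    (l j i k : Fin n) (x : M) : 𝕜 :=
  pd φ l (Δ j i k) x + ∑ m, C l m i x * Δ j m k x + ∑ m, C l m k x * Δ j i m x

/-- The curvature of the symmetric connection with coefficients `C`. -/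
def curv (φ : OpenPartialHomeomorph M (Fin n → 𝕜)) (C : Fin n → Fin n → Fin n → M → 𝕜)
    (l k i j : Fin n) (x : M) : 𝕜 :=
  pd φ i (C j k l) x - pd φ j (C i k l) x + ∑ m, (C i m l x * C j k m x - C j m l x * C i k m x)

/-- The curvature of a flat contravariant metric vanishes. It is written here in terms of the
tensor `Δ = Γ + g C`, the difference of the connection of `g` and an arbitrary symmetric connection
`C`. In a pencil, `C` can be chosen independent of the parameter, and then so is `Δ`.

With the covariant Hessian `H = ∇ξ` of a flat coordinate `f`, `ξ = df`, taken with respect to `C`, the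
flatness equation reads `g^{is} H_{sj} + Δ_j^{is} ξ_s = 0`. Its covariant derivative in the direction
`l`, antisymmetrised in `l` and `j` and contracted with `g^{ml}`, is a linear equation on `ξ` once `H`
is eliminated; the differentials of the flat coordinates span, so its coefficients vanish. -/
lemma IsFlat.curvature (hflat : IsFlat r g Γ) (hΓ : IsContraLeviCivita r g Γ)
    (hg : IsContraMetric r g) (h : PatchAt r φ x) (hx : x ∈ invLocus g)
    {C Δ : Fin n → Fin n → Fin n → M → 𝕜} (hC : ∀ s k j, SmAt n r (C s k j) x)
    (hCs : ∀ s k j y, C s k j y = C k s j y)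
    (hΔ : ∀ᶠ y in 𝓝 x, ∀ k i j, Δ k i j y = Γ φ k i j y + ∑ m, coComp φ g y i m * C m k j y)
    (m i j k : Fin n) :
    ∑ l, coComp φ g x m l * (covUp φ C Δ l j i k x - covUp φ C Δ j l i k x)
      + ∑ s, (Δ s m k x * Δ j s i x - Δ s m i x * Δ j s k x)
      - ∑ l, ∑ s, coComp φ g x m l * coComp φ g x i s * curv φ C k s l j x = 0 := by
  obtain ⟨V, hV, hxV, f, hf, hl⟩ := hflat x hx
  have hsm : ∀ y ∈ V, ∀ a, SmAt n r (f a) y := fun y hy a => (hf a).1.smAt (hV.mem_nhds hy)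
  suffices hw : (fun k => ∑ l, coComp φ g x m l * (covUp φ C Δ l j i k x - covUp φ C Δ j l i k x)
      + ∑ s, (Δ s m k x * Δ j s i x - Δ s m i x * Δ j s k x)
      - ∑ l, ∑ s, coComp φ g x m l * coComp φ g x i s * curv φ C k s l j x) = 0 from congrFun hw k
  refine eq_zero_of_sum_pd h (hsm x hxV) (hl x hxV) fun a => ?_
  have hfa := hsm x hxV a
  have hG := hg.smMatAt h
  have hΔs : ∀ k i j, SmAt n r (Δ k i j) x := fun k i j => by
    refine SmAt.congr (f := fun y => Γ φ k i j y + ∑ m, coComp φ g y i m * C m k j y)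
      ((hΓ.smAt h k i j).add (SmAt.sum fun m _ => (hG i m).mul (hC m k j))) ?_
    filter_upwards [hΔ] with y hy using hy k i j
  set H : Fin n → Fin n → M → 𝕜 := fun s j y =>
    pd φ s (pd φ j (f a)) y - ∑ k, C s j k y * pd φ k (f a) y with hHdef
  have hHs : ∀ s j, SmAt n r (H s j) x := fun s j =>
    ((hfa.pd h j).pd h s).sub (SmAt.sum fun k _ => (hC s j k).mul (hfa.pd h k))
  have hev : ∀ i j, ∀ᶠ y in 𝓝 x,
      ∑ s, coComp φ g y i s * H s j y + ∑ s, Δ j i s y * pd φ s (f a) y = 0 := by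
    intro i j
    filter_upwards [hV.mem_nhds hxV, h.eventually, hΔ] with y hy h' hΔy
    rw [← (hf a).2 φ h.patch y ⟨h'.mem, hy⟩ i j]
    simp only [hHdef, hΔy, mul_sub, add_mul, Finset.sum_add_distrib, Finset.sum_sub_distrib,
      Finset.mul_sum, Finset.sum_mul]
    rw [Finset.sum_comm (f := fun a b => coComp φ g y i b * C b j a y * _)]
    simp only [mul_assoc]
    ring
  have h0 : ∀ i j, ∑ s, coComp φ g x i s * H s j x = - ∑ s, Δ j i s x * pd φ s (f a) x :=
    fun i j => eq_neg_of_add_eq_zero_left (hev i j).self_of_nhds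
  have hH : ∀ s j, H s j x = H j s x := fun s j => by
    simp only [hHdef, pd_comm h hfa s j, hCs s j]
  have hξ : ∀ l s, pd φ l (pd φ s (f a)) x = H l s x + ∑ k, C l s k x * pd φ k (f a) x :=
    fun l s => by simp only [hHdef]; ring
  -- the derivative of the equation of flat coordinates
  have hd : ∀ l j, ∑ s, (pd φ l (fun y => coComp φ g y i s) x * H s j x
      + coComp φ g x i s * pd φ l (H s j) x)
      + ∑ s, (pd φ l (Δ j i s) x * pd φ s (f a) x
        + Δ j i s x * pd φ l (pd φ s (f a)) x) = 0 := by
    intro l j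
    have h1 := pd_eq_zero_of_eventually_const h.mem (hev i j) l
    rw [pd_add h (SmAt.sum fun s _ => (hG i s).mul (hHs s j))
      (SmAt.sum fun s _ => (hΔs j i s).mul (hfa.pd h s)),
      pd_sum h (fun s _ => (hG i s).mul (hHs s j)),
      pd_sum h (fun s _ => (hΔs j i s).mul (hfa.pd h s))] at h1
    rw [← h1]
    congr 1
    · exact Finset.sum_congr rfl fun s _ => (pd_mul h (hG i s) (hHs s j) l).symm
    · exact Finset.sum_congr rfl fun s _ => (pd_mul h (hΔs j i s) (hfa.pd h s) l).symm
  have hm : ∀ l s, pd φ l (fun y => coComp φ g y i s) x = Δ l i s x + Δ l s i x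
      - ∑ m, coComp φ g x i m * C m l s x - ∑ m, coComp φ g x s m * C m l i x := fun l s => by
    have h1 : pd φ l (fun y => coComp φ g y i s) x = Γ φ l i s x + Γ φ l s i x :=
      congrFun (congrFun (hΓ.pdM_coComp hg h hx l) i) s
    rw [h1, hΔ.self_of_nhds, hΔ.self_of_nhds]
    ring
  -- the derivatives of `g` are expressed by `Δ` and `C`, so that the terms with `C` combine into
  -- covariant derivatives of `Δ` and `H`
  have hA : ∀ l j, ∑ s, Δ l i s x * H s j x + ∑ s, Δ l s i x * H s j x
      + ∑ s, coComp φ g x i s * (pd φ l (H s j) x - ∑ m, C s l m x * H m j x)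
      + ∑ k, covUp φ C Δ l j i k x * pd φ k (f a) x + ∑ s, Δ j i s x * H l s x = 0 := by
    intro l j
    rw [← hd l j]
    have e1 : ∑ s, (∑ m, coComp φ g x s m * C m l i x) * H s j x
        = - ∑ k, (∑ m, C l m i x * Δ j m k x) * pd φ k (f a) x := by
      calc ∑ s, (∑ m, coComp φ g x s m * C m l i x) * H s j x
          = ∑ m, C m l i x * ∑ s, coComp φ g x m s * H s j x := by
            simp only [Finset.mul_sum, Finset.sum_mul]
            rw [Finset.sum_comm]
            refine Finset.sum_congr rfl fun m _ => Finset.sum_congr rfl fun s _ => ?_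
            rw [(hg.coComp_isSymm x).apply m s]
            ring
        _ = _ := by
            simp only [h0, Finset.mul_sum, Finset.sum_mul, mul_neg, Finset.sum_neg_distrib]
            rw [Finset.sum_comm]
            congr 1
            refine Finset.sum_congr rfl fun k _ => Finset.sum_congr rfl fun m _ => ?_
            rw [hCs m l]
            ring
    have e2 : ∑ s, (∑ m, coComp φ g x i m * C m l s x) * H s j x
        = ∑ s, coComp φ g x i s * ∑ m, C s l m x * H m j x := by
      simp only [Finset.mul_sum, Finset.sum_mul]
      rw [Finset.sum_comm]
      simp only [mul_assoc]
    have e3 : ∑ s, Δ j i s x * ∑ k, C l s k x * pd φ k (f a) x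
        = ∑ k, (∑ m, C l m k x * Δ j i m x) * pd φ k (f a) x := by
      simp only [Finset.mul_sum, Finset.sum_mul]
      rw [Finset.sum_comm]
      exact Finset.sum_congr rfl fun k _ => Finset.sum_congr rfl fun m _ => by ring
    simp only [hm, hξ, covUp, mul_add, add_mul, sub_mul, mul_sub, Finset.sum_add_distrib,
      Finset.sum_sub_distrib]
    rw [e1, e2, e3]
    ring
  -- Ricci identity for the third covariant derivatives of `f`
  have hW : ∀ l s, (pd φ l (H s j) x - ∑ m, C s l m x * H m j x)
      - (pd φ j (H s l) x - ∑ m, C s j m x * H m l x)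
      = - ∑ k, curv φ C k s l j x * pd φ k (f a) x := by
    intro l s
    have hT : pd φ l (pd φ s (pd φ j (f a))) x = pd φ j (pd φ s (pd φ l (f a))) x := by
      rw [pd_comm h (hfa.pd h j) l s, pd_comm h (hfa.pd h l) j s]
      refine pd_congr h.mem ?_ s
      filter_upwards [h.eventually, hV.mem_nhds hxV] with y h' hy
      exact pd_comm h' (hsm y hy a) l j
    have hp : ∀ l j, pd φ l (H s j) x = pd φ l (pd φ s (pd φ j (f a))) x
        - ∑ k, (pd φ l (C s j k) x * pd φ k (f a) x
          + C s j k x * (H k l x + ∑ p, C k l p x * pd φ p (f a) x)) := by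
      intro l j
      rw [hHdef]
      rw [pd_sub h ((hfa.pd h j).pd h s) (SmAt.sum fun k _ => (hC s j k).mul (hfa.pd h k)),
        pd_sum h fun k _ => (hC s j k).mul (hfa.pd h k)]
      congr 1
      refine Finset.sum_congr rfl fun k _ => ?_
      rw [pd_mul h (hC s j k) (hfa.pd h k), pd_comm h hfa l k, hξ]
    have hq : ∀ l j, ∑ k, C s j k x * ∑ p, C k l p x * pd φ p (f a) x
        = ∑ p, (∑ k, C l k p x * C j s k x) * pd φ p (f a) x := by
      intro l j
      simp only [Finset.mul_sum, Finset.sum_mul]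
      rw [Finset.sum_comm]
      refine Finset.sum_congr rfl fun k _ => Finset.sum_congr rfl fun m _ => ?_
      rw [hCs m l, hCs s j]
      ring
    have hpc : ∀ l j k, pd φ l (C s j k) x = pd φ l (C j s k) x := fun l j k => by
      rw [show C s j k = C j s k from funext fun y => hCs s j k y]
    rw [hp, hp, hT]
    simp only [curv, mul_add, add_mul, sub_mul, Finset.sum_add_distrib,
      Finset.sum_sub_distrib, hq, hpc]
    ring
  -- antisymmetrisation in `l` and `j`
  have h2 : ∀ l, ∑ s, Δ l s i x * H s j x - ∑ s, Δ j s i x * H l s x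
      + ∑ k, (covUp φ C Δ l j i k x - covUp φ C Δ j l i k x) * pd φ k (f a) x
      - ∑ s, coComp φ g x i s * ∑ k, curv φ C k s l j x * pd φ k (f a) x = 0 := by
    intro l
    have e1 := hA l j
    have e2 := hA j l
    have e3 : ∑ s, coComp φ g x i s * ∑ k, curv φ C k s l j x * pd φ k (f a) x
        = - (∑ s, coComp φ g x i s * (pd φ l (H s j) x - ∑ m, C s l m x * H m j x)
          - ∑ s, coComp φ g x i s * (pd φ j (H s l) x - ∑ m, C s j m x * H m l x)) := by
      rw [← Finset.sum_sub_distrib, ← Finset.sum_neg_distrib]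
      refine Finset.sum_congr rfl fun s _ => ?_
      rw [← mul_sub, hW]
      ring
    rw [e3, ← sub_eq_zero.2 (e1.trans e2.symm)]
    simp only [sub_mul, Finset.sum_sub_distrib, fun s => hH j s, fun s => hH s l]
    ring
  -- both `g` and `C` are torsion-free
  have htor : ∀ i j k, ∑ s, coComp φ g x i s * Δ s j k x = ∑ s, coComp φ g x j s * Δ s i k x := by
    intro i j k
    simp only [hΔ.self_of_nhds, mul_add, Finset.sum_add_distrib, hΓ.torsion hg h hx i j,
      Finset.mul_sum]
    congr 1
    rw [Finset.sum_comm]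
    refine Finset.sum_congr rfl fun s _ => Finset.sum_congr rfl fun m _ => ?_
    rw [hCs m s]
    ring
  -- elimination of `H`, after contraction with `g^{ml}`
  have h3 : ∑ l, coComp φ g x m l * (∑ s, Δ l s i x * H s j x)
      = - ∑ k, (∑ l, Δ l m i x * Δ j l k x) * pd φ k (f a) x := by
    calc ∑ l, coComp φ g x m l * (∑ s, Δ l s i x * H s j x)
        = ∑ s, (∑ l, coComp φ g x m l * Δ l s i x) * H s j x := by
          simp only [Finset.mul_sum, Finset.sum_mul]
          rw [Finset.sum_comm]
          simp only [mul_assoc]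
      _ = ∑ s, (∑ l, coComp φ g x s l * Δ l m i x) * H s j x := by
          simp only [htor m]
      _ = ∑ l, Δ l m i x * ∑ s, coComp φ g x l s * H s j x := by
          simp only [Finset.mul_sum, Finset.sum_mul]
          rw [Finset.sum_comm]
          refine Finset.sum_congr rfl fun l _ => Finset.sum_congr rfl fun s _ => ?_
          rw [(hg.coComp_isSymm x).apply l s]
          ring
      _ = _ := by
          simp only [h0, Finset.mul_sum, Finset.sum_mul, mul_neg, Finset.sum_neg_distrib]
          rw [Finset.sum_comm]
          simp only [mul_assoc]
  have h4 : ∑ l, coComp φ g x m l * (∑ s, Δ j s i x * H l s x)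
      = - ∑ k, (∑ s, Δ s m k x * Δ j s i x) * pd φ k (f a) x := by
    calc ∑ l, coComp φ g x m l * (∑ s, Δ j s i x * H l s x)
        = ∑ s, Δ j s i x * ∑ l, coComp φ g x m l * H l s x := by
          simp only [Finset.mul_sum]
          rw [Finset.sum_comm]
          exact Finset.sum_congr rfl fun l _ => Finset.sum_congr rfl fun s _ => by ring
      _ = _ := by
          simp only [h0, Finset.mul_sum, Finset.sum_mul, mul_neg, Finset.sum_neg_distrib]
          rw [Finset.sum_comm]
          congr 1
          exact Finset.sum_congr rfl fun l _ => Finset.sum_congr rfl fun s _ => by ring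
  have h5 : ∑ l, coComp φ g x m l * (∑ s, Δ l s i x * H s j x - ∑ s, Δ j s i x * H l s x
      + ∑ k, (covUp φ C Δ l j i k x - covUp φ C Δ j l i k x) * pd φ k (f a) x
      - ∑ s, coComp φ g x i s * ∑ k, curv φ C k s l j x * pd φ k (f a) x) = 0 := by
    simp only [h2, mul_zero, Finset.sum_const_zero]
  simp only [mul_add _ (Finset.sum _ _ - Finset.sum _ _), mul_sub (coComp φ g x m _),
    Finset.sum_add_distrib, Finset.sum_sub_distrib] at h5
  rw [h3, h4] at h5
  rw [← h5]
  have h6 : ∑ l, coComp φ g x m l *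
        (∑ k, (covUp φ C Δ l j i k x - covUp φ C Δ j l i k x) * pd φ k (f a) x)
      = ∑ k, (∑ l, coComp φ g x m l * (covUp φ C Δ l j i k x - covUp φ C Δ j l i k x))
        * pd φ k (f a) x := by
    simp only [Finset.mul_sum, Finset.sum_mul]
    rw [Finset.sum_comm]
    simp only [mul_assoc]
  have h7 : ∑ l, coComp φ g x m l *
        (∑ s, coComp φ g x i s * ∑ k, curv φ C k s l j x * pd φ k (f a) x)
      = ∑ k, (∑ l, ∑ s, coComp φ g x m l * coComp φ g x i s * curv φ C k s l j x)
        * pd φ k (f a) x := by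
    simp only [Finset.mul_sum, Finset.sum_mul]
    conv_rhs => rw [Finset.sum_comm]
    refine Finset.sum_congr rfl fun l _ => ?_
    conv_rhs => rw [Finset.sum_comm]
    exact Finset.sum_congr rfl fun s _ => Finset.sum_congr rfl fun k _ => by ring
  rw [h6, h7]
  simp only [← Finset.sum_add_distrib, ← Finset.sum_sub_distrib, ← Finset.sum_neg_distrib]
  refine Finset.sum_congr rfl fun k _ => ?_
  simp only [mul_sub, Finset.sum_add_distrib, Finset.sum_sub_distrib]
  ring

end contra

end

section

variable {φ ψ : OpenPartialHomeomorph M (Fin n → 𝕜)} {x : M}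

/-! ### Identities of a flat pencil -/

/-- A tensor that is symmetric in its first two indices and antisymmetric in its last two vanishes. -/
lemma eq_zero_of_symm_of_antisymm {T : Fin n → Fin n → Fin n → 𝕜}
    (h1 : ∀ i j k, T i j k = T j i k) (h2 : ∀ i j k, T i j k = - T i k j) (i j k : Fin n) :
    T i j k = 0 := by
  have : T i j k = - T i j k := by
    calc T i j k = - T i k j := h2 i j k
      _ = - T k i j := by rw [h1]
      _ = T k j i := by rw [h2 k i j, neg_neg]
      _ = T j k i := h1 _ _ _
      _ = - T j i k := h2 _ _ _
      _ = - T i j k := by rw [h1]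
  exact self_eq_neg.1 this

/-- The covariant derivative of a matrix-valued tensor; a lower row index has `P = (Γ_{k·}^·)`, an
upper row index has `P = -(Γ_{k·}^·)ᵀ`, an upper column index has `Q = (Γ_{k·}^·)` and a lower column
index has `Q = -(Γ_{k·}^·)ᵀ`. -/
def covD (φ : OpenPartialHomeomorph M (Fin n → 𝕜)) (k : Fin n) (P Q : Matrix (Fin n) (Fin n) 𝕜)
    (A : M → Matrix (Fin n) (Fin n) 𝕜) (x : M) : Matrix (Fin n) (Fin n) 𝕜 :=
  pdM φ k A x - P * A x + A x * Q

lemma covD_transpose (k : Fin n) (P Q : Matrix (Fin n) (Fin n) 𝕜)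
    (A : M → Matrix (Fin n) (Fin n) 𝕜) :
    covD φ k P Q (fun y => (A y).transpose) x
      = (covD φ k (-Q.transpose) (-P.transpose) A x).transpose := by
  simp only [covD, pdM_transpose, Matrix.transpose_add, Matrix.transpose_sub, Matrix.transpose_mul,
    Matrix.transpose_neg, Matrix.transpose_transpose]
  noncomm_ring

lemma covD_congr {A B : M → Matrix (Fin n) (Fin n) 𝕜} (hx : x ∈ φ.source) (h : A =ᶠ[𝓝 x] B)
    (k : Fin n) (P Q : Matrix (Fin n) (Fin n) 𝕜) : covD φ k P Q A x = covD φ k P Q B x := by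
  simp only [covD, pdM_congr hx h, h.self_of_nhds]

variable [IsManifold 𝓘(𝕜, Fin n → 𝕜) r M]

lemma covD_mul (h : PatchAt r φ x) {A B : M → Matrix (Fin n) (Fin n) 𝕜} (hA : SmMatAt r A x)
    (hB : SmMatAt r B x) (k : Fin n) (P Q S : Matrix (Fin n) (Fin n) 𝕜) :
    covD φ k P S (fun y => A y * B y) x = covD φ k P Q A x * B x + A x * covD φ k Q S B x := by
  simp only [covD, pdM_mul h hA hB]
  noncomm_ring

section pencil

variable {g₁ g₂ : CoForm 𝕜 n M} {Γ₁ Γ₂ : Coeffs 𝕜 n M}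

lemma coComp_sub_smul (c : 𝕜) (y : M) :
    coComp φ (g₁ - c • g₂) y = coComp φ g₁ y - c • coComp φ g₂ y := by
  ext i j
  simp [coComp]

/-- A metric of the pencil is invertible at `x` for all but finitely many parameters. So an identity
that is polynomial in the parameter can be compared coefficient by coefficient. -/
lemma pencil_coeffs (h : PatchAt r φ x) (hx : x ∈ invLocus g₂) {a b e : 𝕜}
    (H : ∀ c : 𝕜, x ∈ invLocus (g₁ - c • g₂) → a + b * c + e * c ^ 2 = 0) :
    a = 0 ∧ b = 0 ∧ e = 0 := by
  have hB := (mem_invLocus_iff h g₂).1 hx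
  set A := coComp φ g₁ x
  set B := coComp φ g₂ x
  -- up to a nonzero factor, the value of `q` at `c` is the determinant of `g₁ - c g₂`
  set q : Polynomial 𝕜 := (A * B⁻¹).charpoly
  set p : Polynomial 𝕜 := Polynomial.C a + Polynomial.C b * Polynomial.X
    + Polynomial.C e * Polynomial.X ^ 2
  have hpe : ∀ c, p.eval c = a + b * c + e * c ^ 2 := fun c => by simp [p]
  have hpq : p * q = 0 := by
    refine Polynomial.funext fun c => ?_
    rw [Polynomial.eval_mul, Polynomial.eval_zero, hpe]
    by_cases hq : q.eval c = 0
    · rw [hq, mul_zero]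
    · rw [H c, zero_mul]
      rw [mem_invLocus_iff h, coComp_sub_smul]
      have h1 : A - c • B = - ((Matrix.scalar (Fin n) c - A * B⁻¹) * B) := by
        rw [sub_mul, Matrix.mul_assoc, Matrix.nonsing_inv_mul _ hB.isUnit, Matrix.mul_one, neg_sub]
        congr 1
        ext i j
        simp [Matrix.scalar_apply, Matrix.diagonal_mul]
      rw [Matrix.eval_charpoly] at hq
      change (A - c • B).det ≠ 0
      rw [h1, Matrix.det_neg, Matrix.det_mul]
      exact mul_ne_zero (pow_ne_zero _ (neg_ne_zero.2 one_ne_zero)) (mul_ne_zero hq hB)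
  have hp : p = 0 := (mul_eq_zero.1 hpq).resolve_right (Matrix.charpoly_monic _).ne_zero
  refine ⟨?_, ?_, ?_⟩
  · simpa [p] using congrArg (fun p => p.coeff 0) hp
  · simpa [p, Polynomial.coeff_X, Polynomial.coeff_one, Polynomial.coeff_C] using
      congrArg (fun p => p.coeff 1) hp
  · simpa [p, Polynomial.coeff_X, Polynomial.coeff_one, Polynomial.coeff_C] using
      congrArg (fun p => p.coeff 2) hp

variable (hp : IsFlatPencil r g₁ g₂ Γ₁ Γ₂) (h : PatchAt r φ x) (hx : x ∈ invLocus g₂)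
include hp h hx

/-- `∂_k g₁^{ij} = Γ₁_k^{ij} + Γ₁_k^{ji}`, also where `g₁` is not invertible. -/
lemma IsFlatPencil.pdM_coComp₁ (k : Fin n) :
    pdM φ k (coComp φ g₁) x = conMat φ Γ₁ k x + (conMat φ Γ₁ k x).transpose := by
  ext i j
  have hs1 := hp.metric₁.smMatAt h
  have hs2 := hp.metric₂.smMatAt h
  have H : ∀ c : 𝕜, x ∈ invLocus (g₁ - c • g₂) →
      (pd φ k (fun y => coComp φ g₁ y i j) x - Γ₁ φ k i j x - Γ₁ φ k j i x)
      + (- (pd φ k (fun y => coComp φ g₂ y i j) x - Γ₂ φ k i j x - Γ₂ φ k j i x)) * c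
      + 0 * c ^ 2 = 0 := by
    intro c hc
    have h1 := congrFun (congrFun ((hp.leviCivita c).pdM_coComp (hp.metric c) h hc k) i) j
    simp only [pdM, Matrix.of_apply, conMat, Matrix.add_apply, Matrix.transpose_apply,
      coComp_sub_smul, Matrix.sub_apply, Matrix.smul_apply, smul_eq_mul] at h1
    rw [pd_sub h (hs1 i j) ((smAt_const c).mul (hs2 i j)), pd_const_mul h (hs2 i j)] at h1
    linear_combination h1
  have := (pencil_coeffs h hx H).1
  simp only [pdM, Matrix.of_apply, conMat, Matrix.add_apply, Matrix.transpose_apply]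
  linear_combination this

/-- The torsion identity of `g₁ - c g₂` in degrees 0 and 1 in the parameter. -/
lemma IsFlatPencil.torsions (i j k : Fin n) :
    (∑ s, coComp φ g₁ x i s * Γ₁ φ s j k x = ∑ s, coComp φ g₁ x j s * Γ₁ φ s i k x) ∧
    (∑ s, (coComp φ g₁ x i s * Γ₂ φ s j k x + coComp φ g₂ x i s * Γ₁ φ s j k x)
      = ∑ s, (coComp φ g₁ x j s * Γ₂ φ s i k x + coComp φ g₂ x j s * Γ₁ φ s i k x)) := by
  have H : ∀ c : 𝕜, x ∈ invLocus (g₁ - c • g₂) →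
      (∑ s, coComp φ g₁ x i s * Γ₁ φ s j k x - ∑ s, coComp φ g₁ x j s * Γ₁ φ s i k x)
      + (- (∑ s, (coComp φ g₁ x i s * Γ₂ φ s j k x + coComp φ g₂ x i s * Γ₁ φ s j k x)
      - ∑ s, (coComp φ g₁ x j s * Γ₂ φ s i k x + coComp φ g₂ x j s * Γ₁ φ s i k x))) * c
      + (∑ s, coComp φ g₂ x i s * Γ₂ φ s j k x - ∑ s, coComp φ g₂ x j s * Γ₂ φ s i k x) * c ^ 2
      = 0 := by
    intro c hc
    have h1 := (hp.leviCivita c).torsion (hp.metric c) h hc i j k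
    simp only [coComp_sub_smul, Matrix.sub_apply, Matrix.smul_apply, smul_eq_mul] at h1
    rw [← sub_eq_zero] at h1
    rw [← h1]
    simp only [← Finset.sum_sub_distrib, Finset.sum_mul, ← Finset.sum_add_distrib,
      ← Finset.sum_neg_distrib]
    exact Finset.sum_congr rfl fun s _ => by ring
  obtain ⟨h1, h2, -⟩ := pencil_coeffs h hx H
  exact ⟨sub_eq_zero.1 h1, sub_eq_zero.1 (neg_eq_zero.1 h2)⟩

/-- The tensor `Δ` is the difference of the connections `Γ₁` and `g₁ Γ₂`. -/
lemma IsFlatPencil.delta_eq (k i j : Fin n) :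
    delta φ g₁ g₂ Γ₁ Γ₂ k i j x
      = Γ₁ φ k i j x + ∑ m, coComp φ g₁ x i m * christoffel φ (coInv φ g₂) m k j x := by
  have hs : ∀ s, deltaUp φ g₁ g₂ Γ₁ Γ₂ s i j x = deltaUp φ g₁ g₂ Γ₁ Γ₂ i s j x := by
    intro s
    have := (hp.torsions h hx i s j).2
    simp only [deltaUp, Finset.sum_sub_distrib, Finset.sum_add_distrib] at this ⊢
    linear_combination this
  have hinv : ∀ k m, ∑ s, coInv φ g₂ x k s * coComp φ g₂ x s m = if k = m then 1 else 0 := by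
    intro k m
    have := congrFun (congrFun (coInv_mul_coComp h hx) k) m
    rwa [Matrix.mul_apply, Matrix.one_apply] at this
  have hcon : ∀ (u : Fin n → 𝕜), ∑ s, coInv φ g₂ x k s * ∑ m, coComp φ g₂ x s m * u m = u k := by
    intro u
    simp only [Finset.mul_sum]
    rw [Finset.sum_comm]
    simp only [← mul_assoc, ← Finset.sum_mul, hinv]
    simp
  calc delta φ g₁ g₂ Γ₁ Γ₂ k i j x
      = ∑ s, coInv φ g₂ x k s * ∑ m, coComp φ g₂ x s m * (Γ₁ φ m i j x
        + ∑ p, coComp φ g₁ x i p * christoffel φ (coInv φ g₂) m p j x) := by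
        unfold delta
        refine Finset.sum_congr rfl fun s _ => ?_
        rw [hs]
        congr 1
        simp only [deltaUp, hp.leviCivita₂.eq φ h.patch x ⟨h.mem, hx⟩, mul_add,
          Finset.sum_add_distrib, Finset.mul_sum, sub_eq_add_neg, mul_neg, neg_neg]
        congr 1
        rw [Finset.sum_comm]
        exact Finset.sum_congr rfl fun a _ => Finset.sum_congr rfl fun b _ => by ring
    _ = _ := by
        rw [hcon]
        simp only [christoffel_symm hp.metric₂.coInv_isSymm k]

omit hp hx in
lemma eventually_patch_invLocus (hg : IsContraMetric r g₂) (hx : x ∈ invLocus g₂) :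
    ∀ᶠ y in 𝓝 x, PatchAt r φ y ∧ y ∈ invLocus g₂ :=
  h.eventually.and (hg.eventually h.le hx)

lemma IsFlatPencil.smAt_delta (k i j : Fin n) : SmAt n r (delta φ g₁ g₂ Γ₁ Γ₂ k i j) x := by
  refine SmAt.sum fun s _ => (hp.metric₂.smMatAt_coInv h hx k s).mul (SmAt.sum fun m _ => ?_)
  exact ((hp.metric₂.smMatAt h _ _).mul (hp.leviCivita₁.smAt h _ _ _)).sub
    ((hp.metric₁.smMatAt h _ _).mul (hp.leviCivita₂.smAt h _ _ _))

omit hp in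
lemma eq_zero_of_coComp_mul {v : Fin n → 𝕜} (H : ∀ m, ∑ l, coComp φ g₂ x m l * v l = 0) (l : Fin n) :
    v l = 0 :=
  congrFun (Matrix.eq_zero_of_mulVec_eq_zero ((mem_invLocus_iff h g₂).1 hx)
    (show (coComp φ g₂ x).mulVec v = 0 from funext H)) l

lemma IsFlatPencil.delta_torsion₁ (i j k : Fin n) :
    ∑ s, coComp φ g₁ x i s * delta φ g₁ g₂ Γ₁ Γ₂ s j k x
      = ∑ s, coComp φ g₁ x j s * delta φ g₁ g₂ Γ₁ Γ₂ s i k x := by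
  simp only [hp.delta_eq h hx, mul_add, Finset.sum_add_distrib, (hp.torsions h hx i j k).1,
    Finset.mul_sum]
  congr 1
  rw [Finset.sum_comm]
  refine Finset.sum_congr rfl fun s _ => Finset.sum_congr rfl fun m _ => ?_
  rw [christoffel_symm hp.metric₂.coInv_isSymm m s]
  ring

lemma IsFlatPencil.delta_torsion₂ (i j k : Fin n) :
    ∑ s, coComp φ g₂ x i s * delta φ g₁ g₂ Γ₁ Γ₂ s j k x
      = ∑ s, coComp φ g₂ x j s * delta φ g₁ g₂ Γ₁ Γ₂ s i k x := by
  have hswap : ∀ i j, ∑ s, coComp φ g₂ x i s * ∑ m, coComp φ g₁ x j m *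
      christoffel φ (coInv φ g₂) m s k x = - ∑ s, coComp φ g₁ x j s * Γ₂ φ s i k x := by
    intro i j
    simp only [hp.leviCivita₂.eq φ h.patch x ⟨h.mem, hx⟩, Finset.mul_sum, mul_neg,
      Finset.sum_neg_distrib, neg_neg]
    rw [Finset.sum_comm]
    refine Finset.sum_congr rfl fun s _ => Finset.sum_congr rfl fun m _ => ?_
    rw [christoffel_symm hp.metric₂.coInv_isSymm m s]
    ring
  have := (hp.torsions h hx i j k).2
  simp only [hp.delta_eq h hx, mul_add, Finset.sum_add_distrib, hswap] at this ⊢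
  linear_combination this

/-- The consequences of the flatness of all metrics of the pencil: the metric `g₂` is flat, the
covariant derivative of `Δ` is symmetric, and the operators `Δ(·, v)` commute. These are the
coefficients of degree 2, 1 and 0 of the curvature of `g₁ - c g₂`. -/
lemma IsFlatPencil.curvature_coeffs :
    (∀ l k i j, riemann φ (coInv φ g₂) l k i j x = 0) ∧
    (∀ l j i k, covUp φ (christoffel φ (coInv φ g₂)) (delta φ g₁ g₂ Γ₁ Γ₂) l j i k x
      = covUp φ (christoffel φ (coInv φ g₂)) (delta φ g₁ g₂ Γ₁ Γ₂) j l i k x) ∧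
    (∀ m i j k, ∑ s, delta φ g₁ g₂ Γ₁ Γ₂ s m k x * delta φ g₁ g₂ Γ₁ Γ₂ j s i x
      = ∑ s, delta φ g₁ g₂ Γ₁ Γ₂ s m i x * delta φ g₁ g₂ Γ₁ Γ₂ j s k x) := by
  set C := christoffel φ (coInv φ g₂) with hCdef
  set Δ := delta φ g₁ g₂ Γ₁ Γ₂ with hΔdef
  have hΔ : ∀ c : 𝕜, ∀ᶠ y in 𝓝 x, ∀ k i j, Δ k i j y
      = (Γ₁ φ k i j y - c * Γ₂ φ k i j y) + ∑ m, coComp φ (g₁ - c • g₂) y i m * C m k j y := by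
    intro c
    filter_upwards [eventually_patch_invLocus h hp.metric₂ hx] with y hy k i j
    rw [hΔdef, hp.delta_eq hy.1 hy.2]
    simp only [coComp_sub_smul, Matrix.sub_apply, Matrix.smul_apply, smul_eq_mul, sub_mul,
      Finset.sum_sub_distrib, hp.leviCivita₂.eq φ hy.1.patch y ⟨hy.1.mem, hy.2⟩, mul_assoc,
      ← Finset.mul_sum, ← hCdef]
    ring
  have key : ∀ m i j k (c : 𝕜), x ∈ invLocus (g₁ - c • g₂) →
      (∑ l, coComp φ g₁ x m l * (covUp φ C Δ l j i k x - covUp φ C Δ j l i k x)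
        + ∑ s, (Δ s m k x * Δ j s i x - Δ s m i x * Δ j s k x)
        - ∑ l, ∑ s, coComp φ g₁ x m l * coComp φ g₁ x i s * curv φ C k s l j x)
      + (- ∑ l, coComp φ g₂ x m l * (covUp φ C Δ l j i k x - covUp φ C Δ j l i k x)
        + ∑ l, ∑ s, (coComp φ g₁ x m l * coComp φ g₂ x i s + coComp φ g₂ x m l * coComp φ g₁ x i s)
          * curv φ C k s l j x) * c
      + (- ∑ l, ∑ s, coComp φ g₂ x m l * coComp φ g₂ x i s * curv φ C k s l j x) * c ^ 2 = 0 := by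
    intro m i j k c hc
    have h1 := (hp.flat c).curvature (hp.leviCivita c) (hp.metric c) h hc
      (C := C) (Δ := Δ) (fun s k j => smAt_christoffel h (hp.metric₂.smMatAt_coInv h hx)
        (det_coInv_ne_zero h hx) s k j)
      (fun s k j y => christoffel_symm hp.metric₂.coInv_isSymm s k j) (hΔ c) m i j k
    rw [← h1]
    simp only [coComp_sub_smul, Matrix.sub_apply, Matrix.smul_apply, smul_eq_mul]
    have e1 : ∑ l, (coComp φ g₁ x m l - c * coComp φ g₂ x m l)
          * (covUp φ C Δ l j i k x - covUp φ C Δ j l i k x)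
        = ∑ l, coComp φ g₁ x m l * (covUp φ C Δ l j i k x - covUp φ C Δ j l i k x)
          - c * ∑ l, coComp φ g₂ x m l * (covUp φ C Δ l j i k x - covUp φ C Δ j l i k x) := by
      rw [Finset.mul_sum, ← Finset.sum_sub_distrib]
      exact Finset.sum_congr rfl fun l _ => by ring
    have e2 : ∑ l, ∑ s, (coComp φ g₁ x m l - c * coComp φ g₂ x m l)
          * (coComp φ g₁ x i s - c * coComp φ g₂ x i s) * curv φ C k s l j x
        = ∑ l, ∑ s, coComp φ g₁ x m l * coComp φ g₁ x i s * curv φ C k s l j x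
          - c * ∑ l, ∑ s, (coComp φ g₁ x m l * coComp φ g₂ x i s
            + coComp φ g₂ x m l * coComp φ g₁ x i s) * curv φ C k s l j x
          + c ^ 2 * ∑ l, ∑ s, coComp φ g₂ x m l * coComp φ g₂ x i s * curv φ C k s l j x := by
      simp only [Finset.mul_sum, ← Finset.sum_sub_distrib, ← Finset.sum_add_distrib]
      exact Finset.sum_congr rfl fun l _ => Finset.sum_congr rfl fun s _ => by ring
    rw [e1, e2]
    ring
  have hR : ∀ k s l j, curv φ C k s l j x = 0 := by
    intro k s l j
    refine eq_zero_of_coComp_mul h hx (v := fun s => curv φ C k s l j x) (fun i => ?_) s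
    refine eq_zero_of_coComp_mul h hx
      (v := fun l => ∑ s, coComp φ g₂ x i s * curv φ C k s l j x) (fun m => ?_) l
    have := neg_eq_zero.1 (pencil_coeffs h hx (key m i j k)).2.2
    rw [← this]
    simp only [Finset.mul_sum, mul_assoc]
  have h5 : ∀ l j i k, covUp φ C Δ l j i k x - covUp φ C Δ j l i k x = 0 := by
    intro l j i k
    refine eq_zero_of_coComp_mul h hx
      (v := fun l => covUp φ C Δ l j i k x - covUp φ C Δ j l i k x) (fun m => ?_) l
    have := (pencil_coeffs h hx (key m i j k)).2.1
    simpa [hR] using this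
  refine ⟨fun l k i j => hR l k i j, fun l j i k => sub_eq_zero.1 (h5 l j i k), fun m i j k => ?_⟩
  have := (pencil_coeffs h hx (key m i j k)).1
  simp only [hR, h5, mul_zero, Finset.sum_const_zero, sub_zero, zero_add,
    Finset.sum_sub_distrib] at this
  exact sub_eq_zero.1 this

end pencil

end

section

variable {φ ψ : OpenPartialHomeomorph M (Fin n → 𝕜)} {x : M}

/-! ### Quasihomogeneous flat pencils in a patch -/

/-- The covariant derivative `∇_k A` of a tensor `A^{ij}` with respect to `g`. -/
def covUU (φ : OpenPartialHomeomorph M (Fin n → 𝕜)) (g : CoForm 𝕜 n M) (k : Fin n)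
    (A : M → Matrix (Fin n) (Fin n) 𝕜) (x : M) : Matrix (Fin n) (Fin n) 𝕜 :=
  covD φ k (-(chrMat φ (coInv φ g) k x).transpose) (chrMat φ (coInv φ g) k x) A x

/-- The covariant derivative `∇_k A` of a tensor `A_i^j` with respect to `g`. -/
def covLU (φ : OpenPartialHomeomorph M (Fin n → 𝕜)) (g : CoForm 𝕜 n M) (k : Fin n)
    (A : M → Matrix (Fin n) (Fin n) 𝕜) (x : M) : Matrix (Fin n) (Fin n) 𝕜 :=
  covD φ k (chrMat φ (coInv φ g) k x) (chrMat φ (coInv φ g) k x) A x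

/-- The matrix `(Δ_k^{ij})` with rows `i` and columns `j`. -/
def deltaMat (φ : OpenPartialHomeomorph M (Fin n → 𝕜)) (g₁ g₂ : CoForm 𝕜 n M) (Γ₁ Γ₂ : Coeffs 𝕜 n M)
    (k : Fin n) (x : M) : Matrix (Fin n) (Fin n) 𝕜 :=
  Matrix.of fun i j => delta φ g₁ g₂ Γ₁ Γ₂ k i j x

/-- The matrix `(Δ_k^{mj} ∂_m τ)` with rows `k` and columns `j`; it will turn out to be `R_k^j`. -/
def opMat (φ : OpenPartialHomeomorph M (Fin n → 𝕜)) (g₁ g₂ : CoForm 𝕜 n M) (Γ₁ Γ₂ : Coeffs 𝕜 n M)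
    (τ : M → 𝕜) (x : M) : Matrix (Fin n) (Fin n) 𝕜 :=
  Matrix.of fun k j => ∑ m, delta φ g₁ g₂ Γ₁ Γ₂ k m j x * pd φ m τ x

/-- The matrix `(Δ_k^{jm} ∂_m τ)` with rows `k` and columns `j`. -/
def opMat' (φ : OpenPartialHomeomorph M (Fin n → 𝕜)) (g₁ g₂ : CoForm 𝕜 n M) (Γ₁ Γ₂ : Coeffs 𝕜 n M)
    (τ : M → 𝕜) (x : M) : Matrix (Fin n) (Fin n) 𝕜 :=
  Matrix.of fun k j => ∑ m, delta φ g₁ g₂ Γ₁ Γ₂ k j m x * pd φ m τ x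

/-- The matrix `(∂_k X^j)` with rows `k` and columns `j`. -/
def dvec (φ : OpenPartialHomeomorph M (Fin n → 𝕜)) (X : ∀ x : M, Tan 𝕜 n x) (x : M) :
    Matrix (Fin n) (Fin n) 𝕜 :=
  Matrix.of fun k j => pd φ k (vecComp φ X j) x

/-- The matrix `(∇_k X^j)` with rows `k` and columns `j`, for the Levi-Civita connection of `g`. -/
def nvec (φ : OpenPartialHomeomorph M (Fin n → 𝕜)) (g : CoForm 𝕜 n M) (X : ∀ x : M, Tan 𝕜 n x)
    (x : M) : Matrix (Fin n) (Fin n) 𝕜 :=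
  Matrix.of fun k j => nablaVec φ (coInv φ g) X k j x

variable [IsManifold 𝓘(𝕜, Fin n → 𝕜) r M]

lemma vecComp_gradient (h : PatchAt r φ x) {τ : M → 𝕜} (hτ : SmAt n r τ x) {g : CoForm 𝕜 n M}
    (hg : IsContraMetric r g) (i : Fin n) :
    vecComp φ (gradient g τ) i x = ∑ s, coComp φ g x i s * pd φ s τ x := by
  have h1 : vecComp φ (gradient g τ) i x = g x (dform n τ x) (dcoord φ i x) := by
    exact Module.apply_evalEquiv_symm_apply (R := 𝕜) (M := Tan 𝕜 n x) (dcoord φ i x) (g x (dform n τ x))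
  rw [h1, dform_eq h hτ]
  simp only [map_sum, map_smul, LinearMap.sum_apply, LinearMap.smul_apply, smul_eq_mul]
  refine Finset.sum_congr rfl fun s _ => ?_
  rw [← (hg.coComp_isSymm x).apply i s, mul_comm]
  rfl

lemma nvec_eq (g : CoForm 𝕜 n M) (X : ∀ x : M, Tan 𝕜 n x) :
    nvec φ g X x = dvec φ X x + ∑ l, vecComp φ X l x • chrMat φ (coInv φ g) l x := by
  ext k j
  simp only [nvec, nablaVec, dvec, chrMat, Matrix.of_apply, Matrix.add_apply, Matrix.sum_apply,
    Matrix.smul_apply, smul_eq_mul]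
  congr 1
  exact Finset.sum_congr rfl fun l _ => mul_comm _ _

/-- The Lie derivative of a contravariant form in terms of covariant derivatives. -/
lemma lieCo_eq (g g₂ : CoForm 𝕜 n M) (X : ∀ x : M, Tan 𝕜 n x) :
    (Matrix.of fun i j => lieCo φ X g i j x)
      = ∑ s, vecComp φ X s x • covUU φ g₂ s (coComp φ g) x
        - (nvec φ g₂ X x).transpose * coComp φ g x - coComp φ g x * nvec φ g₂ X x := by
  have h1 : (Matrix.of fun i j => lieCo φ X g i j x)
      = ∑ s, vecComp φ X s x • pdM φ s (coComp φ g) x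
        - (dvec φ X x).transpose * coComp φ g x - coComp φ g x * dvec φ X x := by
    ext i j
    simp only [lieCo, Matrix.of_apply, Matrix.sub_apply, Matrix.sum_apply, Matrix.smul_apply,
      smul_eq_mul, Matrix.mul_apply, Matrix.transpose_apply, dvec, pdM, Finset.sum_sub_distrib]
    congr 2
    exact Finset.sum_congr rfl fun s _ => mul_comm _ _
  rw [h1, nvec_eq]
  simp only [covUU, covD, smul_add, smul_sub, Finset.sum_add_distrib, Finset.sum_sub_distrib,
    Matrix.transpose_add, Matrix.transpose_sum, Matrix.transpose_smul, add_mul, mul_add,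
    Finset.sum_mul, Finset.mul_sum, Matrix.smul_mul, Matrix.mul_smul, neg_mul, smul_neg,
    Finset.sum_neg_distrib]
  abel

lemma covUU_transpose (g : CoForm 𝕜 n M) (k : Fin n) (A : M → Matrix (Fin n) (Fin n) 𝕜) :
    covUU φ g k (fun y => (A y).transpose) x = (covUU φ g k A x).transpose := by
  unfold covUU
  rw [covD_transpose, Matrix.transpose_neg, Matrix.transpose_transpose, neg_neg]

lemma covUU_mul (h : PatchAt r φ x) {A B : M → Matrix (Fin n) (Fin n) 𝕜} (hA : SmMatAt r A x)
    (hB : SmMatAt r B x) (g : CoForm 𝕜 n M) (k : Fin n) :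
    covUU φ g k (fun y => A y * B y) x = covUU φ g k A x * B x + A x * covLU φ g k B x :=
  covD_mul h hA hB k _ _ _

lemma covUU_congr {A B : M → Matrix (Fin n) (Fin n) 𝕜} (hx : x ∈ φ.source) (h : A =ᶠ[𝓝 x] B)
    (g : CoForm 𝕜 n M) (k : Fin n) : covUU φ g k A x = covUU φ g k B x :=
  covD_congr hx h k _ _

lemma covUU_add (h : PatchAt r φ x) {A B : M → Matrix (Fin n) (Fin n) 𝕜} (hA : SmMatAt r A x)
    (hB : SmMatAt r B x) (g : CoForm 𝕜 n M) (k : Fin n) :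
    covUU φ g k (fun y => A y + B y) x = covUU φ g k A x + covUU φ g k B x := by
  have : pdM φ k (fun y => A y + B y) x = pdM φ k A x + pdM φ k B x := by
    ext i j
    exact pd_add h (hA i j) (hB i j) k
  simp only [covUU, covD, this]
  noncomm_ring

lemma covUU_sum_smul (h : PatchAt r φ x) {u : Fin n → M → 𝕜} (hu : ∀ s, SmAt n r (u s) x)
    {A : Fin n → M → Matrix (Fin n) (Fin n) 𝕜} (hA : ∀ s, SmMatAt r (A s) x)
    (g : CoForm 𝕜 n M) (k : Fin n) :
    covUU φ g k (fun y => ∑ s, u s y • A s y) x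
      = ∑ s, pd φ k (u s) x • A s x + ∑ s, u s x • covUU φ g k (A s) x := by
  have : pdM φ k (fun y => ∑ s, u s y • A s y) x
      = ∑ s, pd φ k (u s) x • A s x + ∑ s, u s x • pdM φ k (A s) x := by
    ext i j
    simp only [pdM, Matrix.of_apply, Matrix.sum_apply, Matrix.smul_apply, smul_eq_mul,
      Matrix.add_apply]
    rw [pd_sum h fun s _ => (hu s).mul (hA s i j), ← Finset.sum_add_distrib]
    exact Finset.sum_congr rfl fun s _ => pd_mul h (hu s) (hA s i j) k
  simp only [covUU, covD, this, smul_add, smul_sub, Finset.sum_add_distrib, Finset.sum_sub_distrib,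
    Finset.sum_mul, Finset.mul_sum, Matrix.smul_mul, Matrix.mul_smul]
  abel

/-- The metric is covariantly constant. -/
lemma covUU_self {g : CoForm 𝕜 n M} (hg : IsContraMetric r g) {Γ : Coeffs 𝕜 n M}
    (hΓ : IsContraLeviCivita r g Γ) (h : PatchAt r φ x) (hx : x ∈ invLocus g) (k : Fin n) :
    covUU φ g k (coComp φ g) x = 0 := by
  rw [covUU, covD, hΓ.pdM_coComp hg h hx, hΓ.conMat_eq h hx]
  have hs : (coComp φ g x).transpose = coComp φ g x := hg.coComp_isSymm x
  rw [Matrix.transpose_neg, Matrix.transpose_mul, hs]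
  noncomm_ring

/-- Two functions that agree where a metric is invertible agree at every point of continuity. -/
lemma eq_of_eventually_eq_invLocus {g : CoForm 𝕜 n M} (hg : IsContraMetric r g) {f₁ f₂ : M → 𝕜}
    (h1 : ContinuousAt f₁ x) (h2 : ContinuousAt f₂ x)
    (h : ∀ᶠ y in 𝓝 x, y ∈ invLocus g → f₁ y = f₂ y) : f₁ x = f₂ x := by
  have hne : (𝓝[invLocus g] x).NeBot := mem_closure_iff_nhdsWithin_neBot.1 (hg.dense x)
  have t1 : Filter.Tendsto f₁ (𝓝[invLocus g] x) (𝓝 (f₁ x)) := h1.mono_left nhdsWithin_le_nhds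
  have t2 : Filter.Tendsto f₂ (𝓝[invLocus g] x) (𝓝 (f₂ x)) := h2.mono_left nhdsWithin_le_nhds
  refine tendsto_nhds_unique (t1.congr' ?_) t2
  exact eventually_nhdsWithin_iff.2 h

section core

variable {g₁ g₂ : CoForm 𝕜 n M} {Γ₁ Γ₂ : Coeffs 𝕜 n M} {τ : M → 𝕜} {d : 𝕜}
variable (hp : IsFlatPencil r g₁ g₂ Γ₁ Γ₂) (hq : IsQuasihomogeneous r g₁ g₂ τ d)
variable (h : PatchAt r φ x) (hx : x ∈ invLocus g₂)

omit [IsManifold 𝓘(𝕜, Fin n → 𝕜) r M] in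
include hq in
lemma IsQuasihomogeneous.smAt (x : M) : SmAt n r τ x :=
  hq.smooth.smAt Filter.univ_mem

include hp hq h in
lemma smAt_gradient₁ (i : Fin n) : SmAt n r (vecComp φ (gradient g₁ τ) i) x := by
  refine SmAt.congr (f := fun y => ∑ s, coComp φ g₁ y i s * pd φ s τ y)
    (SmAt.sum fun s _ => (hp.metric₁.smMatAt h i s).mul ((hq.smAt x).pd h s)) ?_
  filter_upwards [h.eventually] with y hy using vecComp_gradient hy (hq.smAt y) hp.metric₁ i

include hp hq h in
lemma smAt_gradient₂ (i : Fin n) : SmAt n r (vecComp φ (gradient g₂ τ) i) x := by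
  refine SmAt.congr (f := fun y => ∑ s, coComp φ g₂ y i s * pd φ s τ y)
    (SmAt.sum fun s _ => (hp.metric₂.smMatAt h i s).mul ((hq.smAt x).pd h s)) ?_
  filter_upwards [h.eventually] with y hy using vecComp_gradient hy (hq.smAt y) hp.metric₂ i

include hp h hx

lemma smMatAt_deltaMat (k : Fin n) : SmMatAt r (deltaMat φ g₁ g₂ Γ₁ Γ₂ k) x :=
  fun i j => hp.smAt_delta h hx k i j

include hq in
lemma smMatAt_opMat : SmMatAt r (opMat φ g₁ g₂ Γ₁ Γ₂ τ) x :=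
  fun k j => show SmAt n r (fun y => ∑ m, delta φ g₁ g₂ Γ₁ Γ₂ k m j y * pd φ m τ y) x from
    SmAt.sum fun m _ => (hp.smAt_delta h hx k m j).mul ((hq.smAt x).pd h m)

lemma deltaMat_eq (k : Fin n) : deltaMat φ g₁ g₂ Γ₁ Γ₂ k x
    = conMat φ Γ₁ k x + coComp φ g₁ x * chrMat φ (coInv φ g₂) k x := by
  ext i j
  simp only [deltaMat, Matrix.of_apply, hp.delta_eq h hx, conMat, Matrix.add_apply,
    Matrix.mul_apply, chrMat]

/-- `∇_k g₁^{ij} = Δ_k^{ij} + Δ_k^{ji}`. -/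
lemma covUU_coComp₁ (k : Fin n) : covUU φ g₂ k (coComp φ g₁) x
    = deltaMat φ g₁ g₂ Γ₁ Γ₂ k x + (deltaMat φ g₁ g₂ Γ₁ Γ₂ k x).transpose := by
  rw [covUU, covD, hp.pdM_coComp₁ h hx, deltaMat_eq hp h hx]
  have hs : (coComp φ g₁ x).transpose = coComp φ g₁ x := hp.metric₁.coComp_isSymm x
  rw [Matrix.transpose_add, Matrix.transpose_mul, hs]
  noncomm_ring

/-- The Codazzi equation of `Δ`. -/
lemma covUU_deltaMat_comm (l j : Fin n) : covUU φ g₂ l (deltaMat φ g₁ g₂ Γ₁ Γ₂ j) x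
    = covUU φ g₂ j (deltaMat φ g₁ g₂ Γ₁ Γ₂ l) x := by
  have key : ∀ l j, covUU φ g₂ l (deltaMat φ g₁ g₂ Γ₁ Γ₂ j) x = Matrix.of fun i k =>
      covUp φ (christoffel φ (coInv φ g₂)) (delta φ g₁ g₂ Γ₁ Γ₂) l j i k x := by
    intro l j
    ext i k
    simp only [covUU, covD, covUp, pdM, deltaMat, neg_mul, sub_neg_eq_add, Matrix.add_apply,
      Matrix.of_apply, Matrix.mul_apply, Matrix.transpose_apply, chrMat,
      christoffel_symm hp.metric₂.coInv_isSymm l]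
    congr 1
    exact Finset.sum_congr rfl fun m _ => mul_comm _ _
  rw [key, key]
  ext i k
  exact (hp.curvature_coeffs h hx).2.1 l j i k

include hq

/-- `Δ` contracted with the unity: `e^s Δ_s = g₂ R`. -/
lemma sum_smul_deltaMat₂ :
    ∑ s, vecComp φ (gradient g₂ τ) s x • deltaMat φ g₁ g₂ Γ₁ Γ₂ s x
      = coComp φ g₂ x * opMat φ g₁ g₂ Γ₁ Γ₂ τ x := by
  ext i j
  simp only [Matrix.sum_apply, Matrix.smul_apply, smul_eq_mul, Matrix.mul_apply, deltaMat, opMat,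
    Matrix.of_apply, vecComp_gradient h (hq.smAt x) hp.metric₂, Finset.mul_sum, Finset.sum_mul]
  calc ∑ s, ∑ m, coComp φ g₂ x s m * pd φ m τ x * delta φ g₁ g₂ Γ₁ Γ₂ s i j x
      = ∑ m, pd φ m τ x * ∑ s, coComp φ g₂ x m s * delta φ g₁ g₂ Γ₁ Γ₂ s i j x := by
        simp only [Finset.mul_sum]
        rw [Finset.sum_comm]
        refine Finset.sum_congr rfl fun m _ => Finset.sum_congr rfl fun s _ => ?_
        rw [(hp.metric₂.coComp_isSymm x).apply m s]
        ring
    _ = ∑ m, pd φ m τ x * ∑ s, coComp φ g₂ x i s * delta φ g₁ g₂ Γ₁ Γ₂ s m j x := by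
        simp only [hp.delta_torsion₂ h hx _ i j]
    _ = _ := by
        simp only [Finset.mul_sum]
        rw [Finset.sum_comm]
        exact Finset.sum_congr rfl fun m _ => Finset.sum_congr rfl fun s _ => by ring

/-- `Δ` contracted with the Euler vector field: `E^s Δ_s = g₁ R`. -/
lemma sum_smul_deltaMat₁ :
    ∑ s, vecComp φ (gradient g₁ τ) s x • deltaMat φ g₁ g₂ Γ₁ Γ₂ s x
      = coComp φ g₁ x * opMat φ g₁ g₂ Γ₁ Γ₂ τ x := by
  ext i j
  simp only [Matrix.sum_apply, Matrix.smul_apply, smul_eq_mul, Matrix.mul_apply, deltaMat, opMat,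
    Matrix.of_apply, vecComp_gradient h (hq.smAt x) hp.metric₁, Finset.mul_sum, Finset.sum_mul]
  calc ∑ s, ∑ m, coComp φ g₁ x s m * pd φ m τ x * delta φ g₁ g₂ Γ₁ Γ₂ s i j x
      = ∑ m, pd φ m τ x * ∑ s, coComp φ g₁ x m s * delta φ g₁ g₂ Γ₁ Γ₂ s i j x := by
        simp only [Finset.mul_sum]
        rw [Finset.sum_comm]
        refine Finset.sum_congr rfl fun m _ => Finset.sum_congr rfl fun s _ => ?_
        rw [(hp.metric₁.coComp_isSymm x).apply m s]
        ring
    _ = ∑ m, pd φ m τ x * ∑ s, coComp φ g₁ x i s * delta φ g₁ g₂ Γ₁ Γ₂ s m j x := by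
        simp only [hp.delta_torsion₁ h hx _ i j]
    _ = _ := by
        simp only [Finset.mul_sum]
        rw [Finset.sum_comm]
        exact Finset.sum_congr rfl fun m _ => Finset.sum_congr rfl fun s _ => by ring

omit hp hx in
/-- The covariant derivative of the gradient of `τ` for a metric `g`. -/
lemma nvec_gradient {g : CoForm 𝕜 n M} (hg : IsContraMetric r g) (hg₂ : IsContraMetric r g₂) :
    nvec φ g₂ (gradient g τ) x
      = (Matrix.of fun k j => ∑ m, covUU φ g₂ k (coComp φ g) x j m * pd φ m τ x)
        + (Matrix.of fun k m => pd φ k (pd φ m τ) x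
            - ∑ s, christoffel φ (coInv φ g₂) k m s x * pd φ s τ x) * coComp φ g x := by
  have hτ := hq.smAt x
  have hG := hg.smMatAt h
  rw [nvec_eq]
  ext k j
  have h1 : pd φ k (vecComp φ (gradient g τ) j) x
      = ∑ m, (pd φ k (fun y => coComp φ g y j m) x * pd φ m τ x
        + coComp φ g x j m * pd φ k (pd φ m τ) x) := by
    rw [pd_congr h.mem (g := fun y => ∑ s, coComp φ g y j s * pd φ s τ y)
      (by filter_upwards [h.eventually] with y hy using vecComp_gradient hy (hq.smAt y) hg j),
      pd_sum h fun s _ => (hG j s).mul (hτ.pd h s)]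
    exact Finset.sum_congr rfl fun s _ => pd_mul h (hG j s) (hτ.pd h s) k
  simp only [Matrix.add_apply, Matrix.sum_apply, Matrix.smul_apply, smul_eq_mul, Matrix.mul_apply,
    dvec, Matrix.of_apply, h1, covUU, covD, Matrix.transpose_apply, neg_mul,
    sub_neg_eq_add, pdM, chrMat, vecComp_gradient h hτ hg, Finset.sum_add_distrib, add_mul, sub_mul,
    Finset.sum_sub_distrib]
  have e1 : ∑ l, (∑ s, coComp φ g x l s * pd φ s τ x) * christoffel φ (coInv φ g₂) k l j x
      = ∑ m, (∑ l, christoffel φ (coInv φ g₂) l k j x * coComp φ g x l m) * pd φ m τ x := by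
    simp only [Finset.sum_mul]
    rw [Finset.sum_comm]
    refine Finset.sum_congr rfl fun m _ => Finset.sum_congr rfl fun l _ => ?_
    rw [christoffel_symm hg₂.coInv_isSymm k l j]
    ring
  have e2 : ∑ m, (∑ l, coComp φ g x j l * christoffel φ (coInv φ g₂) l k m x) * pd φ m τ x
      = ∑ m, (∑ s, christoffel φ (coInv φ g₂) k m s x * pd φ s τ x) * coComp φ g x m j := by
    simp only [Finset.sum_mul]
    rw [Finset.sum_comm]
    refine Finset.sum_congr rfl fun m _ => Finset.sum_congr rfl fun l _ => ?_
    rw [christoffel_symm hg₂.coInv_isSymm k m l, (hg.coComp_isSymm x).apply m j]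
    ring
  have e3 : ∑ m, coComp φ g x j m * pd φ k (pd φ m τ) x
      = ∑ m, pd φ k (pd φ m τ) x * coComp φ g x m j := by
    refine Finset.sum_congr rfl fun m _ => ?_
    rw [(hg.coComp_isSymm x).apply m j, mul_comm]
  rw [e1, e2, e3]
  ring

/-- The differential of `τ` is covariantly constant, since its gradient `e` is a Killing field. -/
lemma hessian_tau (k m : Fin n) :
    pd φ k (pd φ m τ) x - ∑ s, christoffel φ (coInv φ g₂) k m s x * pd φ s τ x = 0 := by
  have h1 := lieCo_eq (φ := φ) (x := x) g₂ g₂ (gradient g₂ τ)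
  rw [nvec_gradient hq h hp.metric₂ hp.metric₂] at h1
  set H : Matrix (Fin n) (Fin n) 𝕜 := Matrix.of fun k m => pd φ k (pd φ m τ) x
    - ∑ s, christoffel φ (coInv φ g₂) k m s x * pd φ s τ x with hH
  have hHs : H.transpose = H := by
    ext k m
    simp only [hH, Matrix.transpose_apply, Matrix.of_apply, pd_comm h (hq.smAt x) k m,
      christoffel_symm hp.metric₂.coInv_isSymm k m]
  have hs : (coComp φ g₂ x).transpose = coComp φ g₂ x := hp.metric₂.coComp_isSymm x
  have h0 := covUU_self hp.metric₂ hp.leviCivita₂ h hx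
  have h2 : (Matrix.of fun i j => lieCo φ (gradient g₂ τ) g₂ i j x) = 0 := by
    ext i j
    have := hq.lie_e₂ φ h.patch x h.mem i j
    simpa [coComp] using this
  have h3 : (Matrix.of fun k j => ∑ m, covUU φ g₂ k (coComp φ g₂) x j m * pd φ m τ x)
      = (0 : Matrix (Fin n) (Fin n) 𝕜) := by
    ext k j
    simp [h0]
  have h4 : ∑ s, vecComp φ (gradient g₂ τ) s x • covUU φ g₂ s (coComp φ g₂) x = 0 := by
    simp [h0]
  rw [h2, h3, h4, zero_add, Matrix.transpose_mul, hs, hHs] at h1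
  have h5 : coComp φ g₂ x * H * coComp φ g₂ x = 0 := by
    have h6 : (2 : 𝕜) • (coComp φ g₂ x * H * coComp φ g₂ x) = 0 := by
      rw [two_smul]
      rw [eq_comm, zero_sub, sub_eq_zero, neg_eq_iff_add_eq_zero, ← Matrix.mul_assoc] at h1
      exact h1
    exact (smul_eq_zero.1 h6).resolve_left two_ne_zero
  have h7 : H = 0 := by
    calc H = (coInv φ g₂ x * coComp φ g₂ x) * H * (coComp φ g₂ x * coInv φ g₂ x) := by
          rw [coInv_mul_coComp h hx, coComp_mul_coInv h hx, Matrix.one_mul, Matrix.mul_one]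
      _ = coInv φ g₂ x * (coComp φ g₂ x * H * coComp φ g₂ x) * coInv φ g₂ x := by noncomm_ring
      _ = 0 := by rw [h5, Matrix.mul_zero, Matrix.zero_mul]
  exact congrFun (congrFun h7 k) m

lemma nvec_gradient₂ : nvec φ g₂ (gradient g₂ τ) x = 0 := by
  rw [nvec_gradient hq h hp.metric₂ hp.metric₂]
  have h0 := covUU_self hp.metric₂ hp.leviCivita₂ h hx
  have h3 : (Matrix.of fun k j => ∑ m, covUU φ g₂ k (coComp φ g₂) x j m * pd φ m τ x)
      = (0 : Matrix (Fin n) (Fin n) 𝕜) := by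
    ext k j
    simp [h0]
  have h4 : (Matrix.of fun k m => pd φ k (pd φ m τ) x
      - ∑ s, christoffel φ (coInv φ g₂) k m s x * pd φ s τ x) = 0 := by
    ext k m
    exact hessian_tau hp hq h hx k m
  rw [h3, h4, Matrix.zero_mul, add_zero]

lemma nvec_gradient₁ : nvec φ g₂ (gradient g₁ τ) x
    = opMat φ g₁ g₂ Γ₁ Γ₂ τ x + opMat' φ g₁ g₂ Γ₁ Γ₂ τ x := by
  rw [nvec_gradient hq h hp.metric₁ hp.metric₂]
  have h4 : (Matrix.of fun k m => pd φ k (pd φ m τ) x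
      - ∑ s, christoffel φ (coInv φ g₂) k m s x * pd φ s τ x) = 0 := by
    ext k m
    exact hessian_tau hp hq h hx k m
  rw [h4, Matrix.zero_mul, add_zero]
  ext k j
  simp only [covUU_coComp₁ hp h hx, Matrix.of_apply, Matrix.add_apply, Matrix.transpose_apply,
    deltaMat, opMat, opMat', add_mul, Finset.sum_add_distrib]
  ring

/-- The torsion identity of `g₁` contracted with `dτ`. -/
lemma coComp_mul_opMat'_symm : (coComp φ g₁ x * opMat' φ g₁ g₂ Γ₁ Γ₂ τ x).transpose
    = coComp φ g₁ x * opMat' φ g₁ g₂ Γ₁ Γ₂ τ x := by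
  ext i j
  simp only [Matrix.transpose_apply, Matrix.mul_apply, opMat', Matrix.of_apply, Finset.mul_sum]
  rw [Finset.sum_comm]
  conv_rhs => rw [Finset.sum_comm]
  refine Finset.sum_congr rfl fun m _ => ?_
  simp only [← mul_assoc, ← Finset.sum_mul]
  rw [hp.delta_torsion₁ h hx j i m]

/-- The operator `Δ(·, dτ)` is scalar, where `g₁` is invertible: in `L_E g₁ = (d-1) g₁` the terms with
`Δ(dτ, ·)` cancel. -/
lemma opMat'_eq_of_mem (hx1 : x ∈ invLocus g₁) :
    opMat' φ g₁ g₂ Γ₁ Γ₂ τ x = ((1 - d) / 2) • (1 : Matrix (Fin n) (Fin n) 𝕜) := by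
  have h1 := lieCo_eq (φ := φ) (x := x) g₁ g₂ (gradient g₁ τ)
  have hs : (coComp φ g₁ x).transpose = coComp φ g₁ x := hp.metric₁.coComp_isSymm x
  have h2 : (Matrix.of fun i j => lieCo φ (gradient g₁ τ) g₁ i j x) = (d - 1) • coComp φ g₁ x := by
    ext i j
    have := hq.lie_E φ h.patch x h.mem i j
    simpa [coComp] using this
  have h3 : ∑ s, vecComp φ (gradient g₁ τ) s x • covUU φ g₂ s (coComp φ g₁) x
      = coComp φ g₁ x * opMat φ g₁ g₂ Γ₁ Γ₂ τ x
        + (coComp φ g₁ x * opMat φ g₁ g₂ Γ₁ Γ₂ τ x).transpose := by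
    rw [← sum_smul_deltaMat₁ hp hq h hx, Matrix.transpose_sum, ← Finset.sum_add_distrib]
    simp only [covUU_coComp₁ hp h hx, smul_add, Matrix.transpose_smul]
  have h4 := coComp_mul_opMat'_symm hp hq h hx
  rw [h2, h3, nvec_gradient₁ hp hq h hx] at h1
  rw [Matrix.transpose_mul, hs] at h1 h4
  rw [Matrix.transpose_add, mul_add, add_mul, h4] at h1
  have h5 : (2 : 𝕜) • (coComp φ g₁ x * opMat' φ g₁ g₂ Γ₁ Γ₂ τ x) = (1 - d) • coComp φ g₁ x := by
    rw [show (1 - d) = -(d - 1) by ring, neg_smul, h1, two_smul]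
    abel
  calc opMat' φ g₁ g₂ Γ₁ Γ₂ τ x
      = (1 / 2 : 𝕜) • (coInv φ g₁ x * ((2 : 𝕜) • (coComp φ g₁ x * opMat' φ g₁ g₂ Γ₁ Γ₂ τ x))) := by
        rw [Matrix.mul_smul, smul_smul, ← Matrix.mul_assoc, coInv_mul_coComp h hx1, Matrix.one_mul]
        norm_num
    _ = _ := by
        rw [h5, Matrix.mul_smul, coInv_mul_coComp h hx1, smul_smul]
        congr 1
        ring

/-- The operator `Δ(·, dτ)` is scalar. -/
lemma opMat'_eq :
    opMat' φ g₁ g₂ Γ₁ Γ₂ τ x = ((1 - d) / 2) • (1 : Matrix (Fin n) (Fin n) 𝕜) := by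
  ext k j
  have hsm : SmAt n r (fun y => opMat' φ g₁ g₂ Γ₁ Γ₂ τ y k j) x :=
    show SmAt n r (fun y => ∑ m, delta φ g₁ g₂ Γ₁ Γ₂ k j m y * pd φ m τ y) x from
      SmAt.sum fun m _ => (hp.smAt_delta h hx k j m).mul ((hq.smAt x).pd h m)
  refine eq_of_eventually_eq_invLocus (f₁ := fun y => opMat' φ g₁ g₂ Γ₁ Γ₂ τ y k j)
    (f₂ := fun _ => (((1 - d) / 2) • (1 : Matrix (Fin n) (Fin n) 𝕜)) k j)
    hp.metric₁ hsm.continuousAt continuousAt_const ?_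
  filter_upwards [eventually_patch_invLocus h hp.metric₂ hx] with y hy hy1
  rw [opMat'_eq_of_mem hp hq hy.1 hy.2 hy1]

/-- The tensor `R` is the operator `Δ(dτ, ·)`. -/
lemma regTensor_eq : regTensor φ g₁ g₂ τ d x = opMat φ g₁ g₂ Γ₁ Γ₂ τ x := by
  have h1 : regTensor φ g₁ g₂ τ d x = ((d - 1) / 2) • (1 : Matrix (Fin n) (Fin n) 𝕜)
      + nvec φ g₂ (gradient g₁ τ) x := rfl
  rw [h1, nvec_gradient₁ hp hq h hx, opMat'_eq hp hq h hx, add_comm, add_assoc, ← add_smul]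
  rw [show (1 - d) / 2 + (d - 1) / 2 = 0 by ring, zero_smul, add_zero]

lemma nvec_euler : nvec φ g₂ (gradient g₁ τ) x
    = opMat φ g₁ g₂ Γ₁ Γ₂ τ x + ((1 - d) / 2) • (1 : Matrix (Fin n) (Fin n) 𝕜) := by
  rw [nvec_gradient₁ hp hq h hx, opMat'_eq hp hq h hx]

/-- `g₂ R + (g₂ R)ᵀ = g₂`, which is the equation `L_e g₁ = g₂`. -/
lemma coComp₂_mul_opMat : coComp φ g₂ x * opMat φ g₁ g₂ Γ₁ Γ₂ τ x
    + (coComp φ g₂ x * opMat φ g₁ g₂ Γ₁ Γ₂ τ x).transpose = coComp φ g₂ x := by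
  have h1 := lieCo_eq (φ := φ) (x := x) g₁ g₂ (gradient g₂ τ)
  have h2 : (Matrix.of fun i j => lieCo φ (gradient g₂ τ) g₁ i j x) = coComp φ g₂ x := by
    ext i j
    exact hq.lie_e₁ φ h.patch x h.mem i j
  rw [h2, nvec_gradient₂ hp hq h hx, Matrix.mul_zero, Matrix.transpose_zero, Matrix.zero_mul,
    sub_zero, sub_zero] at h1
  rw [← sum_smul_deltaMat₂ hp hq h hx, Matrix.transpose_sum, ← Finset.sum_add_distrib]
  refine Eq.trans ?_ h1.symm
  simp only [covUU_coComp₁ hp h hx, smul_add, Matrix.transpose_smul]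

lemma sum_smul_covUU₂ : ∑ s, vecComp φ (gradient g₂ τ) s x • covUU φ g₂ s (coComp φ g₁) x
    = coComp φ g₂ x := by
  rw [← coComp₂_mul_opMat hp hq h hx, ← sum_smul_deltaMat₂ hp hq h hx, Matrix.transpose_sum,
    ← Finset.sum_add_distrib]
  simp only [covUU_coComp₁ hp h hx, smul_add, Matrix.transpose_smul]

/-- The identity `Δ(R u, v) = Δ(R v, u)`, which makes the multiplication of 1-forms commutative. -/
lemma opMat_transpose_mul_deltaMat (j : Fin n) :
    (opMat φ g₁ g₂ Γ₁ Γ₂ τ x).transpose * deltaMat φ g₁ g₂ Γ₁ Γ₂ j x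
      = (deltaMat φ g₁ g₂ Γ₁ Γ₂ j x).transpose * opMat φ g₁ g₂ Γ₁ Γ₂ τ x := by
  ext k i
  simp only [Matrix.mul_apply, Matrix.transpose_apply, opMat, deltaMat, Matrix.of_apply,
    Finset.mul_sum, Finset.sum_mul]
  rw [Finset.sum_comm]
  conv_rhs => rw [Finset.sum_comm]
  refine Finset.sum_congr rfl fun m _ => ?_
  have := (hp.curvature_coeffs h hx).2.2 m i j k
  calc ∑ s, delta φ g₁ g₂ Γ₁ Γ₂ s m k x * pd φ m τ x * delta φ g₁ g₂ Γ₁ Γ₂ j s i x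
      = pd φ m τ x * ∑ s, delta φ g₁ g₂ Γ₁ Γ₂ s m k x * delta φ g₁ g₂ Γ₁ Γ₂ j s i x := by
        rw [Finset.mul_sum]
        exact Finset.sum_congr rfl fun s _ => by ring
    _ = _ := by
        rw [this, Finset.mul_sum]
        exact Finset.sum_congr rfl fun s _ => by ring

end core

end

section

variable {φ ψ : OpenPartialHomeomorph M (Fin n → 𝕜)} {x : M}

/-! ### Parallelism of `R` and scaling by the Euler vector field -/

/-- The derivative `X^s ∂_s A` of a matrix-valued function along a vector field. -/
def dirM (φ : OpenPartialHomeomorph M (Fin n → 𝕜)) (X : ∀ x : M, Tan 𝕜 n x)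
    (A : M → Matrix (Fin n) (Fin n) 𝕜) (x : M) : Matrix (Fin n) (Fin n) 𝕜 :=
  ∑ s, vecComp φ X s x • pdM φ s A x

/-- The matrix `X^s Γ_{sk}^j` with rows `k` and columns `j`. -/
def dirChr (φ : OpenPartialHomeomorph M (Fin n → 𝕜)) (g : CoForm 𝕜 n M) (X : ∀ x : M, Tan 𝕜 n x)
    (x : M) : Matrix (Fin n) (Fin n) 𝕜 :=
  ∑ s, vecComp φ X s x • chrMat φ (coInv φ g) s x

/-- The components `c_{ijk}` of the multiplication of the tangent vectors, as matrices with rows `i`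
and columns `j`. -/
def cubic (φ : OpenPartialHomeomorph M (Fin n → 𝕜)) (g₁ g₂ : CoForm 𝕜 n M) (Γ₁ Γ₂ : Coeffs 𝕜 n M)
    (τ : M → 𝕜) (k : Fin n) (x : M) : Matrix (Fin n) (Fin n) 𝕜 :=
  coInv φ g₂ x * deltaMat φ g₁ g₂ Γ₁ Γ₂ k x * (opMat φ g₁ g₂ Γ₁ Γ₂ τ x)⁻¹ * coInv φ g₂ x

variable [IsManifold 𝓘(𝕜, Fin n → 𝕜) r M]

lemma dirM_mul (h : PatchAt r φ x) {A B : M → Matrix (Fin n) (Fin n) 𝕜} (hA : SmMatAt r A x)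
    (hB : SmMatAt r B x) (X : ∀ x : M, Tan 𝕜 n x) :
    dirM φ X (fun y => A y * B y) x = dirM φ X A x * B x + A x * dirM φ X B x := by
  simp only [dirM, pdM_mul h hA hB, smul_add, Finset.sum_add_distrib, Finset.sum_mul,
    Finset.mul_sum, Matrix.smul_mul, Matrix.mul_smul]

lemma dirM_inv (h : PatchAt r φ x) {A : M → Matrix (Fin n) (Fin n) 𝕜} (hA : SmMatAt r A x)
    (h0 : (A x).det ≠ 0) (X : ∀ x : M, Tan 𝕜 n x) :
    dirM φ X (fun y => (A y)⁻¹) x = - ((A x)⁻¹ * dirM φ X A x * (A x)⁻¹) := by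
  simp only [dirM, pdM_inv h hA h0, Finset.sum_mul,
    Finset.mul_sum, Matrix.smul_mul, Matrix.mul_smul, smul_neg, Finset.sum_neg_distrib]

lemma sum_smul_covUU (g : CoForm 𝕜 n M) (X : ∀ x : M, Tan 𝕜 n x)
    (A : M → Matrix (Fin n) (Fin n) 𝕜) :
    ∑ s, vecComp φ X s x • covUU φ g s A x
      = dirM φ X A x + (dirChr φ g X x).transpose * A x + A x * dirChr φ g X x := by
  simp only [covUU, covD, dirM, dirChr, smul_add, Finset.sum_add_distrib, Finset.sum_mul,
    Finset.mul_sum, Matrix.transpose_sum, Matrix.transpose_smul, Matrix.smul_mul, Matrix.mul_smul,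
    neg_mul, sub_neg_eq_add]

lemma sum_smul_covLU (g : CoForm 𝕜 n M) (X : ∀ x : M, Tan 𝕜 n x)
    (A : M → Matrix (Fin n) (Fin n) 𝕜) :
    ∑ s, vecComp φ X s x • covLU φ g s A x
      = dirM φ X A x - dirChr φ g X x * A x + A x * dirChr φ g X x := by
  simp only [covLU, covD, dirM, dirChr, smul_add, smul_sub, Finset.sum_add_distrib,
    Finset.sum_sub_distrib, Finset.sum_mul, Finset.mul_sum,
    Matrix.smul_mul, Matrix.mul_smul]

lemma smMatAt_chrMat {g : CoForm 𝕜 n M} (hg : IsContraMetric r g) (h : PatchAt r φ x)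
    (hx : x ∈ invLocus g) (k : Fin n) : SmMatAt r (chrMat φ (coInv φ g) k) x :=
  fun s j => smAt_christoffel h (hg.smMatAt_coInv h hx) (det_coInv_ne_zero h hx) s k j

lemma smMatAt_pdM (h : PatchAt r φ x) {A : M → Matrix (Fin n) (Fin n) 𝕜} (hA : SmMatAt r A x)
    (k : Fin n) : SmMatAt r (pdM φ k A) x := fun i j => (hA i j).pd h k

section core

variable {g₁ g₂ : CoForm 𝕜 n M} {Γ₁ Γ₂ : Coeffs 𝕜 n M} {τ : M → 𝕜} {d : 𝕜}
variable (hp : IsFlatPencil r g₁ g₂ Γ₁ Γ₂) (hq : IsQuasihomogeneous r g₁ g₂ τ d)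
variable (h : PatchAt r φ x) (hx : x ∈ invLocus g₂)

include hp hq h hx

lemma covUU_coComp₂_mul_opMat (k : Fin n) :
    covUU φ g₂ k (fun y => coComp φ g₂ y * opMat φ g₁ g₂ Γ₁ Γ₂ τ y) x
      = coComp φ g₂ x * covLU φ g₂ k (opMat φ g₁ g₂ Γ₁ Γ₂ τ) x := by
  rw [covUU_mul h (hp.metric₂.smMatAt h) (smMatAt_opMat hp hq h hx),
    covUU_self hp.metric₂ hp.leviCivita₂ h hx, Matrix.zero_mul, zero_add]

/-- The covariant derivative of `g₂ R` is antisymmetric. -/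
lemma coComp₂_mul_covLU_antisymm (k : Fin n) :
    (coComp φ g₂ x * covLU φ g₂ k (opMat φ g₁ g₂ Γ₁ Γ₂ τ) x).transpose
      = - (coComp φ g₂ x * covLU φ g₂ k (opMat φ g₁ g₂ Γ₁ Γ₂ τ) x) := by
  have hA : SmMatAt r (fun y => coComp φ g₂ y * opMat φ g₁ g₂ Γ₁ Γ₂ τ y) x :=
    (hp.metric₂.smMatAt h).mul (smMatAt_opMat hp hq h hx)
  have h1 : covUU φ g₂ k (fun y => coComp φ g₂ y * opMat φ g₁ g₂ Γ₁ Γ₂ τ y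
      + (coComp φ g₂ y * opMat φ g₁ g₂ Γ₁ Γ₂ τ y).transpose) x = 0 := by
    rw [covUU_congr h.mem (B := coComp φ g₂), covUU_self hp.metric₂ hp.leviCivita₂ h hx]
    filter_upwards [eventually_patch_invLocus h hp.metric₂ hx] with y hy
      using coComp₂_mul_opMat hp hq hy.1 hy.2
  rw [covUU_add h hA hA.transpose, covUU_transpose,
    covUU_coComp₂_mul_opMat hp hq h hx] at h1
  exact eq_neg_of_add_eq_zero_right h1

/-- By the Codazzi equation, `g₂ ∇_s R` is the covariant derivative of `Δ_s` along the unity. The last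
sum is the correction for the lower index of `Δ_s`, which `covUU` ignores. -/
lemma coComp₂_mul_covLU_eq (s : Fin n) :
    coComp φ g₂ x * covLU φ g₂ s (opMat φ g₁ g₂ Γ₁ Γ₂ τ) x
      = ∑ l, vecComp φ (gradient g₂ τ) l x • (covUU φ g₂ l (deltaMat φ g₁ g₂ Γ₁ Γ₂ s) x
        - ∑ m, chrMat φ (coInv φ g₂) l x s m • deltaMat φ g₁ g₂ Γ₁ Γ₂ m x) := by
  have hd : ∀ l, pd φ s (vecComp φ (gradient g₂ τ) l) x
      = - ∑ m, vecComp φ (gradient g₂ τ) m x * chrMat φ (coInv φ g₂) m x s l := by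
    intro l
    have h1 := nvec_gradient₂ hp hq h hx
    rw [nvec_eq] at h1
    have h2 := congrFun (congrFun h1 s) l
    simp only [Matrix.add_apply, Matrix.sum_apply, Matrix.smul_apply, smul_eq_mul, dvec,
      Matrix.of_apply, Matrix.zero_apply] at h2
    exact eq_neg_of_add_eq_zero_left h2
  rw [← covUU_coComp₂_mul_opMat hp hq h hx, covUU_congr h.mem (B := fun y =>
    ∑ l, vecComp φ (gradient g₂ τ) l y • deltaMat φ g₁ g₂ Γ₁ Γ₂ l y),
    covUU_sum_smul h (fun l => smAt_gradient₂ hp hq h l) (fun l => smMatAt_deltaMat hp h hx l)]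
  · simp only [hd, covUU_deltaMat_comm hp h hx s, smul_sub, Finset.sum_sub_distrib, neg_smul,
      Finset.sum_neg_distrib, Finset.sum_smul, Finset.smul_sum, smul_smul]
    rw [Finset.sum_comm]
    abel
  · filter_upwards [eventually_patch_invLocus h hp.metric₂ hx] with y hy
      using (sum_smul_deltaMat₂ hp hq hy.1 hy.2).symm

/-- The tensor `g₁^{is} g₂^{jm} ∇_s R_m^k` is symmetric in `i` and `j`: this is the derivative of the
torsion identity of `g₁` along the unity vector field. -/
lemma coComp₁_mul_covLU_symm (i j k : Fin n) :
    ∑ s, coComp φ g₁ x i s * (coComp φ g₂ x * covLU φ g₂ s (opMat φ g₁ g₂ Γ₁ Γ₂ τ) x) j k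
      = ∑ s, coComp φ g₁ x j s * (coComp φ g₂ x * covLU φ g₂ s (opMat φ g₁ g₂ Γ₁ Γ₂ τ) x) i k := by
  set W : Fin n → M → Matrix (Fin n) (Fin n) 𝕜 := fun k y =>
    Matrix.of fun s j => delta φ g₁ g₂ Γ₁ Γ₂ s j k y with hW
  have hWs : ∀ k, SmMatAt r (W k) x := fun k s j => hp.smAt_delta h hx s j k
  have hgW : ∀ k, (coComp φ g₁ x * W k x).transpose = coComp φ g₁ x * W k x := by
    intro k
    ext i j
    simpa [Matrix.mul_apply, hW] using hp.delta_torsion₁ h hx j i k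
  have hηW : ∀ k, (coComp φ g₂ x * W k x).transpose = coComp φ g₂ x * W k x := by
    intro k
    ext i j
    simpa [Matrix.mul_apply, hW] using hp.delta_torsion₂ h hx j i k
  have hD : ∀ l, (covUU φ g₂ l (fun y => coComp φ g₁ y * W k y) x).transpose
      = covUU φ g₂ l (fun y => coComp φ g₁ y * W k y) x := by
    intro l
    rw [← covUU_transpose]
    refine covUU_congr h.mem ?_ _ _
    filter_upwards [eventually_patch_invLocus h hp.metric₂ hx] with y hy
    ext i j
    simpa [Matrix.mul_apply, hW] using hp.delta_torsion₁ hy.1 hy.2 j i k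
  have hX : ∀ l s j, (covUU φ g₂ l (deltaMat φ g₁ g₂ Γ₁ Γ₂ s) x
        - ∑ m, chrMat φ (coInv φ g₂) l x s m • deltaMat φ g₁ g₂ Γ₁ Γ₂ m x) j k
      = (covLU φ g₂ l (W k) x + ∑ m, chrMat φ (coInv φ g₂) l x m k • W m x) s j := by
    intro l s j
    simp only [covUU, covLU, covD, Matrix.add_apply, Matrix.sub_apply, Matrix.sum_apply,
      Matrix.smul_apply, smul_eq_mul, Matrix.mul_apply, pdM, Matrix.of_apply, deltaMat, hW, neg_mul,
      Matrix.transpose_apply, sub_neg_eq_add]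
    simp only [mul_comm (delta _ _ _ _ _ _ _ _ _)]
    ring
  have hsum : ∑ l, vecComp φ (gradient g₂ τ) l x • (coComp φ g₁ x
      * (covLU φ g₂ l (W k) x + ∑ m, chrMat φ (coInv φ g₂) l x m k • W m x))
      = ∑ l, vecComp φ (gradient g₂ τ) l x • (covUU φ g₂ l (fun y => coComp φ g₁ y * W k y) x
        + ∑ m, chrMat φ (coInv φ g₂) l x m k • (coComp φ g₁ x * W m x))
        - coComp φ g₂ x * W k x := by
    conv_rhs => rw [← sum_smul_covUU₂ hp hq h hx]
    simp only [covUU_mul h (hp.metric₁.smMatAt h) (hWs k), smul_add, Finset.sum_add_distrib,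
      mul_add, Finset.mul_sum, Finset.sum_mul, Matrix.smul_mul, Matrix.mul_smul]
    abel
  have hT : ∀ i j, ∑ s, coComp φ g₁ x i s
        * (coComp φ g₂ x * covLU φ g₂ s (opMat φ g₁ g₂ Γ₁ Γ₂ τ) x) j k
      = (∑ l, vecComp φ (gradient g₂ τ) l x • (coComp φ g₁ x
      * (covLU φ g₂ l (W k) x + ∑ m, chrMat φ (coInv φ g₂) l x m k • W m x))) i j := by
    intro i j
    simp only [coComp₂_mul_covLU_eq hp hq h hx]
    simp only [Matrix.sum_apply _ _ (Finset.univ : Finset (Fin n))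
      (fun l => vecComp φ (gradient g₂ τ) l x • _), Matrix.smul_apply _ (_ - _), hX,
      Matrix.smul_apply _ (_ * _), Matrix.mul_apply, smul_eq_mul, Finset.mul_sum]
    rw [Finset.sum_comm]
    exact Finset.sum_congr rfl fun l _ => Finset.sum_congr rfl fun s _ => by ring
  have hsym : (∑ l, vecComp φ (gradient g₂ τ) l x • (coComp φ g₁ x
      * (covLU φ g₂ l (W k) x + ∑ m, chrMat φ (coInv φ g₂) l x m k • W m x))).transpose
      = ∑ l, vecComp φ (gradient g₂ τ) l x • (coComp φ g₁ x
      * (covLU φ g₂ l (W k) x + ∑ m, chrMat φ (coInv φ g₂) l x m k • W m x)) := by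
    rw [hsum]
    simp only [Matrix.transpose_sub, Matrix.transpose_sum, Matrix.transpose_smul,
      Matrix.transpose_add, hD, hgW, hηW]
  rw [hT, hT]
  exact (congrFun (congrFun hsym j) i)

/-- The tensor `R` is covariantly constant: with the upper indices raised by `g₁` and `g₂`, its
derivative is symmetric in the first two and antisymmetric in the last two indices, hence zero where
`g₁` is invertible. -/
lemma covLU_opMat (k : Fin n) : covLU φ g₂ k (opMat φ g₁ g₂ Γ₁ Γ₂ τ) x = 0 := by
  have key : ∀ y, PatchAt r φ y → y ∈ invLocus g₂ → y ∈ invLocus g₁ →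
      covLU φ g₂ k (opMat φ g₁ g₂ Γ₁ Γ₂ τ) y = 0 := by
    intro y hφ hy hy1
    have h0 : coComp φ g₂ y * covLU φ g₂ k (opMat φ g₁ g₂ Γ₁ Γ₂ τ) y = 0 := by
      ext j m
      refine eq_zero_of_coComp_mul (g₂ := g₁) hφ hy1 (v := fun s => (coComp φ g₂ y
        * covLU φ g₂ s (opMat φ g₁ g₂ Γ₁ Γ₂ τ) y) j m) (fun i => ?_) k
      refine eq_zero_of_symm_of_antisymm (T := fun i j m => ∑ s, coComp φ g₁ y i s *
        (coComp φ g₂ y * covLU φ g₂ s (opMat φ g₁ g₂ Γ₁ Γ₂ τ) y) j m)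
        (coComp₁_mul_covLU_symm hp hq hφ hy) (fun i j m => ?_) i j m
      rw [← Finset.sum_neg_distrib]
      refine Finset.sum_congr rfl fun s _ => ?_
      have := congrFun (congrFun (coComp₂_mul_covLU_antisymm hp hq hφ hy s) m) j
      rw [Matrix.transpose_apply, Matrix.neg_apply] at this
      rw [this, mul_neg]
    calc covLU φ g₂ k (opMat φ g₁ g₂ Γ₁ Γ₂ τ) y
        = coInv φ g₂ y * coComp φ g₂ y * covLU φ g₂ k (opMat φ g₁ g₂ Γ₁ Γ₂ τ) y := by
          rw [coInv_mul_coComp hφ hy, Matrix.one_mul]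
      _ = 0 := by rw [Matrix.mul_assoc, h0, Matrix.mul_zero]
  have hR := smMatAt_opMat hp hq h hx
  have hC := smMatAt_chrMat hp.metric₂ h hx k
  ext i j
  have hsm : SmAt n r (fun y => covLU φ g₂ k (opMat φ g₁ g₂ Γ₁ Γ₂ τ) y i j) x :=
    ((smMatAt_pdM h hR k i j).sub (hC.mul hR i j)).add (hR.mul hC i j)
  refine eq_of_eventually_eq_invLocus
    (f₁ := fun y => covLU φ g₂ k (opMat φ g₁ g₂ Γ₁ Γ₂ τ) y i j) (f₂ := fun _ => 0)
    hp.metric₁ hsm.continuousAt continuousAt_const ?_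
  filter_upwards [eventually_patch_invLocus h hp.metric₂ hx] with y hy hy1
  rw [key y hy.1 hy.2 hy1, Matrix.zero_apply]

/-- The Christoffel part of `∇E`. -/
lemma dirChr_euler : dirChr φ g₂ (gradient g₁ τ) x = opMat φ g₁ g₂ Γ₁ Γ₂ τ x
    + ((1 - d) / 2) • (1 : Matrix (Fin n) (Fin n) 𝕜) - dvec φ (gradient g₁ τ) x := by
  rw [← nvec_euler hp hq h hx, nvec_eq, dirChr]
  abel

/-- `L_E Δ = (d - 1) Δ`, in components. -/
lemma dirM_deltaMat (k : Fin n) : dirM φ (gradient g₁ τ) (deltaMat φ g₁ g₂ Γ₁ Γ₂ k) x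
    = (dvec φ (gradient g₁ τ) x).transpose * deltaMat φ g₁ g₂ Γ₁ Γ₂ k x
      + deltaMat φ g₁ g₂ Γ₁ Γ₂ k x * dvec φ (gradient g₁ τ) x
      - ∑ s, dvec φ (gradient g₁ τ) x k s • deltaMat φ g₁ g₂ Γ₁ Γ₂ s x
      + (d - 1) • deltaMat φ g₁ g₂ Γ₁ Γ₂ k x := by
  have h1 : covUU φ g₂ k (fun y => coComp φ g₁ y * opMat φ g₁ g₂ Γ₁ Γ₂ τ y) x
      = (deltaMat φ g₁ g₂ Γ₁ Γ₂ k x + (deltaMat φ g₁ g₂ Γ₁ Γ₂ k x).transpose)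
        * opMat φ g₁ g₂ Γ₁ Γ₂ τ x := by
    rw [covUU_mul h (hp.metric₁.smMatAt h) (smMatAt_opMat hp hq h hx), covLU_opMat hp hq h hx,
      covUU_coComp₁ hp h hx, Matrix.mul_zero, add_zero]
  rw [covUU_congr h.mem (B := fun y =>
    ∑ l, vecComp φ (gradient g₁ τ) l y • deltaMat φ g₁ g₂ Γ₁ Γ₂ l y)
    (by filter_upwards [eventually_patch_invLocus h hp.metric₂ hx] with y hy
          using (sum_smul_deltaMat₁ hp hq hy.1 hy.2).symm),
    covUU_sum_smul h (fun l => smAt_gradient₁ hp hq h l) (fun l => smMatAt_deltaMat hp h hx l)] at h1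
  simp only [covUU_deltaMat_comm hp h hx k] at h1
  rw [sum_smul_covUU, add_mul, ← opMat_transpose_mul_deltaMat hp hq h hx,
    dirChr_euler hp hq h hx] at h1
  have h2 : ∑ s, pd φ k (vecComp φ (gradient g₁ τ) s) x • deltaMat φ g₁ g₂ Γ₁ Γ₂ s x
    = ∑ s, dvec φ (gradient g₁ τ) x k s • deltaMat φ g₁ g₂ Γ₁ Γ₂ s x := rfl
  rw [h2] at h1
  simp only [Matrix.transpose_sub, Matrix.transpose_add, Matrix.transpose_smul,
    Matrix.transpose_one, sub_mul, mul_sub, add_mul, mul_add, Matrix.smul_mul, Matrix.mul_smul,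
    Matrix.one_mul, Matrix.mul_one] at h1
  have h3 : (d - 1) • deltaMat φ g₁ g₂ Γ₁ Γ₂ k x = - (((1 - d) / 2) • deltaMat φ g₁ g₂ Γ₁ Γ₂ k x
      + ((1 - d) / 2) • deltaMat φ g₁ g₂ Γ₁ Γ₂ k x) := by
    rw [← add_smul, ← neg_smul]
    congr 1
    ring
  rw [h3]
  generalize ((1 - d) / 2) • deltaMat φ g₁ g₂ Γ₁ Γ₂ k x = Z at *
  generalize (∑ s, dvec φ (gradient g₁ τ) x k s • deltaMat φ g₁ g₂ Γ₁ Γ₂ s x) = Y at *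
  rw [← sub_eq_zero] at h1 ⊢
  rw [← h1]
  abel

/-- `L_E R⁻¹ = 0`, in components. -/
lemma dirM_opMat_inv (hR : (opMat φ g₁ g₂ Γ₁ Γ₂ τ x).det ≠ 0) :
    dirM φ (gradient g₁ τ) (fun y => (opMat φ g₁ g₂ Γ₁ Γ₂ τ y)⁻¹) x
      = (opMat φ g₁ g₂ Γ₁ Γ₂ τ x)⁻¹ * dvec φ (gradient g₁ τ) x
        - dvec φ (gradient g₁ τ) x * (opMat φ g₁ g₂ Γ₁ Γ₂ τ x)⁻¹ := by
  have h1 := sum_smul_covLU (φ := φ) (x := x) g₂ (gradient g₁ τ) (opMat φ g₁ g₂ Γ₁ Γ₂ τ)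
  simp only [covLU_opMat hp hq h hx, smul_zero, Finset.sum_const_zero] at h1
  rw [dirChr_euler hp hq h hx] at h1
  rw [dirM_inv h (smMatAt_opMat hp hq h hx) hR]
  set R := opMat φ g₁ g₂ Γ₁ Γ₂ τ x
  set P := dvec φ (gradient g₁ τ) x
  have h2 : dirM φ (gradient g₁ τ) (opMat φ g₁ g₂ Γ₁ Γ₂ τ) x = R * P - P * R := by
    rw [← sub_eq_zero]
    simp only [sub_mul, mul_sub, add_mul, mul_add, Matrix.smul_mul, Matrix.mul_smul,
      Matrix.one_mul, Matrix.mul_one] at h1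
    rw [h1]
    abel
  rw [h2, mul_sub, sub_mul, neg_sub]
  congr 1
  · rw [← Matrix.mul_assoc, Matrix.mul_assoc _ R, Matrix.mul_nonsing_inv _ hR.isUnit, Matrix.mul_one]
  · rw [← Matrix.mul_assoc, Matrix.nonsing_inv_mul _ hR.isUnit, Matrix.one_mul]

lemma opMat_mul_coInv₂ : opMat φ g₁ g₂ Γ₁ Γ₂ τ x * coInv φ g₂ x
    + coInv φ g₂ x * (opMat φ g₁ g₂ Γ₁ Γ₂ τ x).transpose = coInv φ g₂ x := by
  have h1 := coComp₂_mul_opMat hp hq h hx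
  have hs : (coComp φ g₂ x).transpose = coComp φ g₂ x := hp.metric₂.coComp_isSymm x
  rw [Matrix.transpose_mul, hs] at h1
  have h2 := congrArg (fun A => coInv φ g₂ x * A * coInv φ g₂ x) h1
  simp only [mul_add, add_mul] at h2
  rw [← Matrix.mul_assoc, coInv_mul_coComp h hx, Matrix.one_mul, Matrix.one_mul, Matrix.mul_assoc _
    (_ * _) _, Matrix.mul_assoc _ (coComp φ g₂ x) _, coComp_mul_coInv h hx, Matrix.mul_one] at h2
  exact h2

/-- `L_E ⟨,⟩ = (2 - d) ⟨,⟩`, in components. -/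
lemma dirM_coInv₂ : dirM φ (gradient g₁ τ) (coInv φ g₂) x
    = (2 - d) • coInv φ g₂ x - dvec φ (gradient g₁ τ) x * coInv φ g₂ x
      - coInv φ g₂ x * (dvec φ (gradient g₁ τ) x).transpose := by
  have h1 := sum_smul_covUU (φ := φ) (x := x) g₂ (gradient g₁ τ) (coComp φ g₂)
  simp only [covUU_self hp.metric₂ hp.leviCivita₂ h hx, smul_zero, Finset.sum_const_zero] at h1
  have h2 : dirM φ (gradient g₁ τ) (coInv φ g₂) x
      = - (coInv φ g₂ x * dirM φ (gradient g₁ τ) (coComp φ g₂) x * coInv φ g₂ x) :=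
    dirM_inv h (hp.metric₂.smMatAt h) ((mem_invLocus_iff h g₂).1 hx) _
  have h3 : dirM φ (gradient g₁ τ) (coInv φ g₂) x
      = coInv φ g₂ x * (dirChr φ g₂ (gradient g₁ τ) x).transpose
        + dirChr φ g₂ (gradient g₁ τ) x * coInv φ g₂ x := by
    rw [h2]
    have : dirM φ (gradient g₁ τ) (coComp φ g₂) x
        = - ((dirChr φ g₂ (gradient g₁ τ) x).transpose * coComp φ g₂ x
          + coComp φ g₂ x * dirChr φ g₂ (gradient g₁ τ) x) := by
      rw [add_assoc] at h1
      exact eq_neg_of_add_eq_zero_left h1.symm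
    rw [this, Matrix.mul_neg, Matrix.neg_mul, neg_neg, mul_add, add_mul]
    congr 1
    · rw [Matrix.mul_assoc, Matrix.mul_assoc, coComp_mul_coInv h hx, Matrix.mul_one]
    · rw [← Matrix.mul_assoc, coInv_mul_coComp h hx, Matrix.one_mul]
  have h4 := opMat_mul_coInv₂ hp hq h hx
  rw [h3, dirChr_euler hp hq h hx]
  simp only [Matrix.transpose_sub, Matrix.transpose_add, Matrix.transpose_smul,
    Matrix.transpose_one, sub_mul, mul_sub, add_mul, mul_add, Matrix.smul_mul, Matrix.mul_smul,
    Matrix.one_mul, Matrix.mul_one]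
  have h5 : (2 - d) • coInv φ g₂ x = (opMat φ g₁ g₂ Γ₁ Γ₂ τ x * coInv φ g₂ x
    + coInv φ g₂ x * (opMat φ g₁ g₂ Γ₁ Γ₂ τ x).transpose) + ((1 - d) / 2) • coInv φ g₂ x
    + ((1 - d) / 2) • coInv φ g₂ x := by
    rw [h4, add_assoc, ← add_smul, show (1 - d) / 2 + (1 - d) / 2 = 1 - d by ring,
      show 2 - d = 1 + (1 - d) by ring, add_smul, one_smul]
  rw [h5]
  abel

variable (hR : (opMat φ g₁ g₂ Γ₁ Γ₂ τ x).det ≠ 0)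
include hR

lemma smMatAt_cubic (k : Fin n) : SmMatAt r (cubic φ g₁ g₂ Γ₁ Γ₂ τ k) x :=
  (((hp.metric₂.smMatAt_coInv h hx).mul (smMatAt_deltaMat hp h hx k)).mul
    ((smMatAt_opMat hp hq h hx).inv hR)).mul (hp.metric₂.smMatAt_coInv h hx)

/-- `L_E c = (3 - d) c` for the trilinear form `c`, in components. -/
lemma dirM_cubic (k : Fin n) : dirM φ (gradient g₁ τ) (cubic φ g₁ g₂ Γ₁ Γ₂ τ k) x
    = (3 - d) • cubic φ g₁ g₂ Γ₁ Γ₂ τ k x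
      - dvec φ (gradient g₁ τ) x * cubic φ g₁ g₂ Γ₁ Γ₂ τ k x
      - cubic φ g₁ g₂ Γ₁ Γ₂ τ k x * (dvec φ (gradient g₁ τ) x).transpose
      - ∑ s, dvec φ (gradient g₁ τ) x k s • cubic φ g₁ g₂ Γ₁ Γ₂ τ s x := by
  have s1 := hp.metric₂.smMatAt_coInv h hx
  have s2 := smMatAt_deltaMat hp h hx k
  have s3 := (smMatAt_opMat hp hq h hx).inv hR
  have h1 : dirM φ (gradient g₁ τ) (cubic φ g₁ g₂ Γ₁ Γ₂ τ k) x = _ :=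
    dirM_mul h ((s1.mul s2).mul s3) s1 (gradient g₁ τ)
  rw [h1, dirM_mul h (s1.mul s2) s3, dirM_mul h s1 s2, dirM_opMat_inv hp hq h hx hR,
    dirM_deltaMat hp hq h hx, dirM_coInv₂ hp hq h hx]
  simp only [cubic]
  have h2 : ∑ s, dvec φ (gradient g₁ τ) x k s • (coInv φ g₂ x * deltaMat φ g₁ g₂ Γ₁ Γ₂ s x
        * (opMat φ g₁ g₂ Γ₁ Γ₂ τ x)⁻¹ * coInv φ g₂ x)
      = coInv φ g₂ x * (∑ s, dvec φ (gradient g₁ τ) x k s • deltaMat φ g₁ g₂ Γ₁ Γ₂ s x)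
        * (opMat φ g₁ g₂ Γ₁ Γ₂ τ x)⁻¹ * coInv φ g₂ x := by
    simp only [Finset.mul_sum, Finset.sum_mul, Matrix.smul_mul, Matrix.mul_smul]
  rw [h2]
  generalize (∑ s, dvec φ (gradient g₁ τ) x k s • deltaMat φ g₁ g₂ Γ₁ Γ₂ s x) = Y
  have h3 : (3 - d) • (coInv φ g₂ x * deltaMat φ g₁ g₂ Γ₁ Γ₂ k x
        * (opMat φ g₁ g₂ Γ₁ Γ₂ τ x)⁻¹ * coInv φ g₂ x)
      = (2 - d) • (coInv φ g₂ x * deltaMat φ g₁ g₂ Γ₁ Γ₂ k x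
        * (opMat φ g₁ g₂ Γ₁ Γ₂ τ x)⁻¹ * coInv φ g₂ x)
      + (d - 1) • (coInv φ g₂ x * deltaMat φ g₁ g₂ Γ₁ Γ₂ k x
        * (opMat φ g₁ g₂ Γ₁ Γ₂ τ x)⁻¹ * coInv φ g₂ x)
      + (2 - d) • (coInv φ g₂ x * deltaMat φ g₁ g₂ Γ₁ Γ₂ k x
        * (opMat φ g₁ g₂ Γ₁ Γ₂ τ x)⁻¹ * coInv φ g₂ x) := by
    rw [← add_smul, ← add_smul]
    congr 1
    ring
  rw [h3]
  simp only [sub_mul, mul_sub, add_mul, mul_add, Matrix.smul_mul, Matrix.mul_smul,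
    ← Matrix.mul_assoc]
  abel

lemma deltaMat_mul_inv_symm (k : Fin n) :
    (deltaMat φ g₁ g₂ Γ₁ Γ₂ k x * (opMat φ g₁ g₂ Γ₁ Γ₂ τ x)⁻¹).transpose
      = deltaMat φ g₁ g₂ Γ₁ Γ₂ k x * (opMat φ g₁ g₂ Γ₁ Γ₂ τ x)⁻¹ := by
  have h1 := opMat_transpose_mul_deltaMat hp hq h hx k
  set R := opMat φ g₁ g₂ Γ₁ Γ₂ τ x
  set D := deltaMat φ g₁ g₂ Γ₁ Γ₂ k x
  have hRt : IsUnit R.transpose.det := by rw [Matrix.det_transpose]; exact hR.isUnit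
  calc (D * R⁻¹).transpose = (R.transpose)⁻¹ * (D.transpose * R) * R⁻¹ := by
        rw [Matrix.transpose_mul, Matrix.transpose_nonsing_inv, Matrix.mul_assoc,
          Matrix.mul_assoc D.transpose, Matrix.mul_nonsing_inv _ hR.isUnit, Matrix.mul_one]
    _ = D * R⁻¹ := by
        rw [← h1, ← Matrix.mul_assoc, Matrix.nonsing_inv_mul _ hRt, Matrix.one_mul]

lemma cubic_symm (i j k : Fin n) :
    cubic φ g₁ g₂ Γ₁ Γ₂ τ k x i j = cubic φ g₁ g₂ Γ₁ Γ₂ τ k x j i := by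
  have hs : (coInv φ g₂ x).transpose = coInv φ g₂ x := hp.metric₂.coInv_isSymm x
  have : (cubic φ g₁ g₂ Γ₁ Γ₂ τ k x).transpose = cubic φ g₁ g₂ Γ₁ Γ₂ τ k x := by
    rw [cubic, Matrix.mul_assoc (coInv φ g₂ x), Matrix.transpose_mul, Matrix.transpose_mul, hs,
      deltaMat_mul_inv_symm hp hq h hx hR]
    simp only [Matrix.mul_assoc]
  exact (congrFun (congrFun this i) j).symm

omit hq hR in
lemma coInv₂_mul_deltaMat_swap (a k m : Fin n) :
    (coInv φ g₂ x * deltaMat φ g₁ g₂ Γ₁ Γ₂ k x) a m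
      = (coInv φ g₂ x * deltaMat φ g₁ g₂ Γ₁ Γ₂ a x) k m := by
  set W : Matrix (Fin n) (Fin n) 𝕜 := Matrix.of fun s j => delta φ g₁ g₂ Γ₁ Γ₂ s j m x with hW
  have hs : (coInv φ g₂ x).transpose = coInv φ g₂ x := hp.metric₂.coInv_isSymm x
  have h1 : (coComp φ g₂ x * W).transpose = coComp φ g₂ x * W := by
    ext i j
    simpa [Matrix.mul_apply, hW] using hp.delta_torsion₂ h hx j i m
  have h2 : W * coInv φ g₂ x = coInv φ g₂ x * (coComp φ g₂ x * W) * coInv φ g₂ x := by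
    rw [← Matrix.mul_assoc, coInv_mul_coComp h hx, Matrix.one_mul]
  have h3 : (W * coInv φ g₂ x).transpose = W * coInv φ g₂ x := by
    rw [h2, Matrix.transpose_mul, Matrix.transpose_mul, hs, h1]
    simp only [Matrix.mul_assoc]
  have h4 : ∀ a k, (coInv φ g₂ x * deltaMat φ g₁ g₂ Γ₁ Γ₂ k x) a m = (W * coInv φ g₂ x) k a := by
    intro a k
    simp only [Matrix.mul_apply, deltaMat, hW, Matrix.of_apply]
    refine Finset.sum_congr rfl fun s _ => ?_
    rw [← (hp.metric₂.coInv_isSymm x).apply s a]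
    ring
  rw [h4, h4]
  exact congrFun (congrFun h3 a) k

omit hq hR in
lemma cubic_swap (i j k : Fin n) :
    cubic φ g₁ g₂ Γ₁ Γ₂ τ k x i j = cubic φ g₁ g₂ Γ₁ Γ₂ τ i x k j := by
  rw [cubic, cubic, Matrix.mul_assoc _ _ (coInv φ g₂ x), Matrix.mul_assoc _ _ (coInv φ g₂ x)]
  rw [Matrix.mul_apply, Matrix.mul_apply (M := coInv φ g₂ x * _)]
  simp only [coInv₂_mul_deltaMat_swap hp h hx i k]

/-- `∇_l c_{ijk}` is symmetric in `l` and `k`. The index `k` is not differentiated covariantly here,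
since the correction `Γ_{lk}^m c_{ijm}` is symmetric in `l` and `k`. -/
lemma covD_cubic_comm (l k : Fin n) :
    covD φ l (chrMat φ (coInv φ g₂) l x) (-(chrMat φ (coInv φ g₂) l x).transpose)
        (cubic φ g₁ g₂ Γ₁ Γ₂ τ k) x
      = covD φ k (chrMat φ (coInv φ g₂) k x) (-(chrMat φ (coInv φ g₂) k x).transpose)
        (cubic φ g₁ g₂ Γ₁ Γ₂ τ l) x := by
  have s0 := hp.metric₂.smMatAt h
  have s1 := hp.metric₂.smMatAt_coInv h hx
  have s3 := (smMatAt_opMat hp hq h hx).inv hR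
  have hh : ∀ l, covD φ l (chrMat φ (coInv φ g₂) l x) (-(chrMat φ (coInv φ g₂) l x).transpose)
      (coInv φ g₂) x = 0 := by
    intro l
    have h1 := covUU_self hp.metric₂ hp.leviCivita₂ h hx l
    have h2 : pdM φ l (coInv φ g₂) x = - (coInv φ g₂ x * pdM φ l (coComp φ g₂) x * coInv φ g₂ x) :=
      pdM_inv h s0 ((mem_invLocus_iff h g₂).1 hx) l
    have h3 : pdM φ l (coComp φ g₂) x = -((chrMat φ (coInv φ g₂) l x).transpose * coComp φ g₂ x)
        - coComp φ g₂ x * chrMat φ (coInv φ g₂) l x := by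
      rw [covUU, covD] at h1
      rw [← sub_eq_zero, ← h1]
      noncomm_ring
    rw [covD, h2, h3, mul_sub, sub_mul, Matrix.mul_neg, Matrix.neg_mul, ← Matrix.mul_assoc,
      ← Matrix.mul_assoc, coInv_mul_coComp h hx, Matrix.one_mul, Matrix.mul_assoc (_ * _),
      coComp_mul_coInv h hx, Matrix.mul_one]
    noncomm_ring
  have hS : ∀ l, covD φ l (chrMat φ (coInv φ g₂) l x) (chrMat φ (coInv φ g₂) l x)
      (fun y => (opMat φ g₁ g₂ Γ₁ Γ₂ τ y)⁻¹) x = 0 := by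
    intro l
    have h1 := covLU_opMat hp hq h hx l
    have h3 : pdM φ l (opMat φ g₁ g₂ Γ₁ Γ₂ τ) x
        = chrMat φ (coInv φ g₂) l x * opMat φ g₁ g₂ Γ₁ Γ₂ τ x
          - opMat φ g₁ g₂ Γ₁ Γ₂ τ x * chrMat φ (coInv φ g₂) l x := by
      rw [covLU, covD] at h1
      rw [← sub_eq_zero, ← h1]
      abel
    rw [covD, pdM_inv h (smMatAt_opMat hp hq h hx) hR, h3, mul_sub, sub_mul, ← Matrix.mul_assoc,
      ← Matrix.mul_assoc, Matrix.nonsing_inv_mul _ hR.isUnit, Matrix.one_mul, Matrix.mul_assoc _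
      (opMat φ g₁ g₂ Γ₁ Γ₂ τ x), Matrix.mul_nonsing_inv _ hR.isUnit, Matrix.mul_one]
    abel
  have key : ∀ l k, covD φ l (chrMat φ (coInv φ g₂) l x) (-(chrMat φ (coInv φ g₂) l x).transpose)
      (cubic φ g₁ g₂ Γ₁ Γ₂ τ k) x = coInv φ g₂ x * covUU φ g₂ l (deltaMat φ g₁ g₂ Γ₁ Γ₂ k) x
        * (opMat φ g₁ g₂ Γ₁ Γ₂ τ x)⁻¹ * coInv φ g₂ x := by
    intro l k
    have s2 := smMatAt_deltaMat hp h hx k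
    have h1 : covD φ l (chrMat φ (coInv φ g₂) l x) (-(chrMat φ (coInv φ g₂) l x).transpose)
      (cubic φ g₁ g₂ Γ₁ Γ₂ τ k) x = _ :=
      covD_mul h ((s1.mul s2).mul s3) s1 l _ (chrMat φ (coInv φ g₂) l x) _
    rw [h1, hh, Matrix.mul_zero, add_zero,
      covD_mul h (s1.mul s2) s3 l _ (chrMat φ (coInv φ g₂) l x) _, hS, Matrix.mul_zero, add_zero,
      covD_mul h s1 s2 l _ (-(chrMat φ (coInv φ g₂) l x).transpose) _, hh, Matrix.zero_mul, zero_add]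
    rfl
  rw [key, key, covUU_deltaMat_comm hp h hx]

end core

end

section

variable {φ ψ : OpenPartialHomeomorph M (Fin n → 𝕜)} {x : M}

/-! ### Change of coordinates -/

variable [IsManifold 𝓘(𝕜, Fin n → 𝕜) r M]

lemma smMatAt_jac (hφ : PatchAt r φ x) (hψ : PatchAt r ψ x) : SmMatAt r (jac φ ψ) x :=
  fun i a => smAt_jac hφ hψ i a

lemma pdM_chain (hφ : PatchAt r φ x) (hψ : PatchAt r ψ x) {A : M → Matrix (Fin n) (Fin n) 𝕜}
    (hA : SmMatAt r A x) (k : Fin n) :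
    pdM φ k A x = ∑ b, jac φ ψ x k b • pdM ψ b A x := by
  ext i j
  simp only [pdM, Matrix.of_apply, Matrix.sum_apply, Matrix.smul_apply, smul_eq_mul]
  exact pd_chain_jac hφ hψ (hA i j) k

lemma pdM_jac_symm (hφ : PatchAt r φ x) (hψ : PatchAt r ψ x) (k s a : Fin n) :
    pdM φ k (jac φ ψ) x s a = pdM φ s (jac φ ψ) x k a :=
  pd_comm hφ (smAt_coord hψ a) k s

lemma coInv_eq_jac (hφ : PatchAt r φ x) (hψ : PatchAt r ψ x) (g : CoForm 𝕜 n M) :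
    coInv φ g x = jac φ ψ x * coInv ψ g x * (jac φ ψ x).transpose := by
  have h1 : coComp φ g x = (jac ψ φ x).transpose * coComp ψ g x * jac ψ φ x :=
    coComp_eq_jac hψ hφ g
  have h2 : (jac ψ φ x)⁻¹ = jac φ ψ x := Matrix.inv_eq_right_inv (jac_mul_jac hψ hφ)
  rw [coInv, h1, Matrix.mul_inv_rev, Matrix.mul_inv_rev, ← Matrix.transpose_nonsing_inv, h2,
    ← Matrix.mul_assoc]
  rfl

lemma eq_zero_of_sum_smul {A : Matrix (Fin n) (Fin n) 𝕜} (hA : A.det ≠ 0)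
    {Z : Fin n → Matrix (Fin n) (Fin n) 𝕜} (H : ∀ i a b, ∑ k, A i k * Z k a b = 0) (k : Fin n) :
    Z k = 0 := by
  ext a b
  exact congrFun (Matrix.eq_zero_of_mulVec_eq_zero hA
    (show A.mulVec (fun k => Z k a b) = 0 from funext fun i => H i a b)) k

section metric

variable {g : CoForm 𝕜 n M} (hg : IsContraMetric r g)
include hg

/-- The transformation law of the Christoffel symbols. The difference of the two sides is symmetric in
two indices because both connections are torsion-free, and antisymmetric in two because both are
compatible with the metric. -/
lemma chrMat_mul_jac (hφ : PatchAt r φ x) (hψ : PatchAt r ψ x) (hx : x ∈ invLocus g) (k : Fin n) :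
    chrMat φ (coInv φ g) k x * jac φ ψ x
      = pdM φ k (jac φ ψ) x + ∑ b, jac φ ψ x k b • (jac φ ψ x * chrMat ψ (coInv ψ g) b x) := by
  have hP := smMatAt_jac hφ hψ
  have hhψ := hg.smMatAt_coInv hψ hx
  have hs : ∀ φ : OpenPartialHomeomorph M (Fin n → 𝕜), (coInv φ g x).transpose = coInv φ g x :=
    fun φ => hg.coInv_isSymm x
  set P := jac φ ψ x with hPdef
  set Q : Fin n → Matrix (Fin n) (Fin n) 𝕜 := fun k =>
    pdM φ k (jac φ ψ) x + ∑ b, P k b • (P * chrMat ψ (coInv ψ g) b x) with hQdef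
  set D : Fin n → Matrix (Fin n) (Fin n) 𝕜 := fun k => chrMat φ (coInv φ g) k x * P - Q k with hD
  have hDsym : ∀ k s a, D k s a = D s k a := by
    intro k s a
    simp only [hD, hQdef, Matrix.sub_apply, Matrix.add_apply, pdM_jac_symm hφ hψ k s,
      Matrix.sum_apply, Matrix.smul_apply, smul_eq_mul, Matrix.mul_apply, chrMat, Matrix.of_apply,
      Finset.mul_sum]
    simp only [christoffel_symm hg.coInv_isSymm s k]
    rw [Finset.sum_comm]
    congr 2
    refine Finset.sum_congr rfl fun c _ => Finset.sum_congr rfl fun b _ => ?_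
    rw [christoffel_symm hg.coInv_isSymm c b]
    ring
  have hcompat : ∀ k, D k * (coInv ψ g x * P.transpose)
      = - (D k * (coInv ψ g x * P.transpose)).transpose := by
    intro k
    have h1 : pdM φ k (coInv φ g) x
        = pdM φ k (fun y => jac φ ψ y * coInv ψ g y * (jac φ ψ y).transpose) x := by
      refine pdM_congr hφ.mem ?_ k
      filter_upwards [hφ.eventually, hψ.eventually] with y h1 h2 using coInv_eq_jac h1 h2 g
    rw [pdM_metric hg.coInv_isSymm (det_coInv_ne_zero hφ hx), pdM_mul hφ (hP.mul hhψ) hP.transpose,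
      pdM_mul hφ hP hhψ, pdM_transpose, pdM_chain hφ hψ hhψ] at h1
    simp only [pdM_metric hg.coInv_isSymm (det_coInv_ne_zero hψ hx)] at h1
    rw [coInv_eq_jac hφ hψ, ← hPdef] at h1
    have h2 : ∑ b, P k b • (chrMat ψ (coInv ψ g) b x * coInv ψ g x
        + (chrMat ψ (coInv ψ g) b x * coInv ψ g x).transpose)
        = (∑ b, P k b • chrMat ψ (coInv ψ g) b x) * coInv ψ g x
          + coInv ψ g x * (∑ b, P k b • chrMat ψ (coInv ψ g) b x).transpose := by
      simp only [smul_add, Finset.sum_add_distrib, Finset.sum_mul, Finset.mul_sum,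
        Matrix.transpose_sum, Matrix.transpose_smul, Matrix.smul_mul, Matrix.mul_smul,
        Matrix.transpose_mul, hs]
    have h3 : Q k = pdM φ k (jac φ ψ) x + P * ∑ b, P k b • chrMat ψ (coInv ψ g) b x := by
      simp only [hQdef, Finset.mul_sum, Matrix.mul_smul]
    rw [h2] at h1
    rw [eq_neg_iff_add_eq_zero]
    simp only [hD, h3]
    rw [← sub_eq_zero] at h1
    rw [← h1]
    simp only [Matrix.transpose_mul, Matrix.transpose_sub, Matrix.transpose_add, hs,
      Matrix.transpose_transpose]
    noncomm_ring
  have hzero : ∀ k, D k * (coInv ψ g x * P.transpose) = 0 := by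
    intro k
    ext s t
    refine eq_zero_of_symm_of_antisymm
      (T := fun k s t => (D k * (coInv ψ g x * P.transpose)) s t) (fun k s t => ?_)
      (fun k s t => ?_) k s t
    · simp only [Matrix.mul_apply, hDsym k s]
    · exact congrFun (congrFun (hcompat k) s) t
  have h0 : D k = 0 := by
    have hu : IsUnit (coInv ψ g x * P.transpose).det := by
      rw [Matrix.det_mul, Matrix.det_transpose]
      exact (mul_ne_zero (det_coInv_ne_zero hψ hx) (det_jac_ne_zero hφ hψ)).isUnit
    calc D k = D k * (coInv ψ g x * P.transpose) * (coInv ψ g x * P.transpose)⁻¹ := by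
          rw [Matrix.mul_assoc, Matrix.mul_nonsing_inv _ hu, Matrix.mul_one]
      _ = 0 := by rw [hzero, Matrix.zero_mul]
  exact sub_eq_zero.1 h0

/-- The covariant derivative of a contravariant form is a tensor. -/
lemma covUU_eq_jac (hφ : PatchAt r φ x) (hψ : PatchAt r ψ x) (hx : x ∈ invLocus g)
    {g' : CoForm 𝕜 n M} (hg' : IsContraMetric r g') (k : Fin n) :
    (jac φ ψ x).transpose * covUU φ g k (coComp φ g') x * jac φ ψ x
      = ∑ b, jac φ ψ x k b • covUU ψ g b (coComp ψ g') x := by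
  have hP := smMatAt_jac hφ hψ
  have hA := hg'.smMatAt hφ
  have h1 : pdM φ k (coComp ψ g') x
      = pdM φ k (fun y => (jac φ ψ y).transpose * coComp φ g' y * jac φ ψ y) x := by
    refine pdM_congr hφ.mem ?_ k
    filter_upwards [hφ.eventually, hψ.eventually] with y h1 h2 using coComp_eq_jac h1 h2 g'
  rw [pdM_mul hφ (hP.transpose.mul hA) hP, pdM_mul hφ hP.transpose hA, pdM_transpose] at h1
  have h2 := chrMat_mul_jac hg hφ hψ hx k
  set K := ∑ b, jac φ ψ x k b • chrMat ψ (coInv ψ g) b x with hK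
  have h3 : ∑ b, jac φ ψ x k b • (jac φ ψ x * chrMat ψ (coInv ψ g) b x) = jac φ ψ x * K := by
    simp only [hK, Finset.mul_sum, Matrix.mul_smul]
  have h4 : ∑ b, jac φ ψ x k b • covUU ψ g b (coComp ψ g') x
      = pdM φ k (coComp ψ g') x + K.transpose * coComp ψ g' x + coComp ψ g' x * K := by
    rw [pdM_chain hφ hψ (hg'.smMatAt hψ)]
    simp only [covUU, covD, hK, smul_add, Finset.sum_add_distrib,
      Finset.sum_mul, Finset.mul_sum, Matrix.transpose_sum, Matrix.transpose_smul, Matrix.smul_mul,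
      Matrix.mul_smul, neg_mul, sub_neg_eq_add]
  rw [h3] at h2
  have h5 : pdM φ k (jac φ ψ) x = chrMat φ (coInv φ g) k x * jac φ ψ x - jac φ ψ x * K := by
    rw [h2]; abel
  rw [h4, h1, coComp_eq_jac hφ hψ, h5, covUU, covD]
  simp only [Matrix.transpose_sub, Matrix.transpose_mul]
  noncomm_ring

end metric

section pencil

variable {g₁ g₂ : CoForm 𝕜 n M} {Γ₁ Γ₂ : Coeffs 𝕜 n M} {τ : M → 𝕜} {d : 𝕜}
variable (hp : IsFlatPencil r g₁ g₂ Γ₁ Γ₂) (hφ : PatchAt r φ x) (hψ : PatchAt r ψ x)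
  (hx : x ∈ invLocus g₂)
include hp hφ hψ hx

/-- The components `Δ_k^{ij}` are those of a tensor: this follows from `∇_k g₁^{ij} = Δ_k^{ij} + Δ_k^{ji}`
and the torsion identity of `g₂`, which determine `Δ`. -/
lemma deltaMat_eq_jac (k : Fin n) :
    (jac φ ψ x).transpose * deltaMat φ g₁ g₂ Γ₁ Γ₂ k x * jac φ ψ x
      = ∑ c, jac φ ψ x k c • deltaMat ψ g₁ g₂ Γ₁ Γ₂ c x := by
  set P := jac φ ψ x with hP
  set Z : Fin n → Matrix (Fin n) (Fin n) 𝕜 := fun k =>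
    P.transpose * deltaMat φ g₁ g₂ Γ₁ Γ₂ k x * P - ∑ c, P k c • deltaMat ψ g₁ g₂ Γ₁ Γ₂ c x with hZ
  have hanti : ∀ k, Z k = - (Z k).transpose := by
    intro k
    have h1 := covUU_eq_jac hp.metric₂ hφ hψ hx hp.metric₁ k
    simp only [covUU_coComp₁ hp hφ hx, covUU_coComp₁ hp hψ hx, ← hP] at h1
    rw [eq_neg_iff_add_eq_zero]
    rw [← sub_eq_zero] at h1
    rw [← h1]
    simp only [hZ, Matrix.transpose_sub, Matrix.transpose_mul, Matrix.transpose_sum,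
      Matrix.transpose_smul, Matrix.transpose_transpose, smul_add, Finset.sum_add_distrib]
    noncomm_ring
  have hA : (P.transpose * coComp φ g₂ x).det ≠ 0 := by
    rw [Matrix.det_mul, Matrix.det_transpose]
    exact mul_ne_zero (det_jac_ne_zero hφ hψ) ((mem_invLocus_iff hφ g₂).1 hx)
  have hsym : ∀ i j l, ∑ k, (P.transpose * coComp φ g₂ x) i k * Z k j l
      = ∑ k, (P.transpose * coComp φ g₂ x) j k * Z k i l := by
    have e1 : ∀ i j l, ∑ k, (P.transpose * coComp φ g₂ x) i k
        * (P.transpose * deltaMat φ g₁ g₂ Γ₁ Γ₂ k x * P) j l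
        = ∑ c, ∑ a, ∑ b, P a i * P b j * P c l
          * ∑ k, coComp φ g₂ x a k * delta φ g₁ g₂ Γ₁ Γ₂ k b c x := by
      intro i j l
      simp only [Matrix.mul_apply, Matrix.transpose_apply, deltaMat, Matrix.of_apply,
        Finset.sum_mul, Finset.mul_sum]
      rw [Finset.sum_comm]
      refine Finset.sum_congr rfl fun c _ => ?_
      rw [Finset.sum_comm_cycle]
      refine Finset.sum_congr rfl fun a _ => ?_
      rw [Finset.sum_comm]
      refine Finset.sum_congr rfl fun b _ => Finset.sum_congr rfl fun k _ => ?_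
      ring
    have e2 : ∀ i j l, ∑ k, (P.transpose * coComp φ g₂ x) i k
        * (∑ c, P k c • deltaMat ψ g₁ g₂ Γ₁ Γ₂ c x) j l
        = ∑ c, coComp ψ g₂ x i c * delta ψ g₁ g₂ Γ₁ Γ₂ c j l x := by
      intro i j l
      rw [coComp_eq_jac hφ hψ, ← hP]
      simp only [Matrix.mul_apply (M := P.transpose * coComp φ g₂ x) (N := P), Matrix.sum_apply,
        Matrix.smul_apply, smul_eq_mul, deltaMat, Matrix.of_apply, Finset.mul_sum, Finset.sum_mul]
      rw [Finset.sum_comm]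
      exact Finset.sum_congr rfl fun c _ => Finset.sum_congr rfl fun k _ => by ring
    intro i j l
    simp only [hZ, Matrix.sub_apply, mul_sub, Finset.sum_sub_distrib, e1, e2]
    rw [hp.delta_torsion₂ hψ hx i j l]
    congr 1
    refine Finset.sum_congr rfl fun c _ => ?_
    rw [Finset.sum_comm]
    refine Finset.sum_congr rfl fun a _ => Finset.sum_congr rfl fun b _ => ?_
    rw [hp.delta_torsion₂ hφ hx b a c]
    ring
  refine sub_eq_zero.1 (eq_zero_of_sum_smul hA (Z := Z) (fun i j l => ?_) k)
  refine eq_zero_of_symm_of_antisymm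
    (T := fun i j l => ∑ k, (P.transpose * coComp φ g₂ x) i k * Z k j l) hsym (fun i j l => ?_) i j l
  rw [← Finset.sum_neg_distrib]
  refine Finset.sum_congr rfl fun k _ => ?_
  rw [congrFun (congrFun (hanti k) j) l, Matrix.neg_apply, Matrix.transpose_apply, mul_neg]

lemma opMat_mul_jac (hq : IsQuasihomogeneous r g₁ g₂ τ d) :
    opMat φ g₁ g₂ Γ₁ Γ₂ τ x * jac φ ψ x = jac φ ψ x * opMat ψ g₁ g₂ Γ₁ Γ₂ τ x := by
  have e : ∀ (χ : OpenPartialHomeomorph M (Fin n → 𝕜)) (k l : Fin n),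
      opMat χ g₁ g₂ Γ₁ Γ₂ τ x k l
        = Matrix.vecMul (fun m => pd χ m τ x) (deltaMat χ g₁ g₂ Γ₁ Γ₂ k x) l := by
    intro χ k l
    simp only [opMat, deltaMat, Matrix.of_apply, Matrix.vecMul, dotProduct, mul_comm]
  have hξ : (fun m => pd φ m τ x) = Matrix.vecMul (fun m => pd ψ m τ x) (jac φ ψ x).transpose := by
    ext m
    rw [pd_chain_jac hφ hψ (hq.smAt x), Matrix.vecMul_transpose]
    rfl
  ext k l
  calc (opMat φ g₁ g₂ Γ₁ Γ₂ τ x * jac φ ψ x) k l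
      = Matrix.vecMul (Matrix.vecMul (fun m => pd φ m τ x) (deltaMat φ g₁ g₂ Γ₁ Γ₂ k x))
          (jac φ ψ x) l := by
        simp only [Matrix.mul_apply, e]
        rfl
    _ = Matrix.vecMul (fun m => pd ψ m τ x)
          (∑ c, jac φ ψ x k c • deltaMat ψ g₁ g₂ Γ₁ Γ₂ c x) l := by
        rw [hξ, Matrix.vecMul_vecMul, Matrix.vecMul_vecMul, ← Matrix.mul_assoc,
          deltaMat_eq_jac hp hφ hψ hx]
    _ = _ := by
        simp only [Matrix.mul_apply, e, Matrix.vecMul, dotProduct, Matrix.sum_apply,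
          Matrix.smul_apply, smul_eq_mul, Finset.mul_sum]
        rw [Finset.sum_comm]
        exact Finset.sum_congr rfl fun c _ => Finset.sum_congr rfl fun k _ => by ring

/-- The multiplication of 1-forms does not depend on the patch. -/
lemma formMul_eq (hq : IsQuasihomogeneous r g₁ g₂ τ d)
    (hRφ : (regTensor φ g₁ g₂ τ d x).det ≠ 0) (hRψ : (regTensor ψ g₁ g₂ τ d x).det ≠ 0)
    (u v : Cotan 𝕜 n x) :
    formMul φ g₁ g₂ Γ₁ Γ₂ τ d u v = formMul ψ g₁ g₂ Γ₁ Γ₂ τ d u v := by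
  have hdelta : ∀ v : Cotan 𝕜 n x,
      deltaOp φ g₁ g₂ Γ₁ Γ₂ u v = deltaOp ψ g₁ g₂ Γ₁ Γ₂ u v := by
    intro v
    have e : ∀ (χ : OpenPartialHomeomorph M (Fin n → 𝕜)) (k : Fin n),
        ∑ i, ∑ j, covComp χ u i * covComp χ v j * delta χ g₁ g₂ Γ₁ Γ₂ k i j x
          = dotProduct (covComp χ u) ((deltaMat χ g₁ g₂ Γ₁ Γ₂ k x).mulVec (covComp χ v)) := by
      intro χ k
      simp only [dotProduct, Matrix.mulVec, deltaMat, Matrix.of_apply, Finset.mul_sum]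
      exact Finset.sum_congr rfl fun i _ => Finset.sum_congr rfl fun j _ => by ring
    unfold deltaOp
    simp only [e]
    rw [← covOf_jac hφ hψ]
    congr 1
    ext k
    have h1 := congrArg (fun A => dotProduct (covComp ψ u) (A.mulVec (covComp ψ v)))
      (deltaMat_eq_jac hp hφ hψ hx k)
    simp only [Matrix.sum_mulVec, Matrix.smul_mulVec, dotProduct_sum, dotProduct_smul,
      smul_eq_mul] at h1
    rw [covComp_eq_jac hφ hψ u, covComp_eq_jac hφ hψ v]
    refine Eq.trans ?_ h1
    rw [← Matrix.mulVec_mulVec, ← Matrix.mulVec_mulVec, Matrix.dotProduct_mulVec (covComp ψ u),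
      Matrix.vecMul_transpose]
  have hreg : regInv φ g₁ g₂ τ d v = regInv ψ g₁ g₂ τ d v := by
    unfold regInv
    rw [← covOf_jac hφ hψ, covComp_eq_jac hφ hψ v]
    congr 1
    rw [regTensor_eq hp hq hφ hx] at hRφ ⊢
    rw [regTensor_eq hp hq hψ hx] at hRψ ⊢
    have h1 := opMat_mul_jac hp hφ hψ hx hq
    rw [Matrix.mulVec_mulVec, Matrix.mulVec_mulVec]
    congr 1
    calc (opMat φ g₁ g₂ Γ₁ Γ₂ τ x)⁻¹ * jac φ ψ x
        = (opMat φ g₁ g₂ Γ₁ Γ₂ τ x)⁻¹ * (jac φ ψ x * opMat ψ g₁ g₂ Γ₁ Γ₂ τ x)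
          * (opMat ψ g₁ g₂ Γ₁ Γ₂ τ x)⁻¹ := by
          rw [Matrix.mul_assoc, Matrix.mul_assoc, Matrix.mul_nonsing_inv _ hRψ.isUnit,
            Matrix.mul_one]
      _ = _ := by
          rw [← h1, ← Matrix.mul_assoc, Matrix.nonsing_inv_mul _ hRφ.isUnit, Matrix.one_mul]
  unfold formMul
  rw [hreg, hdelta]

end pencil

end

section

variable {φ ψ : OpenPartialHomeomorph M (Fin n → 𝕜)} {x : M}

/-! ### The algebra of 1-forms -/

/-- The identification `T*_xM → T_xM` defined by a bilinear form on the cotangent space. -/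
def sharp (g : CoForm 𝕜 n M) (x : M) : Cotan 𝕜 n x →ₗ[𝕜] Tan 𝕜 n x :=
  (Module.evalEquiv 𝕜 (Tan 𝕜 n x)).symm.toLinearMap ∘ₗ g x

open Classical in
/-- The inverse of `sharp`, where the bilinear form is nondegenerate; zero elsewhere. -/
def flatForm (g : CoForm 𝕜 n M) (x : M) : Tan 𝕜 n x →ₗ[𝕜] Cotan 𝕜 n x :=
  if h : (g x).Nondegenerate then
    (((g x).toDual h).trans (Module.evalEquiv 𝕜 (Tan 𝕜 n x)).symm).symm.toLinearMap
  else 0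

lemma apply_sharp (g : CoForm 𝕜 n M) (u w : Cotan 𝕜 n x) : u (sharp g x w) = g x w u :=
  Module.apply_evalEquiv_symm_apply (R := 𝕜) (M := Tan 𝕜 n x) u (g x w)

lemma flatForm_sharp {g : CoForm 𝕜 n M} (hx : x ∈ invLocus g) (u : Cotan 𝕜 n x) :
    flatForm g x (sharp g x u) = u := by
  have hx' : (g x).Nondegenerate := hx
  rw [flatForm, dif_pos hx']
  exact (((g x).toDual hx').trans (Module.evalEquiv 𝕜 (Tan 𝕜 n x)).symm).symm_apply_apply u

lemma sharp_flatForm {g : CoForm 𝕜 n M} (hx : x ∈ invLocus g) (v : Tan 𝕜 n x) :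
    sharp g x (flatForm g x v) = v := by
  have hx' : (g x).Nondegenerate := hx
  rw [flatForm, dif_pos hx']
  exact (((g x).toDual hx').trans (Module.evalEquiv 𝕜 (Tan 𝕜 n x)).symm).apply_symm_apply v

lemma flatForm_injective {g : CoForm 𝕜 n M} (hx : x ∈ invLocus g) :
    Function.Injective (flatForm g x) := fun v w hvw => by
  rw [← sharp_flatForm hx v, hvw, sharp_flatForm hx]

lemma apply_flatForm {g : CoForm 𝕜 n M} (hg : IsContraMetric r g) (hx : x ∈ invLocus g)
    (v w : Tan 𝕜 n x) : g x (flatForm g x v) (flatForm g x w) = flatForm g x v w := by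
  rw [← (hg.symm x).eq, ← apply_sharp, sharp_flatForm hx]

/-- The multiplication of 1-forms as a bilinear map. -/
def formMulLin (φ : OpenPartialHomeomorph M (Fin n → 𝕜)) (g₁ g₂ : CoForm 𝕜 n M) (Γ₁ Γ₂ : Coeffs 𝕜 n M)
    (τ : M → 𝕜) (d : 𝕜) (x : M) : Cotan 𝕜 n x →ₗ[𝕜] Cotan 𝕜 n x →ₗ[𝕜] Cotan 𝕜 n x :=
  LinearMap.mk₂ 𝕜 (fun u v => ∑ i, ∑ j, ∑ k, ∑ l, (u (coordVec φ i x)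
      * v (coordVec φ l x) * (deltaMat φ g₁ g₂ Γ₁ Γ₂ k x i j * (regTensor φ g₁ g₂ τ d x)⁻¹ j l))
      • dcoord φ k x)
    (fun u u' v => by simp only [LinearMap.add_apply, add_mul, add_smul, Finset.sum_add_distrib])
    (fun c u v => by
      simp only [LinearMap.smul_apply, smul_eq_mul, Finset.smul_sum, smul_smul, mul_assoc])
    (fun u v v' => by
      simp only [LinearMap.add_apply, add_mul, mul_add, add_smul, Finset.sum_add_distrib])
    (fun c u v => by
      simp only [LinearMap.smul_apply, smul_eq_mul, Finset.smul_sum, smul_smul, mul_assoc,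
        mul_left_comm c])

variable [IsManifold 𝓘(𝕜, Fin n → 𝕜) r M]

/-- The components of a product of 1-forms. -/
lemma covComp_formMul (h : PatchAt r φ x) (g₁ g₂ : CoForm 𝕜 n M) (Γ₁ Γ₂ : Coeffs 𝕜 n M)
    (τ : M → 𝕜) (d : 𝕜) (u v : Cotan 𝕜 n x) (k : Fin n) :
    covComp φ (formMul φ g₁ g₂ Γ₁ Γ₂ τ d u v) k = dotProduct (covComp φ u)
      ((deltaMat φ g₁ g₂ Γ₁ Γ₂ k x * (regTensor φ g₁ g₂ τ d x)⁻¹).mulVec (covComp φ v)) := by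
  rw [← Matrix.mulVec_mulVec, formMul, deltaOp, covComp_covOf h, regInv, covComp_covOf h]
  generalize (regTensor φ g₁ g₂ τ d x)⁻¹.mulVec (covComp φ v) = w
  simp only [dotProduct, Matrix.mulVec, deltaMat, Matrix.of_apply, Finset.mul_sum]
  exact Finset.sum_congr rfl fun i _ => Finset.sum_congr rfl fun j _ => by ring

lemma formMulLin_apply (h : PatchAt r φ x) (g₁ g₂ : CoForm 𝕜 n M) (Γ₁ Γ₂ : Coeffs 𝕜 n M)
    (τ : M → 𝕜) (d : 𝕜) (u v : Cotan 𝕜 n x) :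
    formMulLin φ g₁ g₂ Γ₁ Γ₂ τ d x u v = formMul φ g₁ g₂ Γ₁ Γ₂ τ d u v := by
  rw [← covOf_covComp h (formMul φ g₁ g₂ Γ₁ Γ₂ τ d u v), covOf]
  simp only [covComp_formMul h]
  simp only [formMulLin, LinearMap.mk₂_apply, dotProduct, Matrix.mulVec, Matrix.mul_apply,
    Finset.mul_sum, Finset.sum_mul, Finset.sum_smul]
  rw [Finset.sum_comm_cycle]
  refine Finset.sum_congr rfl fun k _ => Finset.sum_congr rfl fun i _ => ?_
  rw [Finset.sum_comm]
  refine Finset.sum_congr rfl fun l _ => Finset.sum_congr rfl fun j _ => ?_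
  congr 1
  simp only [covComp]
  ring

section core

variable {g₁ g₂ : CoForm 𝕜 n M} {Γ₁ Γ₂ : Coeffs 𝕜 n M} {τ : M → 𝕜} {d : 𝕜}
variable (hp : IsFlatPencil r g₁ g₂ Γ₁ Γ₂) (hq : IsQuasihomogeneous r g₁ g₂ τ d)
variable (h : PatchAt r φ x) (hx : x ∈ invLocus g₂)
variable (hR : (regTensor φ g₁ g₂ τ d x).det ≠ 0)

include hp hq h hx hR

lemma formMul_comm (u v : Cotan 𝕜 n x) :
    formMul φ g₁ g₂ Γ₁ Γ₂ τ d u v = formMul φ g₁ g₂ Γ₁ Γ₂ τ d v u := by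
  refine cotan_ext h (funext fun k => ?_)
  rw [covComp_formMul h, covComp_formMul h, Matrix.dotProduct_mulVec, dotProduct_comm,
    ← Matrix.mulVec_transpose]
  rw [regTensor_eq hp hq h hx] at hR ⊢
  rw [deltaMat_mul_inv_symm hp hq h hx hR]

/-- The multiplications by two 1-forms commute. -/
lemma formMul_right_comm (u v w : Cotan 𝕜 n x) :
    formMul φ g₁ g₂ Γ₁ Γ₂ τ d (formMul φ g₁ g₂ Γ₁ Γ₂ τ d u v) w
      = formMul φ g₁ g₂ Γ₁ Γ₂ τ d (formMul φ g₁ g₂ Γ₁ Γ₂ τ d u w) v := by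
  have e : ∀ v w : Cotan 𝕜 n x, ∀ j,
      covComp φ (formMul φ g₁ g₂ Γ₁ Γ₂ τ d (formMul φ g₁ g₂ Γ₁ Γ₂ τ d u v) w) j
      = ∑ m, ∑ k, ∑ i, covComp φ u m * ((regTensor φ g₁ g₂ τ d x)⁻¹.mulVec (covComp φ v)) k
        * ((regTensor φ g₁ g₂ τ d x)⁻¹.mulVec (covComp φ w)) i
        * ∑ s, delta φ g₁ g₂ Γ₁ Γ₂ s m k x * delta φ g₁ g₂ Γ₁ Γ₂ j s i x := by
    intro v w j
    simp only [covComp_formMul h, ← Matrix.mulVec_mulVec, dotProduct]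
    generalize (regTensor φ g₁ g₂ τ d x)⁻¹.mulVec (covComp φ v) = a
    generalize (regTensor φ g₁ g₂ τ d x)⁻¹.mulVec (covComp φ w) = b
    simp only [Matrix.mulVec, dotProduct, deltaMat, Matrix.of_apply, Finset.mul_sum, Finset.sum_mul]
    rw [Finset.sum_comm_cycle]
    refine Finset.sum_congr rfl fun m _ => ?_
    rw [Finset.sum_comm_cycle]
    refine Finset.sum_congr rfl fun k _ => ?_
    rw [Finset.sum_comm]
    exact Finset.sum_congr rfl fun i _ => Finset.sum_congr rfl fun s _ => by ring
  refine cotan_ext h (funext fun j => ?_)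
  rw [e, e]
  refine Finset.sum_congr rfl fun m _ => ?_
  rw [Finset.sum_comm]
  refine Finset.sum_congr rfl fun i _ => Finset.sum_congr rfl fun k _ => ?_
  rw [(hp.curvature_coeffs h hx).2.2 m i j k]
  ring

lemma formMul_assoc (u v w : Cotan 𝕜 n x) :
    formMul φ g₁ g₂ Γ₁ Γ₂ τ d (formMul φ g₁ g₂ Γ₁ Γ₂ τ d u v) w
      = formMul φ g₁ g₂ Γ₁ Γ₂ τ d u (formMul φ g₁ g₂ Γ₁ Γ₂ τ d v w) := by
  rw [formMul_comm hp hq h hx hR u v, formMul_right_comm hp hq h hx hR,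
    formMul_comm hp hq h hx hR _ u]

/-- The unity of the algebra of 1-forms is `dτ`. -/
lemma formMul_dform (v : Cotan 𝕜 n x) : formMul φ g₁ g₂ Γ₁ Γ₂ τ d (dform n τ x) v = v := by
  have hξ : covComp φ (dform n τ x) = fun m => pd φ m τ x := by
    rw [dform_eq h (hq.smAt x)]
    exact covComp_covOf h _
  refine cotan_ext h (funext fun k => ?_)
  rw [covComp_formMul h, hξ, ← Matrix.mulVec_mulVec]
  have hR' := hR
  rw [regTensor_eq hp hq h hx] at hR' ⊢
  have e : ∀ w : Fin n → 𝕜, dotProduct (fun m => pd φ m τ x)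
      ((deltaMat φ g₁ g₂ Γ₁ Γ₂ k x).mulVec w) = (opMat φ g₁ g₂ Γ₁ Γ₂ τ x).mulVec w k := by
    intro w
    simp only [dotProduct, Matrix.mulVec, deltaMat, opMat, Matrix.of_apply, Finset.mul_sum,
      Finset.sum_mul]
    rw [Finset.sum_comm]
    exact Finset.sum_congr rfl fun i _ => Finset.sum_congr rfl fun s _ => by ring
  rw [e, Matrix.mulVec_mulVec, Matrix.mul_nonsing_inv _ hR'.isUnit, Matrix.one_mulVec]

/-- The intersection form is `g₁`. -/
lemma formMul_euler (u v : Cotan 𝕜 n x) :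
    formMul φ g₁ g₂ Γ₁ Γ₂ τ d u v (gradient g₁ τ x) = g₁ x u v := by
  have h1 : formMul φ g₁ g₂ Γ₁ Γ₂ τ d u v (gradient g₁ τ x)
      = ∑ k, vecComp φ (gradient g₁ τ) k x * covComp φ (formMul φ g₁ g₂ Γ₁ Γ₂ τ d u v) k := by
    conv_lhs => rw [tan_eq_sum h (gradient g₁ τ x)]
    simp only [map_sum, map_smul, smul_eq_mul]
    rfl
  have hR' := hR
  have h2 := sum_smul_deltaMat₁ hp hq h hx
  rw [regTensor_eq hp hq h hx] at hR'
  rw [h1]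
  simp only [covComp_formMul h, regTensor_eq hp hq h hx]
  have h3 : ∑ k, vecComp φ (gradient g₁ τ) k x • (deltaMat φ g₁ g₂ Γ₁ Γ₂ k x
      * (opMat φ g₁ g₂ Γ₁ Γ₂ τ x)⁻¹) = coComp φ g₁ x := by
    simp only [← Matrix.smul_mul, ← Finset.sum_mul]
    rw [h2, Matrix.mul_assoc, Matrix.mul_nonsing_inv _ hR'.isUnit, Matrix.mul_one]
  have h4 : g₁ x u v = dotProduct (covComp φ u) ((coComp φ g₁ x).mulVec (covComp φ v)) := by
    rw [coForm_apply h]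
    simp only [dotProduct, Matrix.mulVec, Finset.mul_sum]
    exact Finset.sum_congr rfl fun i _ => Finset.sum_congr rfl fun j _ => by ring
  rw [h4, ← h3]
  simp only [Matrix.sum_mulVec, Matrix.smul_mulVec, dotProduct_sum, dotProduct_smul, smul_eq_mul]

end core

lemma flatForm_coordVec (h : PatchAt r φ x) {g : CoForm 𝕜 n M}
    (hx : x ∈ invLocus g) (i j : Fin n) :
    flatForm g x (coordVec φ i x) (coordVec φ j x) = coInv φ g x i j := by
  set A : Matrix (Fin n) (Fin n) 𝕜 :=
    Matrix.of fun i j => flatForm g x (coordVec φ i x) (coordVec φ j x) with hA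
  have h1 : ∀ k, sharp g x (dcoord φ k x) = ∑ i, coComp φ g x k i • coordVec φ i x := by
    intro k
    conv_lhs => rw [tan_eq_sum h (sharp g x (dcoord φ k x))]
    simp only [apply_sharp]
    rfl
  have h2 : coComp φ g x * A = 1 := by
    ext k j
    have h3 := congrArg (fun u => u (coordVec φ j x)) (flatForm_sharp hx (dcoord φ k x))
    simp only [h1, map_sum, map_smul, LinearMap.sum_apply, LinearMap.smul_apply, smul_eq_mul,
      dcoord_coordVec h] at h3
    rw [Matrix.mul_apply, Matrix.one_apply]
    exact h3
  have h4 : A = coInv φ g x := (Matrix.inv_eq_right_inv h2).symm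
  exact congrFun (congrFun h4 i) j

lemma covComp_flatForm (h : PatchAt r φ x) {g : CoForm 𝕜 n M} (hg : IsContraMetric r g)
    (hx : x ∈ invLocus g) (v : Tan 𝕜 n x) :
    covComp φ (flatForm g x v) = (coInv φ g x).mulVec (fun i => dcoord φ i x v) := by
  ext j
  have h1 : covComp φ (flatForm g x v) j = flatForm g x v (coordVec φ j x) := rfl
  rw [h1]
  conv_lhs => rw [tan_eq_sum h v]
  simp only [map_sum, map_smul, LinearMap.sum_apply, LinearMap.smul_apply, smul_eq_mul,
    flatForm_coordVec h hx, Matrix.mulVec, dotProduct]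
  exact Finset.sum_congr rfl fun i _ => by rw [← (hg.coInv_isSymm x).apply i j, mul_comm]

end

section

variable {φ ψ : OpenPartialHomeomorph M (Fin n → 𝕜)} {x : M}

/-! ### Lie brackets and derivatives along a vector field -/

/-- The derivative `X^s ∂_s f` of a function along a vector field. -/
def dirD (φ : OpenPartialHomeomorph M (Fin n → 𝕜)) (X : ∀ x : M, Tan 𝕜 n x) (f : M → 𝕜) (x : M) : 𝕜 :=
  ∑ s, vecComp φ X s x * pd φ s f x

lemma dirD_congr {f f' : M → 𝕜} (hx : x ∈ φ.source) (h : f =ᶠ[𝓝 x] f') (X : ∀ x : M, Tan 𝕜 n x) :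
    dirD φ X f x = dirD φ X f' x := by
  simp only [dirD, pd_congr hx h]

lemma dirM_apply (X : ∀ x : M, Tan 𝕜 n x) (A : M → Matrix (Fin n) (Fin n) 𝕜) (i j : Fin n) :
    dirM φ X A x i j = dirD φ X (fun y => A y i j) x := by
  simp only [dirM, dirD, Matrix.sum_apply, Matrix.smul_apply, smul_eq_mul, pdM, Matrix.of_apply]

variable [IsManifold 𝓘(𝕜, Fin n → 𝕜) r M]

lemma dirD_mul (h : PatchAt r φ x) {f f' : M → 𝕜} (hf : SmAt n r f x) (hf' : SmAt n r f' x)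
    (X : ∀ x : M, Tan 𝕜 n x) :
    dirD φ X (fun y => f y * f' y) x = dirD φ X f x * f' x + f x * dirD φ X f' x := by
  simp only [dirD, pd_mul h hf hf', Finset.sum_mul, Finset.mul_sum, ← Finset.sum_add_distrib]
  exact Finset.sum_congr rfl fun s _ => by ring

lemma dirD_sum (h : PatchAt r φ x) {f : Fin n → M → 𝕜} (hf : ∀ i, SmAt n r (f i) x)
    (X : ∀ x : M, Tan 𝕜 n x) :
    dirD φ X (fun y => ∑ i, f i y) x = ∑ i, dirD φ X (f i) x := by
  simp only [dirD, pd_sum h fun i _ => hf i, Finset.mul_sum]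
  exact Finset.sum_comm

lemma dform_eq_dirD (h : PatchAt r φ x) {f : M → 𝕜} (hf : SmAt n r f x) (X : ∀ x : M, Tan 𝕜 n x) :
    dform n f x (X x) = dirD φ X f x := by
  rw [dform_apply h hf]
  exact Finset.sum_congr rfl fun i _ => mul_comm _ _

lemma smAt_bilin {a b : Fin n → M → 𝕜} {A : M → Matrix (Fin n) (Fin n) 𝕜}
    (ha : ∀ i, SmAt n r (a i) x) (hA : SmMatAt r A x) (hb : ∀ i, SmAt n r (b i) x) :
    SmAt n r (fun y => dotProduct (fun i => a i y) ((A y).mulVec fun j => b j y)) x :=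
  show SmAt n r (fun y => ∑ i, a i y * ∑ j, A y i j * b j y) x from
    SmAt.sum fun i _ => (ha i).mul (SmAt.sum fun j _ => (hA i j).mul (hb j))

/-- The derivative of a bilinear expression. -/
lemma dirD_bilin (h : PatchAt r φ x) {a b : Fin n → M → 𝕜} {A : M → Matrix (Fin n) (Fin n) 𝕜}
    (ha : ∀ i, SmAt n r (a i) x) (hA : SmMatAt r A x) (hb : ∀ i, SmAt n r (b i) x)
    (X : ∀ x : M, Tan 𝕜 n x) :
    dirD φ X (fun y => dotProduct (fun i => a i y) ((A y).mulVec fun j => b j y)) x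
      = dotProduct (fun i => dirD φ X (a i) x) ((A x).mulVec fun j => b j x)
        + dotProduct (fun i => a i x) ((dirM φ X A x).mulVec fun j => b j x)
        + dotProduct (fun i => a i x) ((A x).mulVec fun j => dirD φ X (b j) x) := by
  have h1 : dirD φ X (fun y => ∑ i, a i y * ∑ j, A y i j * b j y) x
      = ∑ i, (dirD φ X (a i) x * ∑ j, A x i j * b j x
        + a i x * ∑ j, (dirD φ X (fun y => A y i j) x * b j x + A x i j * dirD φ X (b j) x)) := by
    rw [dirD_sum h fun i => (ha i).mul (SmAt.sum fun j _ => (hA i j).mul (hb j))]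
    refine Finset.sum_congr rfl fun i _ => ?_
    rw [dirD_mul h (ha i) (SmAt.sum fun j _ => (hA i j).mul (hb j)),
      dirD_sum h fun j => (hA i j).mul (hb j)]
    simp only [dirD_mul h (hA i _) (hb _)]
  refine h1.trans ?_
  simp only [dotProduct, Matrix.mulVec, dirM_apply, ← Finset.sum_add_distrib]
  refine Finset.sum_congr rfl fun i _ => ?_
  rw [Finset.sum_add_distrib]
  ring

/-- A vector field on `M`, written in the coordinates of a patch. -/
def coordField (φ : OpenPartialHomeomorph M (Fin n → 𝕜)) (X : ∀ x : M, Tan 𝕜 n x) :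
    (Fin n → 𝕜) → (Fin n → 𝕜) :=
  VectorField.mpullback 𝓘(𝕜, Fin n → 𝕜) 𝓘(𝕜, Fin n → 𝕜) φ.symm X

lemma coordField_apply (h : PatchAt r φ x) (X : ∀ x : M, Tan 𝕜 n x) (i : Fin n) :
    (fun z => coordField φ X z i) =ᶠ[𝓝 (φ x)] vecComp φ X i ∘ φ.symm := by
  filter_upwards [φ.open_target.mem_nhds (φ.map_source h.mem)] with z hz
  have h1 := mdifferentiable_patch h
  have h2 : mfderiv 𝓘(𝕜, Fin n → 𝕜) 𝓘(𝕜, Fin n → 𝕜) φ.symm z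
    = (h1.symm.mfderiv hz : _ →L[𝕜] _) := rfl
  have h3 : coordField φ X z = (h1.symm.mfderiv hz).symm (X (φ.symm z)) := by
    rw [coordField, VectorField.mpullback_apply, h2, ContinuousLinearMap.inverse_equiv]
    rfl
  rw [h3]
  rfl

lemma fderiv_coordField (h : PatchAt r φ x) {X : ∀ x : M, Tan 𝕜 n x}
    (hX : ∀ i, SmAt n r (vecComp φ X i) x) (Y : ∀ x : M, Tan 𝕜 n x) (i : Fin n) :
    fderiv 𝕜 (coordField φ X) (φ x) (coordField φ Y (φ x)) i = dirD φ Y (vecComp φ X i) x := by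
  have hd : DifferentiableAt 𝕜 (coordField φ X) (φ x) :=
    differentiableAt_pi.2 fun i => ((hX i).differentiableAt h).congr_of_eventuallyEq
      (coordField_apply h X i)
  have h1 := (coordField_apply h X i).fderiv_eq (𝕜 := 𝕜)
  rw [fderiv_apply hd] at h1
  refine (congrArg (fun L : (Fin n → 𝕜) →L[𝕜] 𝕜 => L (coordField φ Y (φ x))) h1).trans ?_
  conv_lhs => rw [pi_eq_sum_univ' (coordField φ Y (φ x))]
  simp only [map_sum, map_smul, smul_eq_mul, dirD, pd]
  refine Finset.sum_congr rfl fun s _ => ?_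
  have h2 : coordField φ Y (φ x) s = _ := (coordField_apply h Y s).self_of_nhds
  rw [Function.comp, φ.left_inv h.mem] at h2
  rw [h2]

/-- The components of the Lie bracket in the preferred chart at a point. -/
lemma dcoord_bracket (h : PatchAt r (chartAt (Fin n → 𝕜) x) x) {X Y : ∀ x : M, Tan 𝕜 n x}
    (hX : ∀ i, SmAt n r (vecComp (chartAt (Fin n → 𝕜) x) X i) x)
    (hY : ∀ i, SmAt n r (vecComp (chartAt (Fin n → 𝕜) x) Y i) x) (i : Fin n) :
    dcoord (chartAt (Fin n → 𝕜) x) i x (bracket X Y x)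
      = dirD (chartAt (Fin n → 𝕜) x) X (vecComp (chartAt (Fin n → 𝕜) x) Y i) x
        - dirD (chartAt (Fin n → 𝕜) x) Y (vecComp (chartAt (Fin n → 𝕜) x) X i) x := by
  set φ := chartAt (Fin n → 𝕜) x with hφ
  have e : ∀ Z : (∀ x : M, Tan 𝕜 n x), VectorField.mpullbackWithin 𝓘(𝕜, Fin n → 𝕜)
      𝓘(𝕜, Fin n → 𝕜) (extChartAt 𝓘(𝕜, Fin n → 𝕜) x).symm Z (Set.range 𝓘(𝕜, Fin n → 𝕜))
      = coordField φ Z := by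
    intro Z
    rw [modelWithCornersSelf_coe, Set.range_id, VectorField.mpullbackWithin_univ]
    rfl
  have e' : VectorField.lieBracketWithin 𝕜 (coordField φ X) (coordField φ Y)
      ((extChartAt 𝓘(𝕜, Fin n → 𝕜) x).symm ⁻¹' Set.univ ∩ Set.range 𝓘(𝕜, Fin n → 𝕜))
      = VectorField.lieBracket 𝕜 (coordField φ X) (coordField φ Y) := by
    rw [modelWithCornersSelf_coe, Set.range_id, Set.preimage_univ, Set.univ_inter,
      VectorField.lieBracketWithin_univ]
  have h2 : bracket X Y x = (mfderiv 𝓘(𝕜, Fin n → 𝕜) 𝓘(𝕜, Fin n → 𝕜) φ x).inverse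
      ((VectorField.lieBracket 𝕜 (coordField φ X) (coordField φ Y) (φ x) : Fin n → 𝕜) :
        TangentSpace 𝓘(𝕜, Fin n → 𝕜) (φ x)) := by
    rw [← e', ← e, ← e]
    rfl
  have h3 : mfderiv 𝓘(𝕜, Fin n → 𝕜) 𝓘(𝕜, Fin n → 𝕜) φ x
    = ((mdifferentiable_patch h).mfderiv h.mem : _ →L[𝕜] _) := rfl
  have h1 : bracket X Y x = (patchDeriv h).symm
      (VectorField.lieBracket 𝕜 (coordField φ X) (coordField φ Y) (φ x)) := by
    rw [h2, h3, ContinuousLinearMap.inverse_equiv]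
    rfl
  rw [h1, dcoord_apply h, LinearEquiv.apply_symm_apply, VectorField.lieBracket_eq]
  simp only [Pi.sub_apply]
  rw [fderiv_coordField h hY, fderiv_coordField h hX]

end

section

variable {φ ψ : OpenPartialHomeomorph M (Fin n → 𝕜)} {x : M}

/-! ### The induced Frobenius structure -/

/-- The Frobenius structure induced by the pencil. The multiplication of 1-forms, which does not depend
on the patch, is computed in the preferred chart at each point. The values outside the invertibility
locus of `g₂` are irrelevant. -/
def inducedFrob (g₁ g₂ : CoForm 𝕜 n M) (Γ₁ Γ₂ : Coeffs 𝕜 n M) (τ : M → 𝕜) (d : 𝕜) :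
    FrobData 𝕜 n M where
  metric x := flatForm g₂ x
  mul x := ((formMulLin (chartAt (Fin n → 𝕜) x) g₁ g₂ Γ₁ Γ₂ τ d x).compl₁₂ (flatForm g₂ x)
    (flatForm g₂ x)).compr₂ (sharp g₂ x)
  unit := gradient g₂ τ
  euler := gradient g₁ τ
  charge := d

/-- The components of a tangent vector. -/
def comps (φ : OpenPartialHomeomorph M (Fin n → 𝕜)) {x : M} (v : Tan 𝕜 n x) : Fin n → 𝕜 :=
  fun i => dcoord φ i x v

/-- A function of four arguments is symmetric if it is invariant under the transpositions (0 3), (1 2)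
and (1 3), since these generate the symmetric group. -/
lemma perm_four_invariant {α β : Type*} {N : α → α → α → α → β}
    (h1 : ∀ a b c e, N a b c e = N e b c a) (h2 : ∀ a b c e, N a b c e = N a c b e)
    (h3 : ∀ a b c e, N a b c e = N a e c b) (a : Fin 4 → α) (σ : Equiv.Perm (Fin 4)) :
    N (a (σ 0)) (a (σ 1)) (a (σ 2)) (a (σ 3)) = N (a 0) (a 1) (a 2) (a 3) := by
  have h01 : ∀ a b c e, N a b c e = N b a c e := fun a b c e => by
    rw [h3 a b c e, h1 a e c b, h3 b e c a]
  have h23 : ∀ a b c e, N a b c e = N a b e c := fun a b c e => by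
    rw [h3 a b c e, h2 a e c b, h3 a c e b]
  have hσ : σ ∈ Submonoid.closure (Set.range fun i : Fin 3 => Equiv.swap i.castSucc i.succ) := by
    rw [Equiv.Perm.mclosure_swap_castSucc_succ]; trivial
  induction hσ using Submonoid.closure_induction generalizing a with
  | mem τ hτ =>
    obtain ⟨i, rfl⟩ := hτ
    fin_cases i
    · exact h01 _ _ _ _
    · exact h2 _ _ _ _
    · exact h23 _ _ _ _
  | one => rfl
  | mul τ τ' _ _ ih ih' =>
    have := ih' (fun i => a (τ i))
    simp only [Equiv.Perm.mul_apply]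
    rw [this, ih]

variable [IsManifold 𝓘(𝕜, Fin n → 𝕜) r M]

lemma patchAt_chartAt (hr : ∞ ≤ r) (x : M) : PatchAt r (chartAt (Fin n → 𝕜) x) x :=
  ⟨hr, IsManifold.chart_mem_maximalAtlas x, mem_chart_source _ x⟩

lemma SmoothVecOn.smAt {X : ∀ x : M, Tan 𝕜 n x} {V : Set M} (hX : SmoothVecOn r X V)
    (hV : V ∈ 𝓝 x) (h : PatchAt r φ x) (i : Fin n) : SmAt n r (vecComp φ X i) x :=
  (hX φ h.patch i).smAt (Filter.inter_mem (φ.open_source.mem_nhds h.mem) hV)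

lemma smoothOn_of_smAt {f : M → 𝕜} {U : Set M} (H : ∀ x ∈ U, SmAt n r f x) : SmoothOn n r f U :=
  fun x hx => (H x hx).contMDiffWithinAt

lemma comps_coordVec (h : PatchAt r φ x) (i : Fin n) : comps φ (coordVec φ i x) = Pi.single i 1 := by
  ext j
  rw [comps, dcoord_coordVec h, Pi.single_apply]

lemma cotan_apply (h : PatchAt r φ x) (u : Cotan 𝕜 n x) (v : Tan 𝕜 n x) :
    u v = dotProduct (covComp φ u) (comps φ v) := by
  conv_lhs => rw [cotan_eq_sum h u]
  simp [dotProduct, comps]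

lemma flatForm_apply (h : PatchAt r φ x) {g : CoForm 𝕜 n M} (hg : IsContraMetric r g)
    (hx : x ∈ invLocus g) (v w : Tan 𝕜 n x) :
    flatForm g x v w = dotProduct (comps φ v) ((coInv φ g x).mulVec (comps φ w)) := by
  have hs : (coInv φ g x).transpose = coInv φ g x := hg.coInv_isSymm x
  rw [cotan_apply h, covComp_flatForm h hg hx, Matrix.dotProduct_mulVec, ← Matrix.mulVec_transpose,
    hs]
  rfl

lemma comps_eq (h : PatchAt r φ x) {g : CoForm 𝕜 n M} (hg : IsContraMetric r g)
    (hx : x ∈ invLocus g) (v : Tan 𝕜 n x) :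
    comps φ v = (coComp φ g x).mulVec (covComp φ (flatForm g x v)) := by
  rw [covComp_flatForm h hg hx, Matrix.mulVec_mulVec, coComp_mul_coInv h hx, Matrix.one_mulVec]
  rfl

section core

variable {g₁ g₂ : CoForm 𝕜 n M} {Γ₁ Γ₂ : Coeffs 𝕜 n M} {τ : M → 𝕜} {d : 𝕜}

lemma flatForm_mul (hp : IsFlatPencil r g₁ g₂ Γ₁ Γ₂) (hq : IsQuasihomogeneous r g₁ g₂ τ d)
    (hreg : IsRegular r g₁ g₂ τ d) (h : PatchAt r φ x) (hx : x ∈ invLocus g₂) (v w : Tan 𝕜 n x) :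
    flatForm g₂ x ((inducedFrob g₁ g₂ Γ₁ Γ₂ τ d).mul x v w)
      = formMul φ g₁ g₂ Γ₁ Γ₂ τ d (flatForm g₂ x v) (flatForm g₂ x w) := by
  have hc := patchAt_chartAt (𝕜 := 𝕜) (n := n) h.le x
  rw [← formMul_eq hp hc h hx hq (hreg _ hc.patch x ⟨hc.mem, hx⟩) (hreg _ h.patch x ⟨h.mem, hx⟩),
    ← formMulLin_apply hc]
  exact flatForm_sharp hx _

lemma metricComp_inducedFrob (h : PatchAt r φ x) (hx : x ∈ invLocus g₂) :
    (inducedFrob g₁ g₂ Γ₁ Γ₂ τ d).metricComp φ x = coInv φ g₂ x := by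
  ext i j
  exact flatForm_coordVec h hx i j

lemma metricComp_eventuallyEq (hp : IsFlatPencil r g₁ g₂ Γ₁ Γ₂) (h : PatchAt r φ x)
    (hx : x ∈ invLocus g₂) :
    (inducedFrob g₁ g₂ Γ₁ Γ₂ τ d).metricComp φ =ᶠ[𝓝 x] coInv φ g₂ := by
  filter_upwards [eventually_patch_invLocus h hp.metric₂ hx] with y hy
    using metricComp_inducedFrob hy.1 hy.2

lemma christoffel_inducedFrob (hp : IsFlatPencil r g₁ g₂ Γ₁ Γ₂) (h : PatchAt r φ x)
    (hx : x ∈ invLocus g₂) (s k j : Fin n) :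
    christoffel φ ((inducedFrob g₁ g₂ Γ₁ Γ₂ τ d).metricComp φ) s k j x
      = christoffel φ (coInv φ g₂) s k j x :=
  christoffel_congr h.mem (metricComp_eventuallyEq hp h hx) s k j

lemma nablaVec_inducedFrob (hp : IsFlatPencil r g₁ g₂ Γ₁ Γ₂) (h : PatchAt r φ x)
    (hx : x ∈ invLocus g₂) (X : ∀ x : M, Tan 𝕜 n x) (i j : Fin n) :
    nablaVec φ ((inducedFrob g₁ g₂ Γ₁ Γ₂ τ d).metricComp φ) X i j x = nvec φ g₂ X x i j := by
  simp only [nablaVec, nvec, Matrix.of_apply, christoffel_inducedFrob hp h hx]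

lemma riemann_inducedFrob (hp : IsFlatPencil r g₁ g₂ Γ₁ Γ₂) (h : PatchAt r φ x)
    (hx : x ∈ invLocus g₂) (l k i j : Fin n) :
    riemann φ ((inducedFrob g₁ g₂ Γ₁ Γ₂ τ d).metricComp φ) l k i j x = 0 := by
  rw [← (hp.curvature_coeffs h hx).1 l k i j]
  have hc : ∀ i j k l, pd φ i (christoffel φ ((inducedFrob g₁ g₂ Γ₁ Γ₂ τ d).metricComp φ) j k l) x
      = pd φ i (christoffel φ (coInv φ g₂) j k l) x := by
    intro i j k l
    refine pd_congr h.mem ?_ i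
    filter_upwards [eventually_patch_invLocus h hp.metric₂ hx] with y hy
      using christoffel_inducedFrob hp hy.1 hy.2 j k l
  simp only [riemann, hc, christoffel_inducedFrob hp h hx]

variable (hp : IsFlatPencil r g₁ g₂ Γ₁ Γ₂) (hq : IsQuasihomogeneous r g₁ g₂ τ d)
variable (hreg : IsRegular r g₁ g₂ τ d)
variable (h : PatchAt r φ x) (hx : x ∈ invLocus g₂)
include hp hq h hx

lemma nablaNablaVec_inducedFrob (i j k : Fin n) :
    nablaNablaVec φ ((inducedFrob g₁ g₂ Γ₁ Γ₂ τ d).metricComp φ)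
      (inducedFrob g₁ g₂ Γ₁ Γ₂ τ d).euler i j k x = 0 := by
  set N : M → Matrix (Fin n) (Fin n) 𝕜 := fun y => opMat φ g₁ g₂ Γ₁ Γ₂ τ y
    + ((1 - d) / 2) • (1 : Matrix (Fin n) (Fin n) 𝕜) with hN
  have h1 : ∀ j k, nablaVec φ ((inducedFrob g₁ g₂ Γ₁ Γ₂ τ d).metricComp φ) (gradient g₁ τ) j k
      =ᶠ[𝓝 x] fun y => N y j k := by
    intro j k
    filter_upwards [eventually_patch_invLocus h hp.metric₂ hx] with y hy
    rw [nablaVec_inducedFrob hp hy.1 hy.2, nvec_euler hp hq hy.1 hy.2]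
  have h2 : pd φ i (fun y => N y j k) x = pdM φ i (opMat φ g₁ g₂ Γ₁ Γ₂ τ) x j k := by
    have := pd_add h (smMatAt_opMat hp hq h hx j k)
      (smAt_const ((((1 - d) / 2) • (1 : Matrix (Fin n) (Fin n) 𝕜)) j k)) i
    rw [pd_const, add_zero] at this
    exact this
  have h3 : covLU φ g₂ i (opMat φ g₁ g₂ Γ₁ Γ₂ τ) x = pdM φ i (opMat φ g₁ g₂ Γ₁ Γ₂ τ) x
      - chrMat φ (coInv φ g₂) i x * N x + N x * chrMat φ (coInv φ g₂) i x := by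
    simp only [covLU, covD, hN, mul_add, add_mul, Matrix.mul_smul, Matrix.smul_mul, Matrix.mul_one,
      Matrix.one_mul]
    abel
  rw [covLU_opMat hp hq h hx] at h3
  have h4 := congrFun (congrFun h3 j) k
  rw [Matrix.zero_apply] at h4
  have h5 : nablaNablaVec φ ((inducedFrob g₁ g₂ Γ₁ Γ₂ τ d).metricComp φ) (gradient g₁ τ) i j k x = 0 := by
    rw [h4, nablaNablaVec, pd_congr h.mem (h1 j k), h2]
    simp only [(h1 _ _).self_of_nhds, christoffel_inducedFrob hp h hx, Matrix.add_apply,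
      Matrix.sub_apply, Matrix.mul_apply, chrMat, Matrix.of_apply,
      christoffel_symm hp.metric₂.coInv_isSymm i, mul_comm]
  exact h5

include hreg

lemma det_opMat_ne_zero : (opMat φ g₁ g₂ Γ₁ Γ₂ τ x).det ≠ 0 := by
  rw [← regTensor_eq hp hq h hx]
  exact hreg φ h.patch x ⟨h.mem, hx⟩

/-- The product of two vectors in components. -/
lemma covComp_flatForm_mul (v w : Tan 𝕜 n x) (k : Fin n) :
    covComp φ (flatForm g₂ x ((inducedFrob g₁ g₂ Γ₁ Γ₂ τ d).mul x v w)) k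
      = dotProduct (comps φ v) ((cubic φ g₁ g₂ Γ₁ Γ₂ τ k x).mulVec (comps φ w)) := by
  have hs : (coInv φ g₂ x).transpose = coInv φ g₂ x := hp.metric₂.coInv_isSymm x
  rw [flatForm_mul hp hq hreg h hx, covComp_formMul h, covComp_flatForm h hp.metric₂ hx,
    covComp_flatForm h hp.metric₂ hx, regTensor_eq hp hq h hx, Matrix.mulVec_mulVec]
  have e : ∀ (a b : Fin n → 𝕜) (A B : Matrix (Fin n) (Fin n) 𝕜),
      dotProduct (A.mulVec a) (B.mulVec b) = dotProduct a ((A.transpose * B).mulVec b) := by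
    intro a b A B
    rw [← Matrix.mulVec_mulVec, Matrix.dotProduct_mulVec a, Matrix.vecMul_transpose]
  rw [e, hs, cubic]
  simp only [Matrix.mul_assoc]
  rfl

lemma triComp_inducedFrob (i j k : Fin n) :
    (inducedFrob g₁ g₂ Γ₁ Γ₂ τ d).triComp φ i j k x = cubic φ g₁ g₂ Γ₁ Γ₂ τ k x i j := by
  refine (covComp_flatForm_mul hp hq hreg h hx _ _ k).trans ?_
  rw [comps_coordVec h, comps_coordVec h, single_one_dotProduct, Matrix.mulVec_single_one]
  rfl

lemma mulComp_inducedFrob (i j k : Fin n) :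
    (inducedFrob g₁ g₂ Γ₁ Γ₂ τ d).mulComp φ i j k x
      = ∑ l, coComp φ g₂ x k l * cubic φ g₁ g₂ Γ₁ Γ₂ τ l x i j := by
  refine (congrFun (comps_eq h hp.metric₂ hx _) k).trans ?_
  simp only [Matrix.mulVec, dotProduct]
  refine Finset.sum_congr rfl fun l _ => ?_
  rw [← triComp_inducedFrob hp hq hreg h hx i j l]
  rfl

lemma triComp_inducedFrob_symm (i j k : Fin n) :
    (inducedFrob g₁ g₂ Γ₁ Γ₂ τ d).triComp φ i j k x
      = (inducedFrob g₁ g₂ Γ₁ Γ₂ τ d).triComp φ j i k x := by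
  rw [triComp_inducedFrob hp hq hreg h hx, triComp_inducedFrob hp hq hreg h hx,
    cubic_symm hp hq h hx (det_opMat_ne_zero hp hq hreg h hx)]

lemma triComp_inducedFrob_swap (i j k : Fin n) :
    (inducedFrob g₁ g₂ Γ₁ Γ₂ τ d).triComp φ i j k x
      = (inducedFrob g₁ g₂ Γ₁ Γ₂ τ d).triComp φ k j i x := by
  rw [triComp_inducedFrob hp hq hreg h hx, triComp_inducedFrob hp hq hreg h hx,
    cubic_swap hp h hx]

lemma nablaTri_inducedFrob_perm (a : Fin 4 → Fin n) (σ : Equiv.Perm (Fin 4)) :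
    (inducedFrob g₁ g₂ Γ₁ Γ₂ τ d).nablaTri φ (a (σ 0)) (a (σ 1)) (a (σ 2)) (a (σ 3)) x
      = (inducedFrob g₁ g₂ Γ₁ Γ₂ τ d).nablaTri φ (a 0) (a 1) (a 2) (a 3) x := by
  have hR := det_opMat_ne_zero hp hq hreg h hx
  have hev := eventually_patch_invLocus h hp.metric₂ hx
  have hs : ∀ l i j, christoffel φ (coInv φ g₂) l i j x = christoffel φ (coInv φ g₂) i l j x :=
    fun l i j => christoffel_symm hp.metric₂.coInv_isSymm l i j
  refine perm_four_invariant
    (N := fun l i j k => (inducedFrob g₁ g₂ Γ₁ Γ₂ τ d).nablaTri φ l i j k x)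
    (fun l i j k => ?_) (fun l i j k => ?_) (fun l i j k => ?_) a σ
  · have key : ∀ l k, (inducedFrob g₁ g₂ Γ₁ Γ₂ τ d).nablaTri φ l i j k x
        = covD φ l (chrMat φ (coInv φ g₂) l x) (-(chrMat φ (coInv φ g₂) l x).transpose)
          (cubic φ g₁ g₂ Γ₁ Γ₂ τ k) x i j
          - ∑ m, christoffel φ (coInv φ g₂) l k m x * cubic φ g₁ g₂ Γ₁ Γ₂ τ m x i j := by
      intro l k
      have h1 : pd φ l ((inducedFrob g₁ g₂ Γ₁ Γ₂ τ d).triComp φ i j k) x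
          = pd φ l (fun y => cubic φ g₁ g₂ Γ₁ Γ₂ τ k y i j) x := by
        refine pd_congr h.mem ?_ l
        filter_upwards [hev] with y hy using triComp_inducedFrob hp hq hreg hy.1 hy.2 i j k
      simp only [FrobData.nablaTri, h1, christoffel_inducedFrob hp h hx,
        triComp_inducedFrob hp hq hreg h hx, covD, Matrix.add_apply, Matrix.sub_apply,
        Matrix.mul_apply, Matrix.neg_apply, Matrix.transpose_apply, chrMat, Matrix.of_apply, pdM,
        Finset.sum_add_distrib, mul_neg, hs l]
      simp only [mul_comm (cubic _ _ _ _ _ _ _ _ _ _)]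
      ring
    change (inducedFrob g₁ g₂ Γ₁ Γ₂ τ d).nablaTri φ l i j k x
      = (inducedFrob g₁ g₂ Γ₁ Γ₂ τ d).nablaTri φ k i j l x
    rw [key, key, covD_cubic_comm hp hq h hx hR]
    simp only [hs l k]
  · have h1 : (inducedFrob g₁ g₂ Γ₁ Γ₂ τ d).triComp φ i j k =ᶠ[𝓝 x]
        (inducedFrob g₁ g₂ Γ₁ Γ₂ τ d).triComp φ j i k := by
      filter_upwards [hev] with y hy using triComp_inducedFrob_symm hp hq hreg hy.1 hy.2 i j k
    simp only [FrobData.nablaTri, pd_congr h.mem h1]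
    congr 1
    refine Finset.sum_congr rfl fun m _ => ?_
    rw [triComp_inducedFrob_symm hp hq hreg h hx m j, triComp_inducedFrob_symm hp hq hreg h hx i m,
      triComp_inducedFrob_symm hp hq hreg h hx i j]
    ring
  · have h1 : (inducedFrob g₁ g₂ Γ₁ Γ₂ τ d).triComp φ i j k =ᶠ[𝓝 x]
        (inducedFrob g₁ g₂ Γ₁ Γ₂ τ d).triComp φ k j i := by
      filter_upwards [hev] with y hy using triComp_inducedFrob_swap hp hq hreg hy.1 hy.2 i j k
    simp only [FrobData.nablaTri, pd_congr h.mem h1]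
    congr 1
    refine Finset.sum_congr rfl fun m _ => ?_
    rw [triComp_inducedFrob_swap hp hq hreg h hx m j, triComp_inducedFrob_swap hp hq hreg h hx i m,
      triComp_inducedFrob_swap hp hq hreg h hx i j]
    ring

end core

end

section

variable {φ ψ : OpenPartialHomeomorph M (Fin n → 𝕜)} {x : M}

/-! ### Homogeneity of the induced structure -/

variable [IsManifold 𝓘(𝕜, Fin n → 𝕜) r M]

variable {g₁ g₂ : CoForm 𝕜 n M} {Γ₁ Γ₂ : Coeffs 𝕜 n M} {τ : M → 𝕜} {d : 𝕜}
variable (hp : IsFlatPencil r g₁ g₂ Γ₁ Γ₂) (hq : IsQuasihomogeneous r g₁ g₂ τ d)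
variable (hreg : IsRegular r g₁ g₂ τ d)

include hp hq

/-- The components of `Q(X)`. -/
lemma comps_grading (h : PatchAt r (chartAt (Fin n → 𝕜) x) x) {X : ∀ x : M, Tan 𝕜 n x}
    (hX : ∀ i, SmAt n r (vecComp (chartAt (Fin n → 𝕜) x) X i) x) :
    comps (chartAt (Fin n → 𝕜) x) ((inducedFrob g₁ g₂ Γ₁ Γ₂ τ d).grading X x)
      = (fun i => vecComp (chartAt (Fin n → 𝕜) x) X i x)
        + (fun i => dirD (chartAt (Fin n → 𝕜) x) (gradient g₁ τ)
            (vecComp (chartAt (Fin n → 𝕜) x) X i) x)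
        - (dvec (chartAt (Fin n → 𝕜) x) (gradient g₁ τ) x).transpose.mulVec
          (fun i => vecComp (chartAt (Fin n → 𝕜) x) X i x) := by
  ext i
  have h1 : comps (chartAt (Fin n → 𝕜) x) ((inducedFrob g₁ g₂ Γ₁ Γ₂ τ d).grading X x) i
      = vecComp (chartAt (Fin n → 𝕜) x) X i x
        + dcoord (chartAt (Fin n → 𝕜) x) i x (bracket (gradient g₁ τ) X x) :=
    map_add _ _ _
  rw [h1, dcoord_bracket h (smAt_gradient₁ hp hq h) hX]
  simp only [Pi.add_apply, Pi.sub_apply, Matrix.mulVec, dotProduct, Matrix.transpose_apply, dvec,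
    Matrix.of_apply]
  rw [add_sub_assoc]
  congr 2
  exact Finset.sum_congr rfl fun s _ => mul_comm _ _

/-- The Euler vector field scales the metric. The bracket is computed in the preferred chart, where
`dcoord_bracket` applies. -/
lemma grading_metric_inducedFrob (hr : ∞ ≤ r) (hx : x ∈ invLocus g₂) {X Y : ∀ x : M, Tan 𝕜 n x}
    (hX : ∀ i, SmAt n r (vecComp (chartAt (Fin n → 𝕜) x) X i) x)
    (hY : ∀ i, SmAt n r (vecComp (chartAt (Fin n → 𝕜) x) Y i) x) :
    dform n (fun y => flatForm g₂ y (X y) (Y y)) x (gradient g₁ τ x) + d * flatForm g₂ x (X x) (Y x)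
      = flatForm g₂ x ((inducedFrob g₁ g₂ Γ₁ Γ₂ τ d).grading X x) (Y x)
        + flatForm g₂ x (X x) ((inducedFrob g₁ g₂ Γ₁ Γ₂ τ d).grading Y x) := by
  have h := patchAt_chartAt (𝕜 := 𝕜) (n := n) hr x
  have hgX := comps_grading (Γ₁ := Γ₁) (Γ₂ := Γ₂) hp hq h hX
  have hgY := comps_grading (Γ₁ := Γ₁) (Γ₂ := Γ₂) hp hq h hY
  set φ := chartAt (Fin n → 𝕜) x
  have hH := hp.metric₂.smMatAt_coInv h hx
  have hf : (fun y => flatForm g₂ y (X y) (Y y)) =ᶠ[𝓝 x] fun y =>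
      dotProduct (fun i => vecComp φ X i y) ((coInv φ g₂ y).mulVec fun j => vecComp φ Y j y) := by
    filter_upwards [eventually_patch_invLocus h hp.metric₂ hx] with y hy
      using flatForm_apply hy.1 hp.metric₂ hy.2 _ _
  rw [dform_eq_dirD h ((smAt_bilin hX hH hY).congr hf), dirD_congr h.mem hf,
    dirD_bilin h hX hH hY, dirM_coInv₂ hp hq h hx]
  simp only [flatForm_apply h hp.metric₂ hx, hgX, hgY]
  have e : ∀ v w : Fin n → 𝕜,
      dotProduct ((dvec φ (gradient g₁ τ) x).transpose.mulVec v) w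
        = dotProduct v ((dvec φ (gradient g₁ τ) x).mulVec w) := fun v w => by
    rw [Matrix.dotProduct_mulVec, Matrix.mulVec_transpose]
  have hXx : comps φ (X x) = fun i => vecComp φ X i x := rfl
  have hYx : comps φ (Y x) = fun i => vecComp φ Y i x := rfl
  rw [hXx, hYx]
  simp only [Matrix.sub_mulVec, Matrix.smul_mulVec, add_dotProduct, sub_dotProduct, dotProduct_add,
    dotProduct_sub, Matrix.mulVec_add, Matrix.mulVec_sub, ← Matrix.mulVec_mulVec, dotProduct_smul,
    smul_eq_mul, e]
  ring

include hreg

lemma smAt_comps_mul (h : PatchAt r φ x) (hx : x ∈ invLocus g₂) {X Y : ∀ x : M, Tan 𝕜 n x}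
    (hX : ∀ i, SmAt n r (vecComp φ X i) x) (hY : ∀ i, SmAt n r (vecComp φ Y i) x) (i : Fin n) :
    SmAt n r (vecComp φ (fun y => (inducedFrob g₁ g₂ Γ₁ Γ₂ τ d).mul y (X y) (Y y)) i) x := by
  have hR := det_opMat_ne_zero hp hq hreg h hx
  refine SmAt.congr (f := fun y => ∑ k, coComp φ g₂ y i k * dotProduct (fun i => vecComp φ X i y)
    ((cubic φ g₁ g₂ Γ₁ Γ₂ τ k y).mulVec fun j => vecComp φ Y j y)) (SmAt.sum fun k _ =>
    (hp.metric₂.smMatAt h i k).mul (smAt_bilin hX (smMatAt_cubic hp hq h hx hR k) hY)) ?_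
  filter_upwards [eventually_patch_invLocus h hp.metric₂ hx] with y hy
  refine (congrFun (comps_eq hy.1 hp.metric₂ hy.2 _) i).trans ?_
  change ∑ k, coComp φ g₂ y i k * covComp φ _ k = _
  refine Finset.sum_congr rfl fun k _ => ?_
  rw [covComp_flatForm_mul hp hq hreg hy.1 hy.2]
  rfl

lemma grading_mul_inducedFrob (hr : ∞ ≤ r) (hx : x ∈ invLocus g₂) {X Y : ∀ x : M, Tan 𝕜 n x}
    (hX : ∀ i, SmAt n r (vecComp (chartAt (Fin n → 𝕜) x) X i) x)
    (hY : ∀ i, SmAt n r (vecComp (chartAt (Fin n → 𝕜) x) Y i) x) :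
    (inducedFrob g₁ g₂ Γ₁ Γ₂ τ d).grading
        (fun y => (inducedFrob g₁ g₂ Γ₁ Γ₂ τ d).mul y (X y) (Y y)) x
      = (inducedFrob g₁ g₂ Γ₁ Γ₂ τ d).mul x ((inducedFrob g₁ g₂ Γ₁ Γ₂ τ d).grading X x) (Y x)
        + (inducedFrob g₁ g₂ Γ₁ Γ₂ τ d).mul x (X x)
          ((inducedFrob g₁ g₂ Γ₁ Γ₂ τ d).grading Y x) := by
  have h := patchAt_chartAt (𝕜 := 𝕜) (n := n) hr x
  have hR := det_opMat_ne_zero hp hq hreg h hx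
  set Z : ∀ x : M, Tan 𝕜 n x := fun y => (inducedFrob g₁ g₂ Γ₁ Γ₂ τ d).mul y (X y) (Y y) with hZdef
  have hZ := smAt_comps_mul hp hq hreg h hx hX hY
  have hgX := comps_grading (Γ₁ := Γ₁) (Γ₂ := Γ₂) hp hq h hX
  have hgY := comps_grading (Γ₁ := Γ₁) (Γ₂ := Γ₂) hp hq h hY
  have hgZ := comps_grading (Γ₁ := Γ₁) (Γ₂ := Γ₂) hp hq h hZ
  set φ := chartAt (Fin n → 𝕜) x
  have hH := hp.metric₂.smMatAt_coInv h hx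
  set E := gradient g₁ τ
  set P := dvec φ E x with hP
  -- the product in lowered components, near `x`
  have hζ : ∀ k, (fun y => dotProduct (fun i => (Pi.single k 1 : Fin n → 𝕜) i)
        ((coInv φ g₂ y).mulVec fun j => vecComp φ Z j y)) =ᶠ[𝓝 x] fun y =>
      dotProduct (fun i => vecComp φ X i y)
        ((cubic φ g₁ g₂ Γ₁ Γ₂ τ k y).mulVec fun j => vecComp φ Y j y) := by
    intro k
    filter_upwards [eventually_patch_invLocus h hp.metric₂ hx] with y hy
    refine Eq.trans ?_ (covComp_flatForm_mul hp hq hreg hy.1 hy.2 (X y) (Y y) k)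
    rw [covComp_flatForm hy.1 hp.metric₂ hy.2]
    exact single_one_dotProduct _ _
  have hD : ∀ k, _ := fun k => dirD_congr h.mem (hζ k) E
  have hcst : ∀ k i, dirD φ E (fun _ : M => (Pi.single k 1 : Fin n → 𝕜) i) x = 0 := fun k i => by
    simp only [dirD, pd_const, mul_zero, Finset.sum_const_zero]
  have e : ∀ v w : Fin n → 𝕜, dotProduct (P.transpose.mulVec v) w
        = dotProduct v (P.mulVec w) := fun v w => by
    rw [Matrix.dotProduct_mulVec, Matrix.mulVec_transpose]
  refine flatForm_injective hx (cotan_ext h (funext fun k => ?_))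
  have hlin : covComp φ (flatForm g₂ x ((inducedFrob g₁ g₂ Γ₁ Γ₂ τ d).mul x
      ((inducedFrob g₁ g₂ Γ₁ Γ₂ τ d).grading X x) (Y x)
        + (inducedFrob g₁ g₂ Γ₁ Γ₂ τ d).mul x (X x)
          ((inducedFrob g₁ g₂ Γ₁ Γ₂ τ d).grading Y x))) k
      = covComp φ (flatForm g₂ x ((inducedFrob g₁ g₂ Γ₁ Γ₂ τ d).mul x
      ((inducedFrob g₁ g₂ Γ₁ Γ₂ τ d).grading X x) (Y x))) k
        + covComp φ (flatForm g₂ x ((inducedFrob g₁ g₂ Γ₁ Γ₂ τ d).mul x (X x)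
          ((inducedFrob g₁ g₂ Γ₁ Γ₂ τ d).grading Y x))) k := by
    rw [map_add]
    rfl
  rw [hlin, covComp_flatForm_mul hp hq hreg h hx, covComp_flatForm_mul hp hq hreg h hx,
    covComp_flatForm h hp.metric₂ hx]
  have hL : (fun i => dcoord φ i x ((inducedFrob g₁ g₂ Γ₁ Γ₂ τ d).grading Z x))
    = comps φ ((inducedFrob g₁ g₂ Γ₁ Γ₂ τ d).grading Z x) := rfl
  have hXx : comps φ (X x) = fun i => vecComp φ X i x := rfl
  have hYx : comps φ (Y x) = fun i => vecComp φ Y i x := rfl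
  rw [hL, hgX, hgY, hgZ, hXx, hYx]
  have hDk := hD k
  rw [dirD_bilin h (fun i => smAt_const _) hH hZ, dirD_bilin h hX (smMatAt_cubic hp hq h hx hR k) hY,
    dirM_coInv₂ hp hq h hx, dirM_cubic hp hq h hx hR] at hDk
  have hzero : (fun i => dirD φ E (fun _ : M => (Pi.single k 1 : Fin n → 𝕜) i) x) = 0 :=
    funext (hcst k)
  have hζx : ∀ k, (coInv φ g₂ x).mulVec (fun j => vecComp φ Z j x) k
      = dotProduct (fun i => vecComp φ X i x)
        ((cubic φ g₁ g₂ Γ₁ Γ₂ τ k x).mulVec fun j => vecComp φ Y j x) := fun k =>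
    (single_one_dotProduct _ _).symm.trans (hζ k).self_of_nhds
  have hPζ : P.mulVec ((coInv φ g₂ x).mulVec (fun j => vecComp φ Z j x)) k
      = dotProduct (fun i => vecComp φ X i x)
        ((∑ s, P k s • cubic φ g₁ g₂ Γ₁ Γ₂ τ s x).mulVec fun j => vecComp φ Y j x) := by
    simp only [Matrix.sum_mulVec, Matrix.smul_mulVec, dotProduct_sum, dotProduct_smul, smul_eq_mul,
      ← hζx]
    rfl
  rw [hzero, zero_dotProduct, zero_add] at hDk
  have hone : ∀ v : Fin n → 𝕜, dotProduct (fun i => (Pi.single k 1 : Fin n → 𝕜) i) v = v k :=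
    fun v => single_one_dotProduct _ _
  simp only [Matrix.sub_mulVec, Matrix.smul_mulVec, add_dotProduct, sub_dotProduct, dotProduct_add,
    dotProduct_sub, Matrix.mulVec_add, Matrix.mulVec_sub, ← Matrix.mulVec_mulVec, dotProduct_smul,
    smul_eq_mul, e, hone, Pi.add_apply, Pi.sub_apply, Pi.smul_apply, ← hζx] at hDk ⊢
  linear_combination hDk + hPζ

end

section

variable {φ ψ : OpenPartialHomeomorph M (Fin n → 𝕜)} {x : M}

/-! ### Existence and uniqueness -/

variable [IsManifold 𝓘(𝕜, Fin n → 𝕜) r M]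

variable {g₁ g₂ : CoForm 𝕜 n M} {Γ₁ Γ₂ : Coeffs 𝕜 n M} {τ : M → 𝕜} {d : 𝕜}
variable (hr : ∞ ≤ r)
variable (hp : IsFlatPencil r g₁ g₂ Γ₁ Γ₂) (hq : IsQuasihomogeneous r g₁ g₂ τ d)
variable (hreg : IsRegular r g₁ g₂ τ d)

include hr hp hq hreg

lemma isFrobeniusOn_inducedFrob :
    (inducedFrob g₁ g₂ Γ₁ Γ₂ τ d).IsFrobeniusOn r (invLocus g₂) := by
  have hopen := hp.metric₂.isOpen hr
  have hc : ∀ x : M, PatchAt r (chartAt (Fin n → 𝕜) x) x := patchAt_chartAt hr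
  have hmul : ∀ x ∈ invLocus g₂, ∀ v w, flatForm g₂ x ((inducedFrob g₁ g₂ Γ₁ Γ₂ τ d).mul x v w)
      = formMul (chartAt (Fin n → 𝕜) x) g₁ g₂ Γ₁ Γ₂ τ d (flatForm g₂ x v) (flatForm g₂ x w) :=
    fun x hx v w => flatForm_mul hp hq hreg (hc x) hx v w
  have hR : ∀ x ∈ invLocus g₂, (regTensor (chartAt (Fin n → 𝕜) x) g₁ g₂ τ d x).det ≠ 0 :=
    fun x hx => hreg _ (hc x).patch x ⟨(hc x).mem, hx⟩
  have hcomm : ∀ x ∈ invLocus g₂, ∀ u v, (inducedFrob g₁ g₂ Γ₁ Γ₂ τ d).mul x u v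
      = (inducedFrob g₁ g₂ Γ₁ Γ₂ τ d).mul x v u := fun x hx u v => flatForm_injective hx (by
    rw [hmul x hx, hmul x hx, formMul_comm hp hq (hc x) hx (hR x hx)])
  have hsymm : ∀ x ∈ invLocus g₂, ∀ v w, flatForm g₂ x v w = flatForm g₂ x w v :=
    fun x hx v w => by
      rw [← apply_flatForm hp.metric₂ hx v w, ← apply_flatForm hp.metric₂ hx w v]
      exact ((hp.metric₂.symm x).eq _ _).symm
  refine
  { smooth_metric := fun φ hφ i j => smoothOn_of_smAt fun x hx => ?_
    smooth_mul := fun φ hφ i j k => smoothOn_of_smAt fun x hx => ?_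
    smooth_unit := fun φ hφ i => smoothOn_of_smAt fun x hx =>
      smAt_gradient₂ hp hq ⟨hr, hφ, hx.1⟩ i
    smooth_euler := fun φ hφ i => smoothOn_of_smAt fun x hx =>
      smAt_gradient₁ hp hq ⟨hr, hφ, hx.1⟩ i
    mul_comm := hcomm
    mul_assoc := fun x hx u v w => flatForm_injective hx ?_
    unit_mul := fun x hx u => flatForm_injective hx ?_
    symm := fun x hx => ⟨fun v w => hsymm x hx v w⟩
    nondegenerate := fun x hx => ?_
    invariant := fun x hx u v w => ?_
    flat := fun φ hφ x hx l k i j => riemann_inducedFrob hp ⟨hr, hφ, hx.1⟩ hx.2 l k i j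
    nabla_unit := fun φ hφ x hx i j => ?_
    nablaTri_symm := fun φ hφ x hx a σ =>
      nablaTri_inducedFrob_perm hp hq hreg ⟨hr, hφ, hx.1⟩ hx.2 a σ
    nablaNabla_euler := fun φ hφ x hx i j k =>
      nablaNablaVec_inducedFrob hp hq ⟨hr, hφ, hx.1⟩ hx.2 i j k
    grading_mul := fun V hV hVU X Y hX hY x hx =>
      grading_mul_inducedFrob hp hq hreg hr (hVU hx)
        (fun i => hX.smAt (hV.mem_nhds hx) (hc x) i) (fun i => hY.smAt (hV.mem_nhds hx) (hc x) i)
    grading_metric := fun V hV hVU X Y hX hY x hx =>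
      grading_metric_inducedFrob hp hq hr (hVU hx)
        (fun i => hX.smAt (hV.mem_nhds hx) (hc x) i) (fun i => hY.smAt (hV.mem_nhds hx) (hc x) i) }
  · have h : PatchAt r φ x := ⟨hr, hφ, hx.1⟩
    refine (hp.metric₂.smMatAt_coInv h hx.2 i j).congr ?_
    filter_upwards [metricComp_eventuallyEq (Γ₁ := Γ₁) (Γ₂ := Γ₂) (τ := τ) (d := d) hp h hx.2]
      with y hy
    rw [hy]
  · have h : PatchAt r φ x := ⟨hr, hφ, hx.1⟩
    refine SmAt.congr (f := fun y => ∑ l, coComp φ g₂ y k l * cubic φ g₁ g₂ Γ₁ Γ₂ τ l y i j)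
      (SmAt.sum fun l _ => (hp.metric₂.smMatAt h k l).mul
        (smMatAt_cubic hp hq h hx.2 (det_opMat_ne_zero hp hq hreg h hx.2) l i j)) ?_
    filter_upwards [eventually_patch_invLocus h hp.metric₂ hx.2] with y hy
      using mulComp_inducedFrob hp hq hreg hy.1 hy.2 i j k
  · rw [hmul x hx, hmul x hx, hmul x hx, hmul x hx, formMul_assoc hp hq (hc x) hx (hR x hx)]
  · rw [hmul x hx]
    have h1 : flatForm g₂ x ((inducedFrob g₁ g₂ Γ₁ Γ₂ τ d).unit x) = dform n τ x :=
      flatForm_sharp hx _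
    rw [h1, formMul_dform hp hq (hc x) hx (hR x hx)]
  · refine ⟨fun v hv => flatForm_injective hx (LinearMap.ext fun w => ?_),
      fun v hv => flatForm_injective hx (LinearMap.ext fun w => ?_)⟩
    · rw [map_zero]
      exact hv w
    · rw [map_zero, hsymm x hx]
      exact hv w
  · have h1 : ∀ u v w, flatForm g₂ x ((inducedFrob g₁ g₂ Γ₁ Γ₂ τ d).mul x u v) w
        = ∑ i, ∑ j, ∑ k, comps (chartAt (Fin n → 𝕜) x) u i * comps (chartAt (Fin n → 𝕜) x) v j
          * comps (chartAt (Fin n → 𝕜) x) w k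
          * (inducedFrob g₁ g₂ Γ₁ Γ₂ τ d).triComp (chartAt (Fin n → 𝕜) x) i j k x := by
      intro u v w
      rw [cotan_apply (hc x), dotProduct]
      simp only [covComp_flatForm_mul hp hq hreg (hc x) hx,
        triComp_inducedFrob hp hq hreg (hc x) hx, dotProduct, Matrix.mulVec, Finset.sum_mul,
        Finset.mul_sum]
      rw [Finset.sum_comm]
      refine Finset.sum_congr rfl fun i _ => ?_
      rw [Finset.sum_comm]
      exact Finset.sum_congr rfl fun j _ => Finset.sum_congr rfl fun k _ => by ring
    change flatForm g₂ x ((inducedFrob g₁ g₂ Γ₁ Γ₂ τ d).mul x u v) w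
      = flatForm g₂ x u ((inducedFrob g₁ g₂ Γ₁ Γ₂ τ d).mul x v w)
    rw [hsymm x hx u, hcomm x hx v w, h1, h1]
    rw [Finset.sum_comm_cycle]
    refine Finset.sum_congr rfl fun k _ => ?_
    rw [Finset.sum_comm]
    refine Finset.sum_congr rfl fun j _ => Finset.sum_congr rfl fun i _ => ?_
    rw [triComp_inducedFrob_swap hp hq hreg (hc x) hx i j k]
    ring
  · rw [← Matrix.zero_apply (α := 𝕜) i j, ← nvec_gradient₂ hp hq ⟨hr, hφ, hx.1⟩ hx.2]
    exact nablaVec_inducedFrob hp ⟨hr, hφ, hx.1⟩ hx.2 _ i j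

lemma isInduced_inducedFrob :
    (inducedFrob g₁ g₂ Γ₁ Γ₂ τ d).IsInduced r g₁ g₂ Γ₁ Γ₂ τ d where
  metric_eq x hx v w := apply_flatForm hp.metric₂ hx v w
  mul_dual φ hφ x hx v w := flatForm_mul hp hq hreg ⟨hr, hφ, hx.1⟩ hx.2 v w
  unit_eq _ _ := rfl
  euler_eq _ _ := rfl
  intersection_eq x hx v w := by
    have hc := patchAt_chartAt (𝕜 := 𝕜) (n := n) hr x
    refine Eq.symm ((congrArg (fun u => u (gradient g₁ τ x))
      (flatForm_mul hp hq hreg hc hx v w)).trans ?_)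
    exact formMul_euler hp hq hc hx (hreg _ hc.patch x ⟨hc.mem, hx⟩) _ _

omit hr hq hreg in
/-- The only nondegenerate metric that agrees with `g₂` as a form on the cotangent spaces is the inverse
of `g₂`. -/
lemma flatMap_eq_of_metricEq {F : FrobData 𝕜 n M} (hF : F.MetricEq g₂ (invLocus g₂))
    (hx : x ∈ invLocus g₂) (hs : (F.metric x).IsSymm) (hn : (F.metric x).Nondegenerate) :
    F.flatMap x = flatForm g₂ x := by
  have hinj : Function.Injective (F.flatMap x) := LinearMap.ker_eq_bot.1 hn.ker_eq_bot
  have hsurj : Function.Surjective (F.flatMap x) :=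
    (LinearMap.injective_iff_surjective_of_finrank_eq_finrank
      (Subspace.dual_finrank_eq (K := 𝕜) (V := Tan 𝕜 n x)).symm).1 hinj
  have key : ∀ b : Cotan 𝕜 n x, F.flatMap x (sharp g₂ x b) = b := by
    intro b
    obtain ⟨v, rfl⟩ := hsurj b
    ext w
    have h1 : F.flatMap x (sharp g₂ x (F.flatMap x v)) w
      = F.flatMap x w (sharp g₂ x (F.flatMap x v)) := (hs.eq _ _).symm
    rw [h1, apply_sharp]
    exact hF x hx v w
  ext v w
  rw [← sharp_flatForm hx v, key, flatForm_sharp hx]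

omit hreg hp hq hr in
lemma smoothVecOn_coordVec (hr : ∞ ≤ r) (hφ : IsPatch r φ) (i : Fin n) {V : Set M}
    (hV : V ⊆ φ.source) : SmoothVecOn r (fun y => coordVec φ i y) V := by
  intro ψ hψ a
  refine smoothOn_of_smAt fun x hx => ?_
  have h1 : PatchAt r φ x := ⟨hr, hφ, hV hx.2⟩
  have h2 : PatchAt r ψ x := ⟨hr, hψ, hx.1⟩
  refine (smAt_jac h1 h2 i a).congr ?_
  filter_upwards [h1.eventually, h2.eventually] with y h1 h2
  rw [vecComp, dcoord_eq_jac h1 h2]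
  simp [dcoord_coordVec h1]

/-- Uniqueness. The charge is recovered from the homogeneity of the metric, applied to coordinate fields
with `⟨∂_i, ∂_j⟩ ≠ 0`; this needs a positive dimension. -/
lemma sameOn_inducedFrob [Nonempty M] (hn : 0 < n) {F : FrobData 𝕜 n M}
    (hF : F.IsFrobeniusOn r (invLocus g₂)) (hI : F.IsInduced r g₁ g₂ Γ₁ Γ₂ τ d) :
    F.SameOn (inducedFrob g₁ g₂ Γ₁ Γ₂ τ d) (invLocus g₂) := by
  have hopen := hp.metric₂.isOpen hr
  have hmet : ∀ x ∈ invLocus g₂, F.metric x = flatForm g₂ x := fun x hx =>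
    flatMap_eq_of_metricEq hp hI.metric_eq hx (hF.symm x hx) (hF.nondegenerate x hx)
  have hflat : ∀ x ∈ invLocus g₂, F.flatMap x = flatForm g₂ x := hmet
  refine ⟨hmet, fun x hx => ?_, hI.unit_eq, hI.euler_eq, ?_⟩
  · have hc := patchAt_chartAt (𝕜 := 𝕜) (n := n) hr x
    refine LinearMap.ext₂ fun v w => flatForm_injective hx ?_
    have h1 := hI.mul_dual _ hc.patch x ⟨hc.mem, hx⟩ v w
    rw [hflat x hx] at h1
    rw [h1, flatForm_mul hp hq hreg hc hx]
  · obtain ⟨x, hx⟩ := hp.metric₂.dense.nonempty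
    have hc := patchAt_chartAt (𝕜 := 𝕜) (n := n) hr x
    set φ := chartAt (Fin n → 𝕜) x
    obtain ⟨i, j, hij⟩ : ∃ i j, coInv φ g₂ x i j ≠ 0 := by
      by_contra! h0
      have : Nonempty (Fin n) := ⟨⟨0, hn⟩⟩
      refine det_coInv_ne_zero hc hx ?_
      rw [show coInv φ g₂ x = 0 from Matrix.ext h0, Matrix.det_zero]
    have hV : IsOpen (φ.source ∩ invLocus g₂) := φ.open_source.inter hopen
    have hxV : x ∈ φ.source ∩ invLocus g₂ := ⟨hc.mem, hx⟩
    have hs : ∀ i, SmoothVecOn r (fun y => coordVec φ i y) (φ.source ∩ invLocus g₂) := fun i =>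
      smoothVecOn_coordVec hr hc.patch i Set.inter_subset_left
    have h1 := hF.grading_metric _ hV Set.inter_subset_right _ _ (hs i) (hs j) x hxV
    have h2 := (isFrobeniusOn_inducedFrob hr hp hq hreg).grading_metric _ hV
      Set.inter_subset_right _ _ (hs i) (hs j) x hxV
    have hE : F.euler =ᶠ[𝓝 x] gradient g₁ τ := by
      filter_upwards [hopen.mem_nhds hx] with y hy using hI.euler_eq y hy
    have hg : ∀ X, F.grading X x = (inducedFrob g₁ g₂ Γ₁ Γ₂ τ d).grading X x := fun X => by
      have := hE.mlieBracket_vectorField_eq (I := 𝓘(𝕜, Fin n → 𝕜)) (Filter.EventuallyEq.refl _ X)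
      exact congrArg (X x + ·) this
    have hd : dform n (fun y => F.metric y (coordVec φ i y) (coordVec φ j y)) x
        = dform n (fun y => flatForm g₂ y (coordVec φ i y) (coordVec φ j y)) x := by
      have : (fun y => F.metric y (coordVec φ i y) (coordVec φ j y)) =ᶠ[𝓝 x]
          fun y => flatForm g₂ y (coordVec φ i y) (coordVec φ j y) := by
        filter_upwards [hopen.mem_nhds hx] with y hy
        rw [hmet y hy]
      unfold dform
      rw [this.mfderiv_eq]
    rw [hg, hg, hd, hmet x hx, hI.euler_eq x hx] at h1
    have h3 : F.charge * flatForm g₂ x (coordVec φ i x) (coordVec φ j x)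
        = d * flatForm g₂ x (coordVec φ i x) (coordVec φ j x) :=
      add_left_cancel (h1.trans h2.symm)
    rw [flatForm_coordVec hc hx] at h3
    exact mul_right_cancel₀ hij h3

end

end FlatPencil

end

open FlatPencil in
theorem theorem2p1 {𝕜 : Type*} [RCLike 𝕜] (n : ℕ) (hn : 0 < n) (r : WithTop ℕ∞) (hr : ∞ ≤ r)
    (M : Type*) [TopologicalSpace M] [Nonempty M] [ChartedSpace (Fin n → 𝕜) M]
    [IsManifold (modelWithCornersSelf 𝕜 (Fin n → 𝕜)) r M]
    (g₁ g₂ : CoForm 𝕜 n M) (Γ₁ Γ₂ : Coeffs 𝕜 n M) (τ : M → 𝕜) (d : 𝕜)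
    (hpencil : IsFlatPencil r g₁ g₂ Γ₁ Γ₂) (hqh : IsQuasihomogeneous r g₁ g₂ τ d)
    (hreg : IsRegular r g₁ g₂ τ d) :
    ∃ F : FrobData 𝕜 n M,
      F.IsFrobeniusOn r (invLocus g₂) ∧ F.IsInduced r g₁ g₂ Γ₁ Γ₂ τ d ∧ F.charge = d ∧
      ∀ F' : FrobData 𝕜 n M, F'.IsFrobeniusOn r (invLocus g₂) →
        F'.IsInduced r g₁ g₂ Γ₁ Γ₂ τ d → F'.SameOn F (invLocus g₂) := by
  exact ⟨inducedFrob g₁ g₂ Γ₁ Γ₂ τ d, isFrobeniusOn_inducedFrob hr hpencil hqh hreg,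
    isInduced_inducedFrob hr hpencil hqh hreg, rfl,
    fun _ hF hI => sameOn_inducedFrob hr hpencil hqh hreg hn hF hI⟩
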